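/- Let $p$ be an odd prime and $N=2p-2$. Let $E(1)_*=\mathbb Z_{(p)}[v_1^{\pm1}]$ with $|v_1|=N$, and let $E(1)_*E(1)$ be the associated Hopf algebroid of the Adams summand $E(1)$ of $p$-local complex $K$-theory; concretely (Adams–Harris–Switzer), $E(1)_*E(1)$ is the ring of all $f\in\mathbb Q[u^{\pm1},v^{\pm1}]$ with $f(a^{p-1}t,b^{p-1}t)\in\mathbb Z_{(p)}[t^{\pm1}]$ for all $a,b\in\mathbb Z_{(p)}^\times$, with left and right units $v_1\mapsto u$, $v_1\mapsto v$. Let $\mathcal C$ be the category of quasi-periodic cochain complexes of period $N$ of graded $E(1)_*E(1)$-comodules concentrated in internal degrees divisible by $N$: cochain complexes $C^\bullet_*$ of such comodules together with an isomorphism $\tau: C^{n}_{k-N}\cong C^{n+N}_{k}$ of complexes of graded comodules; morphisms are the morphisms of complexes of graded comodules commuting with $\tau$. Let $\mathcal D$ be the derived category, i.e. the localization $\gamma:\mathcal C\to\mathcal D$ of $\mathcal C$ at the quasi-isomorphisms. The tensor product $C\otimes_{E(1)_*}D$ in $\mathcal C$ has $(C\otimes_{E(1)_*} D)^n=\bigoplus_{s+t=n}C^s\otimes_{E(1)_*}D^t$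 modulo $\tau x\otimes y=x\otimes\tau y$ (so that the sum is effectively over $s,t\in\mathbb Z/N$), with the diagonal coaction and $d(x\otimes y)=dx\otimes y+(-1)^{|x|}x\otimes dy$; it is a symmetric monoidal structure on $\mathcal C$ with symmetry $x\otimes y\mapsto(-1)^{|x||y|}y\otimes x$, where $|\cdot|$ is the cohomological degree. A complex in $\mathcal C$ is called flat if all its terms are flat over $E(1)_*$. Let $\mathcal C_{flat}\subset\mathcal C$ be the full subcategory of flat complexes, $K_{flat}$ its quotient by the homotopy relation ($f\sim g$ if $f-g=dh+hd$ for a comodule map $h$ of cohomological degree $-1$ and internal degree $0$ commuting with $\tau$), and $S$ the class of quasi-isomorphisms in $K_{flat}$. Then: 1. (Functorial flat replacement.) There are a functor $P:\mathcal C\to\mathcal C$ and a natural transformation $i:P\to\mathrm{id}_{\mathcal C}$ such that $P(C)$ is flat and $i_C:P(C)\to C$ is a quasi-isomorphism for every $C$. 2. The restriction $\gamma_{flat}=\gamma|_{\mathcal C_{flat}}$ factors through $\mathcal C_{flat}\to K_{flat}\to K_{flat}[S^{-1}]$, and the induced functor $K_{flat}[S^{-1}]\to\mathcal D$ is an equivalence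 of categories. 3. The tensor product in $\mathcal C$ has a left derived functor $\otimes^L_{E(1)_*}:\mathcal D\times\mathcal D\to\mathcal D$ which defines a symmetric monoidal structure on $\mathcal D$. More precisely, there are a symmetric monoidal structure on $\mathcal D$ with tensor product $\otimes^L_{E(1)_*}$, and a structure of lax symmetric monoidal functor on $\gamma$, such that the unit map $1_{\mathcal D}\to\gamma(1_{\mathcal C})$ is an isomorphism; the transformation $\mu_{C,D}:\gamma(C)\otimes^L_{E(1)_*}\gamma(D)\to\gamma(C\otimes_{E(1)_*}D)$ exhibits $\otimes^L_{E(1)_*}$ as the left derived functor of $\gamma(-\otimes_{E(1)_*}-)$, i.e. it is terminal among the functors $G:\mathcal D\times\mathcal D\to\mathcal D$ with a natural transformation $G\circ(\gamma\times\gamma)\to\gamma(-\otimes_{E(1)_*}-)$; and $\mu_{C,D}$ is an isomorphism whenever $C$ and $D$ are flat (so that $\otimes^L_{E(1)_*}$ is computed by flat replacement of both factors). -/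

import Mathlib

open CategoryTheory MonoidalCategory TensorProduct LaurentPolynomial

noncomputable section

namespace FrankeE1

/-- The ring `ℤ_(p)` of `p`-local integers, as a subring of `ℚ`. -/
def ZLoc (p : ℕ) : Subring ℚ where
  carrier := {x | p.Coprime x.den}
  mul_mem' {x y} hx hy :=
    Nat.Coprime.coprime_dvd_right (Rat.mul_den_dvd x y) (Nat.Coprime.mul_right hx hy)
  one_mem' := by simp
  add_mem' {x y} hx hy :=
    Nat.Coprime.coprime_dvd_right (Rat.add_den_dvd x y) (Nat.Coprime.mul_right hx hy)
  zero_mem' := by simp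
  neg_mem' {x} hx := by simpa using hx

/-- The degree `2p - 2` of `v₁`. -/
def qdeg (p : ℕ) : ℤ := 2 * (p : ℤ) - 2

lemma even_qdeg (p : ℕ) : Even (qdeg p) := ⟨(p : ℤ) - 1, by unfold qdeg; ring⟩

/-- The Laurent polynomial ring `ℤ_(p)[v, v⁻¹]`. -/
abbrev LaurentZ (p : ℕ) : Type := LaurentPolynomial (ZLoc p)

/-- `ℚ[v_1^{±1}, …, v_n^{±1}]`, the rationalisation of `E(1)_*(E(1)^{∧ (n - 1)})`. -/
abbrev RatLaurent (n : ℕ) : Type := AddMonoidAlgebra ℚ (Fin n → ℤ)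

/-- For units `a_1, …, a_n` of `ℤ_(p)`, the substitution
`f(v_1, …, v_n) ↦ f(a_1^{p-1} t, …, a_n^{p-1} t)` with values in `ℚ[t, t⁻¹]`. -/
def subst (p : ℕ) {n : ℕ} (a : Fin n → (ZLoc p)ˣ) : RatLaurent n →+* ℚ[T;T⁻¹] :=
  AddMonoidAlgebra.liftNCRingHom (LaurentPolynomial.C : ℚ →+* ℚ[T;T⁻¹])
    { toFun := fun e =>
        LaurentPolynomial.C (∏ i, ((((a i ^ (p - 1)) ^ (Multiplicative.toAdd e i) : (ZLoc p)ˣ) : ZLoc p) : ℚ)) *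
          LaurentPolynomial.T (∑ i, Multiplicative.toAdd e i)
      map_one' := by simp
      map_mul' := fun e e' => by
        simp only [toAdd_mul, Pi.add_apply, zpow_add, Units.val_mul, Subring.coe_mul,
          Finset.prod_mul_distrib, Finset.sum_add_distrib, LaurentPolynomial.T_add, map_mul]
        ring }
    (fun _ _ => Commute.all _ _)

lemma subst_single (p : ℕ) {n : ℕ} (a : Fin n → (ZLoc p)ˣ) (e : Fin n → ℤ) (r : ℚ) :
    subst p a (AddMonoidAlgebra.single e r) =
      LaurentPolynomial.C (r * ∏ i, ((((a i ^ (p - 1)) ^ (e i) : (ZLoc p)ˣ) : ZLoc p) : ℚ)) *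
        LaurentPolynomial.T (∑ i, e i) := by
  simp only [subst, AddMonoidAlgebra.liftNCRingHom_single]
  simp [map_mul, mul_assoc]

/-- The inclusion `ℤ_(p)[t, t⁻¹] ⊆ ℚ[t, t⁻¹]`. -/
def E1toRat (p : ℕ) : LaurentZ p →+* ℚ[T;T⁻¹] := AddMonoidAlgebra.mapRingHom ℤ (ZLoc p).subtype

lemma E1toRat_injective (p : ℕ) : Function.Injective (E1toRat p) := by
  intro x y h
  ext k
  have := congrArg (fun f => f.coeff k) h
  simpa [E1toRat] using this

/-- The ring of stably `p`-integral Laurent polynomials in `n` variables: all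
`f ∈ ℚ[v_1^{±1}, …, v_n^{±1}]` with `f(a_1^{p-1} t, …, a_n^{p-1} t) ∈ ℤ_(p)[t, t⁻¹]`
for all units `a_1, …, a_n` of `ℤ_(p)`. By the theorem of Adams, Harris and Switzer it is the ring
of homotopy groups of the `n`-fold smash power of `E(1)`. -/
def stablyIntegral (p n : ℕ) : Subring (RatLaurent n) :=
  ⨅ a : Fin n → (ZLoc p)ˣ, (E1toRat p).range.comap (subst p a)

lemma mem_stablyIntegral {p n : ℕ} {f : RatLaurent n} :
    f ∈ stablyIntegral p n ↔ ∀ a : Fin n → (ZLoc p)ˣ, ∃ g : LaurentZ p, E1toRat p g = subst p a f := by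
  simp [stablyIntegral, Subring.mem_iInf]

/-- The substitution of variables `v_i ↦ v_{σ i}`. -/
def changeVarsRat {m n : ℕ} (σ : Fin m → Fin n) : RatLaurent m →+* RatLaurent n :=
  AddMonoidAlgebra.mapDomainRingHom ℚ
    ({ toFun := fun e j => ∑ i with σ i = j, e i
       map_zero' := by ext; simp
       map_add' := fun e e' => by ext; simp [Finset.sum_add_distrib] } :
      (Fin m → ℤ) →+ (Fin n → ℤ))

lemma changeVarsRat_single {m n : ℕ} (σ : Fin m → Fin n) (e : Fin m → ℤ) (r : ℚ) :
    changeVarsRat σ (AddMonoidAlgebra.single e r) =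
      AddMonoidAlgebra.single (fun j => ∑ i with σ i = j, e i) r := by
  simp [changeVarsRat]

lemma subst_changeVarsRat (p : ℕ) {m n : ℕ} (σ : Fin m → Fin n) (a : Fin n → (ZLoc p)ˣ)
    (f : RatLaurent m) : subst p a (changeVarsRat σ f) = subst p (a ∘ σ) f := by
  induction f using AddMonoidAlgebra.induction_linear with
  | zero => simp
  | add f g hf hg => simp [hf, hg]
  | single e r =>
    have key : ∀ g : (ZLoc p)ˣ, ∀ s : Finset (Fin m), g ^ (∑ i ∈ s, e i) = ∏ i ∈ s, g ^ e i :=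
      fun g s => by
        classical
        induction s using Finset.induction_on with
        | empty => simp
        | insert i s hi ih => rw [Finset.sum_insert hi, Finset.prod_insert hi, zpow_add, ih]
    rw [changeVarsRat_single, subst_single, subst_single]
    congr 2
    · have h : (∏ j, (a j ^ (p - 1)) ^ (∑ i with σ i = j, e i)) =
          ∏ i, ((a ∘ σ) i ^ (p - 1)) ^ e i := by
        rw [← Finset.prod_fiberwise Finset.univ σ]
        refine Finset.prod_congr rfl fun j _ => ?_
        rw [key]
        refine Finset.prod_congr rfl fun i hi => ?_
        rw [← (Finset.mem_filter.mp hi).2, Function.comp_apply]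
      have h' := congrArg (((ZLoc p).subtype : ZLoc p →* ℚ).comp (Units.coeHom _)) h
      rw [map_prod, map_prod] at h'
      exact congrArg (r * ·) h'
    · rw [Finset.sum_fiberwise]

/-- The substitution `v_i ↦ v_{σ i}` on stably integral Laurent polynomials. -/
def changeVars (p : ℕ) {m n : ℕ} (σ : Fin m → Fin n) : stablyIntegral p m →+* stablyIntegral p n :=
  (changeVarsRat σ).restrict _ _ fun f hf => mem_stablyIntegral.mpr fun a => by
    rw [subst_changeVarsRat]
    exact mem_stablyIntegral.mp hf _

lemma coe_changeVars (p : ℕ) {m n : ℕ} (σ : Fin m → Fin n) (f : stablyIntegral p m) :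
    (changeVars p σ f : RatLaurent n) = changeVarsRat σ f := rfl

/-- The `i`-th unit `E(1)_* → ℚ[v_1^{±1}, …, v_n^{±1}]`, `v ↦ v_i`. -/
def unitRat (p : ℕ) {n : ℕ} (i : Fin n) : LaurentZ p →+* RatLaurent n :=
  (AddMonoidAlgebra.mapDomainRingHom ℚ (AddMonoidHom.single (fun _ : Fin n => ℤ) i)).comp (E1toRat p)

lemma unitRat_single (p : ℕ) {n : ℕ} (i : Fin n) (k : ℤ) (r : ZLoc p) :
    unitRat p i (AddMonoidAlgebra.single k r) = AddMonoidAlgebra.single (Pi.single i k) (r : ℚ) := by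
  simp [unitRat, E1toRat, -LaurentPolynomial.single_eq_C_mul_T]

lemma unitRat_mem (p : ℕ) {n : ℕ} (i : Fin n) (x : LaurentZ p) : unitRat p i x ∈ stablyIntegral p n := by
  induction x using AddMonoidAlgebra.induction_linear with
  | zero => simp
  | add f g hf hg => simpa using add_mem hf hg
  | single k r =>
    refine mem_stablyIntegral.mpr fun a => ⟨AddMonoidAlgebra.single k
      (r * ((a i ^ (p - 1)) ^ k : (ZLoc p)ˣ)), ?_⟩
    rw [unitRat_single, subst_single, Finset.prod_eq_single i, Finset.sum_eq_single i]
    · simp only [E1toRat, AddMonoidAlgebra.mapRingHom_single, Pi.single_eq_same]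
      simp
    · intro j _ hj; simp [hj]
    · simp
    · intro j _ hj; simp [hj]
    · simp

/-- The `i`-th unit `E(1)_* → π_*(E(1)^{∧ n})`, `v ↦ v_i`. -/
def unitMap (p : ℕ) {n : ℕ} (i : Fin n) : LaurentZ p →+* stablyIntegral p n :=
  (unitRat p i).codRestrict _ (unitRat_mem p i)

lemma coe_unitMap (p : ℕ) {n : ℕ} (i : Fin n) (x : LaurentZ p) :
    (unitMap p i x : RatLaurent n) = unitRat p i x := rfl

lemma changeVars_unitMap (p : ℕ) {m n : ℕ} (σ : Fin m → Fin n) (i : Fin m) (x : LaurentZ p) :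
    changeVars p σ (unitMap p i x) = unitMap p (σ i) x := by
  apply Subtype.ext
  rw [coe_changeVars, coe_unitMap, coe_unitMap]
  induction x using AddMonoidAlgebra.induction_linear with
  | zero => simp
  | add f g hf hg => simp [hf, hg]
  | single k r =>
    rw [unitRat_single, unitRat_single, changeVarsRat_single]
    congr 1
    ext j
    by_cases h : σ i = j
    · subst h
      rw [Finset.sum_eq_single i] <;> simp +contextual
    · rw [Pi.single_eq_of_ne (Ne.symm h)]
      refine Finset.sum_eq_zero fun l hl => Pi.single_eq_of_ne ?_ _
      rintro rfl
      exact h (Finset.mem_filter.mp hl).2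

/-- The counit `f ↦ f(t, …, t)` from stably integral Laurent polynomials to `ℤ_(p)[v, v⁻¹]`. -/
def counitMap (p n : ℕ) : stablyIntegral p n →+* LaurentZ p :=
  ((RingEquiv.ofBijective (E1toRat p).rangeRestrict
      ⟨fun _ _ h => E1toRat_injective p (congrArg Subtype.val h),
        (E1toRat p).rangeRestrict_surjective⟩).symm : (E1toRat p).range →+* LaurentZ p).comp
    ((subst p (1 : Fin n → (ZLoc p)ˣ)).restrict (stablyIntegral p n) (E1toRat p).range
      fun _ hf => mem_stablyIntegral.mp hf 1)

lemma E1toRat_counitMap (p n : ℕ) (f : stablyIntegral p n) :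
    E1toRat p (counitMap p n f) = subst p 1 (f : RatLaurent n) := by
  have := (RingEquiv.ofBijective (E1toRat p).rangeRestrict
      ⟨fun _ _ h => E1toRat_injective p (congrArg Subtype.val h),
        (E1toRat p).rangeRestrict_surjective⟩).apply_symm_apply
    ((subst p (1 : Fin n → (ZLoc p)ˣ)).restrict (stablyIntegral p n) (E1toRat p).range
      (fun _ hf => mem_stablyIntegral.mp hf 1) f)
  exact congrArg Subtype.val this

lemma counitMap_unitMap (p : ℕ) {n : ℕ} (i : Fin n) (x : LaurentZ p) :
    counitMap p n (unitMap p i x) = x := by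
  apply E1toRat_injective
  rw [E1toRat_counitMap, coe_unitMap]
  induction x using AddMonoidAlgebra.induction_linear with
  | zero => simp
  | add f g hf hg => simp [hf, hg]
  | single k r =>
    rw [unitRat_single, subst_single, Finset.sum_eq_single i]
    · simp [E1toRat, -LaurentPolynomial.single_eq_C_mul_T]
      simp
    · intro j _ hj; simp [hj]
    · simp

/-- The structure of a (flat) Hopf algebroid `(A, Γ)` as far as it enters the definition of left
comodules and of their tensor product. The algebra structure on `Γ` is the right unit `η_R`, the ring
`Γ₃` stands for `Γ ⊗_A Γ` (an `A`-algebra by the right unit of the right factor), `unitL` is the left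
unit `η_L`, and `inl`, `inr` are the inclusions `g ↦ g ⊗ 1`, `g ↦ 1 ⊗ g` of the factors. -/
structure HopfAlgebroid (A Γ Γ₃ : Type) [CommRing A] [CommRing Γ] [CommRing Γ₃]
    [Algebra A Γ] [Algebra A Γ₃] where
  unitL : A →+* Γ
  inl : Γ →+* Γ₃
  inr : Γ →ₐ[A] Γ₃
  comul : Γ →ₐ[A] Γ₃
  counit : Γ →ₐ[A] A
  inl_unitR : ∀ a, inl (algebraMap A Γ a) = inr (unitL a)
  comul_unitL : ∀ a, comul (unitL a) = inl (unitL a)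
  counit_unitL : ∀ a, counit (unitL a) = a

section Coaction

variable {A Γ Γ₃ : Type} [CommRing A] [CommRing Γ] [CommRing Γ₃] [Algebra A Γ] [Algebra A Γ₃]

/-- For a map `ψ : M → Γ ⊗_A M` that is semilinear along the left unit, the map
`1 ⊗ ψ : Γ ⊗_A M → Γ ⊗_A Γ ⊗_A M = Γ₃ ⊗_A M`. -/
def HopfAlgebroid.oneTensor (H : HopfAlgebroid A Γ Γ₃) {M : Type} [AddCommGroup M] [Module A M]
    (ψ : M →+ Γ ⊗[A] M) (hψ : ∀ (a : A) (m : M), ψ (a • m) = H.unitL a • ψ m) :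
    Γ ⊗[A] M →+ Γ₃ ⊗[A] M :=
  TensorProduct.liftAddHom
    { toFun := fun g =>
        { toFun := fun m => H.inl g • H.inr.toLinearMap.rTensor M (ψ m)
          map_zero' := by simp
          map_add' := by simp }
      map_zero' := by ext; simp
      map_add' := fun g h => by ext; simp [add_smul] }
    (fun a g m => by
      have key : ∀ (s : Γ) (x : Γ ⊗[A] M), H.inr.toLinearMap.rTensor M (s • x) =
          H.inr s • H.inr.toLinearMap.rTensor M x := fun s x => by
        induction x using TensorProduct.induction_on with
        | zero => simp
        | tmul t m => simp [TensorProduct.smul_tmul']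
        | add x y hx hy => simp only [smul_add, map_add, hx, hy]
      simp only [AddMonoidHom.coe_mk, ZeroHom.coe_mk]
      rw [hψ, key, ← H.inl_unitR, smul_smul, Algebra.smul_def, map_mul, mul_comm])

/-- A left coaction of the Hopf algebroid `(A, Γ)` on the `A`-module `M`: a counital and
coassociative map `ψ : M → Γ ⊗_A M` which is `A`-linear for the left unit. -/
structure Coaction (H : HopfAlgebroid A Γ Γ₃) (M : Type) [AddCommGroup M] [Module A M] where
  toHom : M →+ Γ ⊗[A] M
  semilinear : ∀ (a : A) (m : M), toHom (a • m) = H.unitL a • toHom m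
  counit : ∀ m, TensorProduct.lid A M (H.counit.toLinearMap.rTensor M (toHom m)) = m
  coassoc : ∀ m, H.comul.toLinearMap.rTensor M (toHom m) = H.oneTensor toHom semilinear (toHom m)

lemma HopfAlgebroid.oneTensor_tmul (H : HopfAlgebroid A Γ Γ₃) {M : Type} [AddCommGroup M]
    [Module A M] (ψ : M →+ Γ ⊗[A] M) (hψ : ∀ (a : A) (m : M), ψ (a • m) = H.unitL a • ψ m)
    (g : Γ) (m : M) :
    H.oneTensor ψ hψ (g ⊗ₜ m) = H.inl g • H.inr.toLinearMap.rTensor M (ψ m) := rfl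

lemma rTensor_smul' {S S' : Type} [CommRing S] [CommRing S'] [Algebra A S] [Algebra A S']
    (f : S →ₐ[A] S') {M : Type} [AddCommGroup M] [Module A M] (s : S) (x : S ⊗[A] M) :
    f.toLinearMap.rTensor M (s • x) = f s • f.toLinearMap.rTensor M x := by
  induction x using TensorProduct.induction_on with
  | zero => simp
  | tmul t m => simp [TensorProduct.smul_tmul']
  | add x y hx hy => simp only [smul_add, map_add, hx, hy]

lemma lTensor_smul' {S : Type} [CommRing S] [Algebra A S] {M N : Type} [AddCommGroup M]
    [AddCommGroup N] [Module A M] [Module A N] (f : M →ₗ[A] N) (s : S) (x : S ⊗[A] M) :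
    f.lTensor S (s • x) = s • f.lTensor S x := by
  induction x using TensorProduct.induction_on with
  | zero => simp
  | tmul t m => simp [TensorProduct.smul_tmul']
  | add x y hx hy => simp only [smul_add, map_add, hx, hy]

end Coaction

section Pairing

variable {A B : Type} [CommRing A] [CommRing B] [Algebra A B]
variable (S : Type) [CommRing S] [Algebra A S]
variable (M N P : Type) [AddCommGroup M] [AddCommGroup N] [AddCommGroup P]
  [Module A M] [Module B M] [IsScalarTower A B M]
  [Module A N] [Module B N] [IsScalarTower A B N]
  [Module A P] [Module B P] [IsScalarTower A B P]

/-- The pairing `(S ⊗_A M) × (S ⊗_A N) → S ⊗_A (M ⊗_B N)`,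
`(s ⊗ m, t ⊗ n) ↦ s t ⊗ (m ⊗ n)`. -/
def pairing : (S ⊗[A] M) →ₗ[S] (S ⊗[A] N) →ₗ[S] (S ⊗[A] (M ⊗[B] N)) :=
  LinearMap.liftBaseChange S
    ((LinearMap.baseChangeHom A S N (M ⊗[B] N)).comp
      (LinearMap.mk₂ A (fun m n => m ⊗ₜ[B] n)
        (fun _ _ _ => TensorProduct.add_tmul _ _ _)
        (fun _ _ _ => TensorProduct.smul_tmul' _ _ _)
        (fun _ _ _ => TensorProduct.tmul_add _ _ _)
        (fun a m n => by
          rw [← algebraMap_smul B a n, TensorProduct.tmul_smul, algebraMap_smul])))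

variable {S M N P}

@[simp] lemma pairing_tmul (s t : S) (m : M) (n : N) :
    pairing (B := B) S M N (s ⊗ₜ m) (t ⊗ₜ n) = (s * t) ⊗ₜ[A] (m ⊗ₜ[B] n) := by
  simp [pairing, TensorProduct.smul_tmul']
  rfl

/-- The scalar `b ∈ B` as an `A`-linear endomorphism. -/
def scalarMap (A : Type) {B : Type} [CommRing A] [CommRing B] [Algebra A B] (M : Type)
    [AddCommGroup M] [Module A M] [Module B M] [IsScalarTower A B M] (b : B) : M →ₗ[A] M :=
  (LinearMap.lsmul B M b).restrictScalars A

@[simp] lemma scalarMap_apply (b : B) (m : M) : scalarMap A M b m = b • m := rfl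

lemma pairing_scalar (b : B) (x : S ⊗[A] M) (y : S ⊗[A] N) :
    pairing (B := B) S M N ((scalarMap A M b).lTensor S x) y =
      pairing (B := B) S M N x ((scalarMap A N b).lTensor S y) := by
  induction x using TensorProduct.induction_on with
  | zero => simp
  | add x x' hx hx' => simp only [map_add, LinearMap.add_apply, hx, hx']
  | tmul s m =>
    induction y using TensorProduct.induction_on with
    | zero => simp
    | add y y' hy hy' => simp only [map_add, hy, hy']
    | tmul t n => simp [TensorProduct.smul_tmul]

lemma pairing_scalar' (b : B) (x : S ⊗[A] M) (y : S ⊗[A] N) :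
    pairing (B := B) S M N ((scalarMap A M b).lTensor S x) y =
      (scalarMap A (M ⊗[B] N) b).lTensor S (pairing (B := B) S M N x y) := by
  induction x using TensorProduct.induction_on with
  | zero => simp
  | add x x' hx hx' => simp only [map_add, LinearMap.add_apply, hx, hx']
  | tmul s m =>
    induction y using TensorProduct.induction_on with
    | zero => simp
    | add y y' hy hy' => simp only [map_add, hy, hy']
    | tmul t n => simp [TensorProduct.smul_tmul']

lemma pairing_map {M' N' : Type} [AddCommGroup M'] [AddCommGroup N']
    [Module A M'] [Module B M'] [IsScalarTower A B M']
    [Module A N'] [Module B N'] [IsScalarTower A B N'] (f : M →ₗ[B] M') (g : N →ₗ[B] N')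
    (x : S ⊗[A] M) (y : S ⊗[A] N) :
    ((TensorProduct.map f g).restrictScalars A).lTensor S (pairing (B := B) S M N x y) =
      pairing (B := B) S M' N' ((f.restrictScalars A).lTensor S x)
        ((g.restrictScalars A).lTensor S y) := by
  induction x using TensorProduct.induction_on with
  | zero => simp
  | add x x' hx hx' => simp only [map_add, LinearMap.add_apply, hx, hx']
  | tmul s m =>
    induction y using TensorProduct.induction_on with
    | zero => simp
    | add y y' hy hy' => simp only [map_add, hy, hy']
    | tmul t n => simp

lemma pairing_assoc (x : S ⊗[A] M) (y : S ⊗[A] N) (z : S ⊗[A] P) :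
    ((TensorProduct.assoc B M N P).toLinearMap.restrictScalars A).lTensor S
      (pairing (B := B) S (M ⊗[B] N) P (pairing (B := B) S M N x y) z) =
      pairing (B := B) S M (N ⊗[B] P) x (pairing (B := B) S N P y z) := by
  induction x using TensorProduct.induction_on with
  | zero => simp
  | add x x' hx hx' => simp only [map_add, LinearMap.add_apply, hx, hx']
  | tmul s m =>
    induction y using TensorProduct.induction_on with
    | zero => simp
    | add y y' hy hy' => simp only [map_add, LinearMap.add_apply, hy, hy']
    | tmul t n =>
      induction z using TensorProduct.induction_on with
      | zero => simp
      | add y y' hy hy' => simp only [map_add, hy, hy']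
      | tmul u k => simp [mul_assoc]

lemma pairing_comm (x : S ⊗[A] M) (y : S ⊗[A] N) :
    ((TensorProduct.comm B M N).toLinearMap.restrictScalars A).lTensor S
      (pairing (B := B) S M N x y) = pairing (B := B) S N M y x := by
  induction x using TensorProduct.induction_on with
  | zero => simp
  | add x x' hx hx' => simp only [map_add, LinearMap.add_apply, hx, hx']
  | tmul s m =>
    induction y using TensorProduct.induction_on with
    | zero => simp
    | add y y' hy hy' => simp only [map_add, LinearMap.add_apply, hy, hy']
    | tmul t n => simp [mul_comm]

lemma pairing_rTensor {S' : Type} [CommRing S'] [Algebra A S'] (f : S →ₐ[A] S')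
    (x : S ⊗[A] M) (y : S ⊗[A] N) :
    f.toLinearMap.rTensor (M ⊗[B] N) (pairing (B := B) S M N x y) =
      pairing (B := B) S' M N (f.toLinearMap.rTensor M x) (f.toLinearMap.rTensor N y) := by
  induction x using TensorProduct.induction_on with
  | zero => simp
  | add x x' hx hx' => simp only [map_add, LinearMap.add_apply, hx, hx']
  | tmul s m =>
    induction y using TensorProduct.induction_on with
    | zero => simp
    | add y y' hy hy' => simp only [map_add, hy, hy']
    | tmul t n => simp

lemma pairing_lid (x : A ⊗[A] M) (y : A ⊗[A] N) :
    TensorProduct.lid A (M ⊗[B] N) (pairing (B := B) A M N x y) =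
      TensorProduct.lid A M x ⊗ₜ[B] TensorProduct.lid A N y := by
  induction x using TensorProduct.induction_on with
  | zero => simp
  | add x x' hx hx' => simp only [map_add, LinearMap.add_apply, hx, hx', TensorProduct.add_tmul]
  | tmul s m =>
    induction y using TensorProduct.induction_on with
    | zero => simp
    | add y y' hy hy' => simp only [map_add, hy, hy', TensorProduct.tmul_add]
    | tmul t n =>
      simp only [pairing_tmul, TensorProduct.lid_tmul]
      rw [← algebraMap_smul B t n, TensorProduct.tmul_smul, algebraMap_smul, mul_comm, mul_smul,
        TensorProduct.smul_tmul']

end Pairing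

section TensorCoaction

variable {A Γ Γ₃ : Type} [CommRing A] [CommRing Γ] [CommRing Γ₃] [Algebra A Γ] [Algebra A Γ₃]
  {H : HopfAlgebroid A Γ Γ₃}
variable {M N P : Type} [AddCommGroup M] [AddCommGroup N] [AddCommGroup P]
  [Module A M] [Module A[T;T⁻¹] M] [IsScalarTower A A[T;T⁻¹] M]
  [Module A N] [Module A[T;T⁻¹] N] [IsScalarTower A A[T;T⁻¹] N]
  [Module A P] [Module A[T;T⁻¹] P] [IsScalarTower A A[T;T⁻¹] P]

/-- The coaction commutes with the action of the powers of `T`. -/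
def Coaction.Periodic (ψ : Coaction H M) : Prop :=
  ∀ (k : ℤ) (m : M), ψ.toHom ((T k : A[T;T⁻¹]) • m) =
    (scalarMap A M (T k : A[T;T⁻¹])).lTensor Γ (ψ.toHom m)

lemma C_smul_eq (a : A) (m : M) : (C a : A[T;T⁻¹]) • m = a • m := by
  rw [LaurentPolynomial.C_eq_algebraMap, algebraMap_smul]

lemma Coaction.Periodic.map_monomial {ψ : Coaction H M} (h : ψ.Periodic) (a : A) (k : ℤ) (m : M) :
    ψ.toHom ((C a * T k : A[T;T⁻¹]) • m) =
      H.unitL a • (scalarMap A M (T k : A[T;T⁻¹])).lTensor Γ (ψ.toHom m) := by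
  rw [mul_smul, C_smul_eq, ψ.semilinear, h]

lemma Coaction.Periodic.balanced {ψ : Coaction H M} {φ : Coaction H N} (h : ψ.Periodic)
    (h' : φ.Periodic) (b : A[T;T⁻¹]) (m : M) (n : N) :
    pairing (B := A[T;T⁻¹]) Γ M N (ψ.toHom (b • m)) (φ.toHom n) =
      pairing (B := A[T;T⁻¹]) Γ M N (ψ.toHom m) (φ.toHom (b • n)) := by
  induction b using LaurentPolynomial.induction_on' with
  | add b c hb hc => simp only [add_smul, map_add, LinearMap.add_apply, hb, hc]
  | C_mul_T k a =>
    rw [h.map_monomial, h'.map_monomial, map_smul, map_smul, LinearMap.smul_apply, pairing_scalar]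

/-- The diagonal coaction `m ⊗ n ↦ m₍₋₁₎ n₍₋₁₎ ⊗ (m₍₀₎ ⊗ n₍₀₎)` as an additive map. -/
def tensorHom' (ψ : Coaction H M) (φ : Coaction H N) (h : ψ.Periodic) (h' : φ.Periodic) :
    M ⊗[A[T;T⁻¹]] N →+ Γ ⊗[A] (M ⊗[A[T;T⁻¹]] N) :=
  TensorProduct.liftAddHom
    { toFun := fun m =>
        { toFun := fun n => pairing (B := A[T;T⁻¹]) Γ M N (ψ.toHom m) (φ.toHom n)
          map_zero' := by simp
          map_add' := by simp }
      map_zero' := by ext; simp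
      map_add' := fun g h => by ext; simp }
    (fun b m n => h.balanced h' b m n)

@[simp] lemma tensorHom'_tmul (ψ : Coaction H M) (φ : Coaction H N) (h : ψ.Periodic)
    (h' : φ.Periodic) (m : M) (n : N) : tensorHom' ψ φ h h' (m ⊗ₜ n) =
      pairing (B := A[T;T⁻¹]) Γ M N (ψ.toHom m) (φ.toHom n) := rfl

lemma pairing_oneTensor (ψ : Coaction H M) (φ : Coaction H N) (h : ψ.Periodic) (h' : φ.Periodic)
    (hs) (x : Γ ⊗[A] M) (y : Γ ⊗[A] N) :
    H.oneTensor (tensorHom' ψ φ h h') hs (pairing (B := A[T;T⁻¹]) Γ M N x y) =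
      pairing (B := A[T;T⁻¹]) Γ₃ M N (H.oneTensor ψ.toHom ψ.semilinear x)
        (H.oneTensor φ.toHom φ.semilinear y) := by
  induction x using TensorProduct.induction_on with
  | zero => simp
  | add x x' hx hx' => simp only [map_add, LinearMap.add_apply, hx, hx']
  | tmul s m =>
    induction y using TensorProduct.induction_on with
    | zero => simp
    | add y y' hy hy' => simp only [map_add, hy, hy']
    | tmul t n =>
      simp only [pairing_tmul, HopfAlgebroid.oneTensor_tmul, tensorHom'_tmul, map_mul, map_smul,
        LinearMap.smul_apply, pairing_rTensor, mul_smul]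
      exact smul_comm _ _ _

/-- The diagonal coaction on the tensor product. -/
def Coaction.tensor (ψ : Coaction H M) (φ : Coaction H N) (h : ψ.Periodic) (h' : φ.Periodic) :
    Coaction H (M ⊗[A[T;T⁻¹]] N) where
  toHom := tensorHom' ψ φ h h'
  semilinear a x := by
    induction x using TensorProduct.induction_on with
    | zero => simp
    | add x x' hx hx' => simp only [map_add, smul_add, hx, hx']
    | tmul m n => simp [TensorProduct.smul_tmul', ψ.semilinear]
  counit x := by
    induction x using TensorProduct.induction_on with
    | zero => simp
    | add x x' hx hx' => simp only [map_add, hx, hx']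
    | tmul m n => rw [tensorHom'_tmul, pairing_rTensor, pairing_lid, ψ.counit, φ.counit]
  coassoc x := by
    induction x using TensorProduct.induction_on with
    | zero => simp
    | add x x' hx hx' => simp only [map_add, hx, hx']
    | tmul m n =>
      rw [tensorHom'_tmul, pairing_rTensor, pairing_oneTensor, ψ.coassoc, φ.coassoc]

lemma Coaction.tensor_tmul (ψ : Coaction H M) (φ : Coaction H N) (h : ψ.Periodic)
    (h' : φ.Periodic) (m : M) (n : N) : (ψ.tensor φ h h').toHom (m ⊗ₜ n) =
      pairing (B := A[T;T⁻¹]) Γ M N (ψ.toHom m) (φ.toHom n) := rfl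

lemma Coaction.tensor_periodic (ψ : Coaction H M) (φ : Coaction H N) (h : ψ.Periodic)
    (h' : φ.Periodic) : (ψ.tensor φ h h').Periodic := fun k x => by
  induction x using TensorProduct.induction_on with
  | zero => simp
  | add x x' hx hx' => simp only [map_add, smul_add, hx, hx']
  | tmul m n =>
    rw [TensorProduct.smul_tmul', Coaction.tensor_tmul, Coaction.tensor_tmul, h, pairing_scalar']

variable (H) in
/-- The coaction on `A[T, T⁻¹]` with `a T^k ↦ η_L(a) ⊗ T^k`. -/
def unitHom : A[T;T⁻¹] →+* Γ ⊗[A] A[T;T⁻¹] :=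
  AddMonoidAlgebra.liftNCRingHom
    ((Algebra.TensorProduct.includeLeftRingHom : Γ →+* Γ ⊗[A] A[T;T⁻¹]).comp H.unitL)
    { toFun := fun k => 1 ⊗ₜ T (Multiplicative.toAdd k)
      map_one' := by simp; rfl
      map_mul' := fun k l => by
        rw [toAdd_mul, T_add, Algebra.TensorProduct.tmul_mul_tmul, one_mul] }
    (fun _ _ => Commute.all _ _)

@[simp] lemma unitHom_monomial (a : A) (k : ℤ) :
    unitHom H (C a * T k) = H.unitL a ⊗ₜ[A] (T k : A[T;T⁻¹]) := by
  rw [← LaurentPolynomial.single_eq_C_mul_T, unitHom, AddMonoidAlgebra.liftNCRingHom_single]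
  simp

lemma unitHom_smul (a : A) (b : A[T;T⁻¹]) : unitHom H (a • b) = H.unitL a • unitHom H b := by
  induction b using LaurentPolynomial.induction_on' with
  | add b c hb hc => simp only [smul_add, map_add, hb, hc]
  | C_mul_T k c =>
    rw [LaurentPolynomial.smul_eq_C_mul, ← mul_assoc, ← map_mul, unitHom_monomial, unitHom_monomial,
      map_mul, TensorProduct.smul_tmul', smul_eq_mul]

variable (H) in
/-- The coaction on `A[T, T⁻¹]` with `a T^k ↦ η_L(a) ⊗ T^k`. -/
def unitCoaction : Coaction H A[T;T⁻¹] where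
  toHom := unitHom H
  semilinear := fun a b => unitHom_smul a b
  counit b := by
    induction b using LaurentPolynomial.induction_on' with
    | add b c hb hc => simp only [map_add, hb, hc]
    | C_mul_T k c =>
      simp [H.counit_unitL, LaurentPolynomial.smul_eq_C_mul]
  coassoc b := by
    induction b using LaurentPolynomial.induction_on' with
    | add b c hb hc => simp only [map_add, hb, hc]
    | C_mul_T k c =>
      have h1 : unitHom H (T k) = 1 ⊗ₜ[A] (T k : A[T;T⁻¹]) := by
        simpa using unitHom_monomial (H := H) 1 k
      change H.comul.toLinearMap.rTensor _ (unitHom H _) = H.oneTensor _ _ (unitHom H _)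
      rw [unitHom_monomial]
      refine Eq.trans ?_ (H.oneTensor_tmul _ _ _ _).symm
      change _ = H.inl _ • H.inr.toLinearMap.rTensor _ (unitHom H _)
      simp [h1, H.comul_unitL, TensorProduct.smul_tmul']

lemma unitCoaction_periodic : (unitCoaction H).Periodic := fun k b => by
  induction b using LaurentPolynomial.induction_on' with
  | add b c hb hc => simp only [map_add, smul_add, hb, hc]
  | C_mul_T l c =>
    change unitHom H _ = (scalarMap A A[T;T⁻¹] (T k)).lTensor Γ (unitHom H _)
    rw [smul_eq_mul, mul_left_comm, ← T_add, unitHom_monomial, unitHom_monomial,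
      LinearMap.lTensor_tmul, scalarMap_apply, smul_eq_mul, ← T_add]

lemma pairing_unit_left (a : A) (k : ℤ) (x : Γ ⊗[A] M) :
    ((TensorProduct.lid A[T;T⁻¹] M).toLinearMap.restrictScalars A).lTensor Γ
      (pairing (B := A[T;T⁻¹]) Γ A[T;T⁻¹] M (unitHom H (C a * T k)) x) =
      H.unitL a • (scalarMap A M (T k : A[T;T⁻¹])).lTensor Γ x := by
  rw [unitHom_monomial]
  induction x using TensorProduct.induction_on with
  | zero => simp
  | add x x' hx hx' => simp only [map_add, smul_add, hx, hx']
  | tmul m n => simp [TensorProduct.smul_tmul']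

end TensorCoaction

section Gradings

set_option linter.unusedSectionVars false

variable {ι : Type} [DecidableEq ι]

/-- The isomorphism from the direct sum of the homogeneous parts. -/
def grEquiv {M : Type} [AddCommGroup M] {𝓜 : ι → AddSubgroup M}
    (h : DirectSum.IsInternal 𝓜) : (DirectSum ι fun i => 𝓜 i) ≃+ M :=
  AddEquiv.ofBijective (DirectSum.coeAddMonoidHom 𝓜) h

/-- The additive map out of a graded group given by maps out of its homogeneous parts. -/
def grLift {M P : Type} [AddCommGroup M] [AddCommGroup P] {𝓜 : ι → AddSubgroup M}
    (h : DirectSum.IsInternal 𝓜) (f : ι → M →+ P) : M →+ P :=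
  (DirectSum.toAddMonoid fun i => (f i).comp (𝓜 i).subtype).comp
    (grEquiv h).symm.toAddMonoidHom

lemma grLift_of_mem {M P : Type} [AddCommGroup M] [AddCommGroup P] {𝓜 : ι → AddSubgroup M}
    (h : DirectSum.IsInternal 𝓜) (f : ι → M →+ P) {i : ι} {x : M} (hx : x ∈ 𝓜 i) :
    grLift h f x = f i x := by
  have : (grEquiv h).symm x = DirectSum.of (fun i => 𝓜 i) i ⟨x, hx⟩ := by
    rw [AddEquiv.symm_apply_eq]
    exact (DirectSum.coeAddMonoidHom_of 𝓜 i ⟨x, hx⟩).symm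
  change DirectSum.toAddMonoid _ ((grEquiv h).symm x) = _
  rw [this, DirectSum.toAddMonoid_of]
  rfl

lemma gr_induction {M : Type} [AddCommGroup M] {𝓜 : ι → AddSubgroup M}
    (h : DirectSum.IsInternal 𝓜) {motive : M → Prop} (zero : motive 0)
    (add : ∀ x y, motive x → motive y → motive (x + y))
    (mem : ∀ i x, x ∈ 𝓜 i → motive x) (x : M) : motive x := by
  obtain ⟨y, rfl⟩ := h.2 x
  induction y using DirectSum.induction_on with
  | zero => simpa using zero
  | of i y => simpa using mem i y y.2
  | add y z hy hz => simpa using add _ _ hy hz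

lemma isInternal_of_delta {M : Type} [AddCommGroup M] {𝓜 : ι → AddSubgroup M}
    (δ : M →+ ι →₀ M) (hδ : ∀ i, ∀ x ∈ 𝓜 i, δ x = Finsupp.single i x)
    (htop : ⨆ i, 𝓜 i = ⊤) : DirectSum.IsInternal 𝓜 := by
  constructor
  · rw [injective_iff_map_eq_zero]
    intro x hx
    have key : ∀ y : DirectSum ι fun i => 𝓜 i, ∀ i, δ (DirectSum.coeAddMonoidHom 𝓜 y) i = y i := by
      intro y i
      induction y using DirectSum.induction_on with
      | zero => simp
      | of j y =>
        rw [DirectSum.coeAddMonoidHom_of, hδ j _ y.2, DirectSum.coe_of_apply, Finsupp.single_apply]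
        split_ifs <;> simp
      | add y z hy hz => simp [hy, hz]
    ext i
    rw [← key x i, hx]
    simp
  · rw [← AddMonoidHom.range_eq_top, eq_top_iff, ← htop]
    refine iSup_le fun i x hx => ⟨DirectSum.of (fun i => 𝓜 i) i ⟨x, hx⟩, by simp⟩

lemma isInternal_iSup_eq_top {M : Type} [AddCommGroup M] {𝓜 : ι → AddSubgroup M}
    (h : DirectSum.IsInternal 𝓜) : ⨆ i, 𝓜 i = ⊤ := by
  rw [eq_top_iff]
  intro x _
  induction x using gr_induction h with
  | zero => exact zero_mem _
  | add x y hx hy => exact add_mem (hx trivial) (hy trivial)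
  | mem i x hx => exact AddSubgroup.mem_iSup_of_mem i hx

variable [AddCommGroup ι]

section Tensor

variable {B : Type} [CommRing B] {M N P : Type} [AddCommGroup M] [AddCommGroup N] [AddCommGroup P]
  [Module B M] [Module B N] [Module B P]

/-- The grading of `M ⊗_B N`: the part of degree `k` is spanned by the `x ⊗ y` with `x`, `y`
homogeneous of degrees adding up to `k`. -/
def tensorGrading (B : Type) [CommRing B] {M N : Type} [AddCommGroup M] [AddCommGroup N]
    [Module B M] [Module B N] (𝓜 : ι → AddSubgroup M) (𝓝 : ι → AddSubgroup N) (k : ι) :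
    AddSubgroup (M ⊗[B] N) :=
  AddSubgroup.closure {t | ∃ i j, i + j = k ∧ ∃ x ∈ 𝓜 i, ∃ y ∈ 𝓝 j, x ⊗ₜ[B] y = t}

lemma tmul_mem_tensorGrading {𝓜 : ι → AddSubgroup M} {𝓝 : ι → AddSubgroup N} {i j k : ι}
    (h : i + j = k) {x : M} {y : N} (hx : x ∈ 𝓜 i) (hy : y ∈ 𝓝 j) :
    x ⊗ₜ[B] y ∈ tensorGrading B 𝓜 𝓝 k :=
  AddSubgroup.subset_closure ⟨i, j, h, x, hx, y, hy, rfl⟩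

/-- To define an additive map on `M ⊗_B N` it suffices to define it on homogeneous tensors. -/
lemma tensor_gr_induction {𝓜 : ι → AddSubgroup M} {𝓝 : ι → AddSubgroup N}
    (hM : DirectSum.IsInternal 𝓜) (hN : DirectSum.IsInternal 𝓝) {motive : M ⊗[B] N → Prop}
    (zero : motive 0) (add : ∀ x y, motive x → motive y → motive (x + y))
    (tmul : ∀ i j x y, x ∈ 𝓜 i → y ∈ 𝓝 j → motive (x ⊗ₜ y)) (x : M ⊗[B] N) : motive x := by
  induction x using TensorProduct.induction_on with
  | zero => exact zero
  | add x y hx hy => exact add x y hx hy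
  | tmul x y =>
    induction x using gr_induction hM with
    | zero => simpa using zero
    | add x x' hx hx' => simpa [TensorProduct.add_tmul] using add _ _ hx hx'
    | mem i x hx =>
      induction y using gr_induction hN with
      | zero => simpa using zero
      | add x x' hx hx' => simpa [TensorProduct.tmul_add] using add _ _ hx hx'
      | mem j y hy => exact tmul i j x y hx hy

lemma tensorGrading_le_comap {𝓜 : ι → AddSubgroup M} {𝓝 : ι → AddSubgroup N} {k : ι}
    {Q : Type} [AddCommGroup Q] (f : M ⊗[B] N →+ Q) (𝓠 : AddSubgroup Q)
    (h : ∀ i j x y, i + j = k → x ∈ 𝓜 i → y ∈ 𝓝 j → f (x ⊗ₜ y) ∈ 𝓠) {t : M ⊗[B] N}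
    (ht : t ∈ tensorGrading B 𝓜 𝓝 k) : f t ∈ 𝓠 := by
  have : tensorGrading B 𝓜 𝓝 k ≤ 𝓠.comap f := by
    rw [tensorGrading, AddSubgroup.closure_le]
    rintro _ ⟨i, j, hk, x, hx, y, hy, rfl⟩
    exact h i j x y hk hx hy
  exact this ht

lemma tensorGrading_smul_mem {𝓑 : ι → AddSubgroup B} {𝓜 : ι → AddSubgroup M}
    {𝓝 : ι → AddSubgroup N} (h : ∀ i j b x, b ∈ 𝓑 i → x ∈ 𝓜 j → b • x ∈ 𝓜 (i + j))
    (i j : ι) (b : B) (t : M ⊗[B] N) (hb : b ∈ 𝓑 i) (ht : t ∈ tensorGrading B 𝓜 𝓝 j) :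
    b • t ∈ tensorGrading B 𝓜 𝓝 (i + j) := by
  refine tensorGrading_le_comap (DistribSMul.toAddMonoidHom (M ⊗[B] N) b) _ ?_ ht
  intro k l x y hkl hx hy
  simp only [DistribSMul.toAddMonoidHom_apply, TensorProduct.smul_tmul']
  exact tmul_mem_tensorGrading (by rw [← hkl, add_assoc]) (h i k b x hb hx) hy

lemma tensorGrading_isInternal {𝓑 : ι → AddSubgroup B} {𝓜 : ι → AddSubgroup M}
    {𝓝 : ι → AddSubgroup N} (hB : DirectSum.IsInternal 𝓑) (hM : DirectSum.IsInternal 𝓜)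
    (hN : DirectSum.IsInternal 𝓝)
    (hsM : ∀ i j b x, b ∈ 𝓑 i → x ∈ 𝓜 j → b • x ∈ 𝓜 (i + j))
    (hsN : ∀ i j b x, b ∈ 𝓑 i → x ∈ 𝓝 j → b • x ∈ 𝓝 (i + j)) :
    DirectSum.IsInternal (tensorGrading B 𝓜 𝓝) := by
  let f : M →+ N →+ (ι →₀ M ⊗[B] N) := grLift hM fun i =>
    { toFun := fun x => grLift hN fun j =>
        (Finsupp.singleAddHom (i + j)).comp (TensorProduct.mk B M N x).toAddMonoidHom
      map_zero' := by
        ext y : 1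
        induction y using gr_induction hN with
        | zero => simp
        | add y y' hy hy' => simp only [map_add, hy, hy']
        | mem j y hy => simp [grLift_of_mem hN _ hy]
      map_add' := fun x x' => by
        ext y : 1
        induction y using gr_induction hN with
        | zero => simp
        | add y y' hy hy' =>
          exact (map_add _ _ _).trans ((congrArg₂ (· + ·) hy hy').trans (map_add _ _ _).symm)
        | mem j y hy => simp [grLift_of_mem hN _ hy] }
  have hf : ∀ i j x y, x ∈ 𝓜 i → y ∈ 𝓝 j → f x y = Finsupp.single (i + j) (x ⊗ₜ[B] y) := by
    intro i j x y hx hy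
    simp [f, grLift_of_mem hM _ hx, grLift_of_mem hN _ hy]
  have hbal : ∀ (b : B) (x : M) (y : N), f (b • x) y = f x (b • y) := by
    intro b x y
    induction b using gr_induction hB with
    | zero => simp
    | add b c hb hc => simp only [add_smul, map_add, AddMonoidHom.add_apply, hb, hc]
    | mem k b hb =>
      induction x using gr_induction hM with
      | zero => simp
      | add x x' hx hx' => simp only [smul_add, map_add, AddMonoidHom.add_apply, hx, hx']
      | mem i x hx =>
        induction y using gr_induction hN with
        | zero => simp
        | add y y' hy hy' => simp only [smul_add, map_add, hy, hy']
        | mem j y hy =>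
          rw [hf _ _ _ _ (hsM k i b x hb hx) hy, hf _ _ _ _ hx (hsN k j b y hb hy),
            TensorProduct.smul_tmul]
          congr 1
          abel
  refine isInternal_of_delta (TensorProduct.liftAddHom f hbal) ?_ ?_
  · intro k t ht
    have : t ∈ tensorGrading B 𝓜 𝓝 k →
      ((TensorProduct.liftAddHom f hbal) - Finsupp.singleAddHom k : M ⊗[B] N →+ _) t ∈
        (⊥ : AddSubgroup (ι →₀ M ⊗[B] N)) := by
      refine tensorGrading_le_comap _ ⊥ ?_
      rintro i j x y rfl hx hy
      rw [AddMonoidHom.sub_apply, TensorProduct.liftAddHom_tmul, hf i j x y hx hy]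
      simp
    simpa [sub_eq_zero] using this ht
  · rw [eq_top_iff]
    intro t _
    induction t using tensor_gr_induction hM hN with
    | zero => exact zero_mem _
    | add x y hx hy => exact add_mem (hx trivial) (hy trivial)
    | tmul i j x y hx hy =>
      exact AddSubgroup.mem_iSup_of_mem (i + j) (tmul_mem_tensorGrading rfl hx hy)

end Tensor

lemma pairing_mem {A Γ B M N : Type} [CommRing A] [CommRing Γ] [Algebra A Γ] [CommRing B]
    [Algebra A B] [AddCommGroup M] [AddCommGroup N] [Module A M] [Module B M] [IsScalarTower A B M]
    [Module A N] [Module B N] [IsScalarTower A B N] {𝓖 : ι → AddSubgroup Γ}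
    {𝓜 : ι → AddSubgroup M} {𝓝 : ι → AddSubgroup N}
    (hG : ∀ i j g h, g ∈ 𝓖 i → h ∈ 𝓖 j → g * h ∈ 𝓖 (i + j)) {i j k : ι} (hk : i + j = k)
    {x : Γ ⊗[A] M} {y : Γ ⊗[A] N} (hx : x ∈ tensorGrading A 𝓖 𝓜 i)
    (hy : y ∈ tensorGrading A 𝓖 𝓝 j) :
    pairing (B := B) Γ M N x y ∈ tensorGrading A 𝓖 (tensorGrading B 𝓜 𝓝) k := by
  refine tensorGrading_le_comap ((pairing (B := B) Γ M N).flip y).toAddMonoidHom _ ?_ hx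
  intro a b g m hab hg hm
  rw [LinearMap.toAddMonoidHom_coe, LinearMap.flip_apply]
  refine tensorGrading_le_comap (pairing (B := B) Γ M N (g ⊗ₜ m)).toAddMonoidHom _ ?_ hy
  intro c e h n hce hh hn
  simp only [LinearMap.toAddMonoidHom_coe, pairing_tmul]
  refine tmul_mem_tensorGrading ?_ (hG _ _ _ _ hg hh) (tmul_mem_tensorGrading rfl hm hn)
  rw [← hk, ← hab, ← hce]
  abel

lemma lTensor_eq_zsmul {A Γ M : Type} [CommRing A] [CommRing Γ] [Algebra A Γ] [AddCommGroup M]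
    [Module A M] {𝓖 : ι → AddSubgroup Γ} {𝓜 : ι → AddSubgroup M} (f : M →ₗ[A] M) (c : ℤ) {i : ι}
    (h : ∀ a b g m, a + b = i → g ∈ 𝓖 a → m ∈ 𝓜 b → g = 0 ∨ f m = c • m) {t : Γ ⊗[A] M}
    (ht : t ∈ tensorGrading A 𝓖 𝓜 i) : f.lTensor Γ t = c • t := by
  induction ht using AddSubgroup.closure_induction with
  | zero => simp
  | add x y _ _ hx hy => rw [map_add, hx, hy, smul_add]
  | neg x _ hx => rw [map_neg, hx, smul_neg]
  | mem t ht =>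
    obtain ⟨a, b, hab, g, hg, m, hm, rfl⟩ := ht
    rcases h a b g m hab hg hm with rfl | h
    · simp
    · rw [LinearMap.lTensor_tmul, h, TensorProduct.tmul_smul]

end Gradings

section Structure

/-- The ring `E(1)_* = ℤ_(p)[v₁, v₁⁻¹]`; the variable `v₁` has degree `2p - 2`. -/
def E1 (p : ℕ) : Type := LaurentZ p

instance (p : ℕ) : CommRing (E1 p) := inferInstanceAs (CommRing (LaurentZ p))

/-- The monomial `r v₁^k` in `E(1)_*`. -/
def E1.monomial {p : ℕ} (r : ZLoc p) (k : ℤ) : E1 p := (C r * T k : LaurentZ p)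

/-- `E(1)_*E(1)`, in the description of Adams, Harris and Switzer: the stably integral elements of `ℚ[u^{±1}, v^{±1}]`, where `u = η_L(v₁)` is the
variable with index `0` and `v = η_R(v₁)` the variable with index `1`. -/
def EE (p : ℕ) : Type := stablyIntegral p 2

/-- `E(1)_*E(1) ⊗_{E(1)_*} E(1)_*E(1) = π_*(E(1) ∧ E(1) ∧ E(1))`, as the ring of stably integral
elements of `ℚ[u^{±1}, v^{±1}, w^{±1}]`; the tensor `f ⊗ g` is the product `f(u, v) g(v, w)`. -/
def EEE (p : ℕ) : Type := stablyIntegral p 3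

instance (p : ℕ) : CommRing (EE p) := inferInstanceAs (CommRing (stablyIntegral p 2))
instance (p : ℕ) : CommRing (EEE p) := inferInstanceAs (CommRing (stablyIntegral p 3))

instance (p : ℕ) : Algebra (E1 p) (EE p) :=
  RingHom.toAlgebra (unitMap p (1 : Fin 2) : LaurentZ p →+* stablyIntegral p 2)
instance (p : ℕ) : Algebra (E1 p) (EEE p) :=
  RingHom.toAlgebra (unitMap p (2 : Fin 3) : LaurentZ p →+* stablyIntegral p 3)

/-- The Hopf algebroid `(E(1)_*, E(1)_*E(1))`. The left and right units send `v₁` to `u` and `v`,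
the comultiplication sends `f(u, v)` to `f(u, w)`, and the counit sends `f(u, v)` to
`f(v₁, v₁)`. -/
def hopf (p : ℕ) : HopfAlgebroid (E1 p) (EE p) (EEE p) where
  unitL := (unitMap p (0 : Fin 2) : LaurentZ p →+* stablyIntegral p 2)
  inl := (changeVars p ![0, 1] : stablyIntegral p 2 →+* stablyIntegral p 3)
  inr :=
    { (changeVars p ![1, 2] : stablyIntegral p 2 →+* stablyIntegral p 3) with
      commutes' := fun a => changeVars_unitMap p ![1, 2] 1 a }
  comul :=
    { (changeVars p ![0, 2] : stablyIntegral p 2 →+* stablyIntegral p 3) with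
      commutes' := fun a => changeVars_unitMap p ![0, 2] 1 a }
  counit :=
    { (counitMap p 2 : stablyIntegral p 2 →+* LaurentZ p) with
      commutes' := fun a => counitMap_unitMap p 1 a }
  inl_unitR a := (changeVars_unitMap p ![0, 1] 1 a).trans (changeVars_unitMap p ![1, 2] 0 a).symm
  comul_unitL a := (changeVars_unitMap p ![0, 2] 0 a).trans (changeVars_unitMap p ![0, 1] 0 a).symm
  counit_unitL a := counitMap_unitMap p 0 a

lemma E1.monomial_add {p : ℕ} (r s : ZLoc p) (k : ℤ) :
    E1.monomial (r + s) k = E1.monomial r k + E1.monomial s k := by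
  have : (C (r + s) * T k : LaurentZ p) = C r * T k + C s * T k := by rw [map_add, add_mul]
  exact this

lemma E1.monomial_zero {p : ℕ} (k : ℤ) : E1.monomial (0 : ZLoc p) k = 0 := by
  change (C 0 * T k : LaurentZ p) = 0
  rw [map_zero, zero_mul]

/-- The coefficients of an element of `E(1)_*`. -/
def E1.coeffs (p : ℕ) : E1 p →+ (ℤ →₀ ZLoc p) :=
  (AddMonoidAlgebra.coeffAddEquiv (R := ZLoc p) (M := ℤ)).toAddMonoidHom

lemma E1.coeffs_monomial {p : ℕ} (r : ZLoc p) (k : ℤ) :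
    E1.coeffs p (E1.monomial r k) = Finsupp.single k r := by
  change (C r * T k : LaurentZ p).coeff = _
  rw [← LaurentPolynomial.single_eq_C_mul_T]
  rfl

/-- The grading of `E(1)_*E(1)`, in which `u` and `v` have degree `2p - 2`, as a bigrading
concentrated in cohomological degree `0`. -/
def gradingEE (p : ℕ) (i : ℤ × ℤ) : AddSubgroup (EE p) where
  carrier := {f | ∀ e : Fin 2 → ℤ, (Subtype.val f : RatLaurent 2).coeff e ≠ 0 →
    (0, qdeg p * (e 0 + e 1)) = i}
  zero_mem' e he := absurd rfl he
  add_mem' {f g} hf hg e he := by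
    by_contra h
    have h1 : (Subtype.val f : RatLaurent 2).coeff e = 0 := by_contra fun h' => h (hf e h')
    have h2 : (Subtype.val g : RatLaurent 2).coeff e = 0 := by_contra fun h' => h (hg e h')
    refine he ?_
    change ((Subtype.val f : RatLaurent 2) + (Subtype.val g : RatLaurent 2)).coeff e = 0
    simp [h1, h2]
  neg_mem' {f} hf e he := hf e fun h => he (by
    change (-(Subtype.val f : RatLaurent 2)).coeff e = 0
    simp [h])

lemma gradingEE_mul (p : ℕ) (i j : ℤ × ℤ) (g h : EE p) (hg : g ∈ gradingEE p i)
    (hh : h ∈ gradingEE p j) : g * h ∈ gradingEE p (i + j) := by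
  intro e he
  classical
  have : e ∈ ((Subtype.val g : RatLaurent 2) * (Subtype.val h : RatLaurent 2)).coeff.support :=
    Finsupp.mem_support_iff.mpr he
  have := AddMonoidAlgebra.support_coeff_mul_subset _ _ this
  obtain ⟨e₁, h₁, e₂, h₂, rfl⟩ := Finset.mem_add.mp this
  rw [← hg e₁ (Finsupp.mem_support_iff.mp h₁), ← hh e₂ (Finsupp.mem_support_iff.mp h₂)]
  simp only [Prod.mk_add_mk, Pi.add_apply]
  congr 1
  ring

lemma gradingEE_unitL (p : ℕ) (k : ℤ) (r : ZLoc p) :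
    (hopf p).unitL (E1.monomial r k) ∈ gradingEE p (0, qdeg p * k) := by
  intro e he
  change (unitRat p (0 : Fin 2) (C r * T k)).coeff e ≠ 0 at he
  rw [← LaurentPolynomial.single_eq_C_mul_T] at he
  rw [unitRat_single, AddMonoidAlgebra.coeff_single, Finsupp.single_apply] at he
  split_ifs at he with h
  · subst h
    simp
  · exact absurd rfl he

/-- The ring `E(1)_*[τ, τ⁻¹]`, where `τ = T 1` will act as the periodicity isomorphism. -/
abbrev PE (p : ℕ) : Type := (E1 p)[T;T⁻¹]

/-- The bigrading (cohomological degree, internal degree) of `E(1)_*[τ, τ⁻¹]`: the element `v₁`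
has bidegree `(0, 2p - 2)`, and `τ` has bidegree `(2p - 2, 2p - 2)`. -/
def gradingPE (p : ℕ) (i : ℤ × ℤ) : AddSubgroup (PE p) :=
  AddSubgroup.closure {b | ∃ (r : ZLoc p) (j k : ℤ),
    (qdeg p * j, qdeg p * j + qdeg p * k) = i ∧ C (E1.monomial r k) * T j = b}

lemma monomial_mem_gradingPE (p : ℕ) (r : ZLoc p) (j k : ℤ) :
    C (E1.monomial r k) * T j ∈ gradingPE p (qdeg p * j, qdeg p * j + qdeg p * k) :=
  AddSubgroup.subset_closure ⟨r, j, k, rfl, rfl⟩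

lemma gradingPE_le {p : ℕ} {i : ℤ × ℤ} {Q : Type} [AddCommGroup Q] (f : PE p →+ Q)
    (𝓠 : AddSubgroup Q) (h : ∀ (r : ZLoc p) (j k : ℤ),
      (qdeg p * j, qdeg p * j + qdeg p * k) = i → f (C (E1.monomial r k) * T j) ∈ 𝓠)
    {b : PE p} (hb : b ∈ gradingPE p i) : f b ∈ 𝓠 := by
  have : gradingPE p i ≤ 𝓠.comap f := by
    rw [gradingPE, AddSubgroup.closure_le]
    rintro _ ⟨r, j, k, hi, rfl⟩
    exact h r j k hi
  exact this hb

lemma PE_induction {p : ℕ} {motive : PE p → Prop} (add : ∀ x y, motive x → motive y → motive (x + y))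
    (monomial : ∀ (r : ZLoc p) (j k : ℤ), motive (C (E1.monomial r k) * T j)) (b : PE p) : motive b := by
  induction b using LaurentPolynomial.induction_on' with
  | add x y hx hy => exact add x y hx hy
  | C_mul_T j a =>
    refine LaurentPolynomial.induction_on' (R := ZLoc p)
      (motive := fun a => motive (C (show E1 p from a) * T j)) a ?_ ?_
    · intro x y hx hy
      have := add _ _ hx hy
      rw [← add_mul, ← map_add] at this
      exact this
    · exact fun k r => monomial r j k

lemma gradingPE_isInternal (p : ℕ) : DirectSum.IsInternal (gradingPE p) := by
  let D : ℤ × ℤ → ZLoc p →+ ((ℤ × ℤ) →₀ PE p) := fun jk =>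
    { toFun := fun r => Finsupp.single (qdeg p * jk.1, qdeg p * jk.1 + qdeg p * jk.2)
        (C (E1.monomial r jk.2) * T jk.1)
      map_zero' := by rw [E1.monomial_zero, map_zero, zero_mul, Finsupp.single_zero]
      map_add' := fun r s => by
        rw [E1.monomial_add, map_add, add_mul, Finsupp.single_add] }
  let δ : PE p →+ ((ℤ × ℤ) →₀ PE p) :=
    (Finsupp.liftAddHom fun j => (Finsupp.liftAddHom fun k => D (j, k)).comp (E1.coeffs p)).comp
      (AddMonoidAlgebra.coeffAddEquiv (R := E1 p) (M := ℤ)).toAddMonoidHom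
  have hδ : ∀ (r : ZLoc p) (j k : ℤ), δ (C (E1.monomial r k) * T j) =
      Finsupp.single (qdeg p * j, qdeg p * j + qdeg p * k) (C (E1.monomial r k) * T j) := by
    intro r j k
    rw [← LaurentPolynomial.single_eq_C_mul_T]
    change Finsupp.liftAddHom _ (Finsupp.single j (E1.monomial r k)) = _
    rw [Finsupp.liftAddHom_apply_single]
    change Finsupp.liftAddHom _ (E1.coeffs p (E1.monomial r k)) = _
    rw [E1.coeffs_monomial, Finsupp.liftAddHom_apply_single]
    change Finsupp.single _ (C (E1.monomial r k) * T j) = _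
    rw [LaurentPolynomial.single_eq_C_mul_T]
  refine isInternal_of_delta (M := PE p) (𝓜 := gradingPE p) δ ?_ ?_
  · intro i b hb
    induction hb using AddSubgroup.closure_induction with
    | mem x hx =>
      obtain ⟨r, j, k, rfl, rfl⟩ := hx
      exact hδ r j k
    | zero => rw [map_zero, Finsupp.single_zero]
    | add x y _ _ hx hy => rw [map_add, hx, hy, Finsupp.single_add]
    | neg x _ hx => rw [map_neg, hx]; exact (Finsupp.single_neg _ _).symm
  · rw [eq_top_iff]
    intro b _
    induction b using PE_induction with
    | add x y hx hy => exact add_mem (hx trivial) (hy trivial)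
    | monomial r j k => exact AddSubgroup.mem_iSup_of_mem _ (monomial_mem_gradingPE p r j k)

end Structure

section Complexes

/-- A quasi-periodic cochain complex, of period `N = 2p - 2`, of graded `E(1)_*E(1)`-comodules which
are concentrated in internal degrees divisible by `2p - 2`.

Such a complex consists of graded `E(1)_*E(1)`-comodules `C^n = (C^n_k)_k`, `n ∈ ℤ`, of comodule maps
`d : C^n → C^{n + 1}` preserving the internal degree `k` and with `d ∘ d = 0`, and of isomorphisms
`τ : C^n_{k - N} ≅ C^{n + N}_k` of comodules commuting with `d`. It is encoded by the direct sum
`carrier` of all the `C^n_k`, with its bigrading `grading (n, k) = C^n_k`. The `E(1)_*`-module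
structure and `τ` together are an action of `E(1)_*[τ, τ⁻¹]` compatible with the bidegrees
`(0, 2p - 2)` of `v₁` and `(N, N)` of `τ`. -/
structure QPComplex (p : ℕ) where
  /-- the direct sum of all the `C^n_k` -/
  carrier : Type
  [addCommGroup : AddCommGroup carrier]
  [moduleE : Module (E1 p) carrier]
  [moduleP : Module (PE p) carrier]
  [isScalarTower : IsScalarTower (E1 p) (PE p) carrier]
  /-- `grading (n, k)` is the part `C^n_k` of cohomological degree `n`, internal degree `k` -/
  grading : ℤ × ℤ → AddSubgroup carrier
  isInternal : DirectSum.IsInternal grading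
  smul_mem : ∀ i j b x, b ∈ gradingPE p i → x ∈ grading j → b • x ∈ grading (i + j)
  /-- `C^n_k = 0` unless `2p - 2` divides `k` -/
  concentrated : ∀ n k, ¬ qdeg p ∣ k → grading (n, k) = ⊥
  /-- the coaction of `E(1)_*E(1)` -/
  coaction : Coaction (hopf p) carrier
  /-- the periodicity isomorphism `τ` is a map of comodules -/
  periodic : coaction.Periodic
  /-- the coaction maps `C^n_k` to the part of internal degree `k` of `E(1)_*E(1) ⊗ C^n` -/
  coaction_mem : ∀ i x, x ∈ grading i →
    coaction.toHom x ∈ tensorGrading (E1 p) (gradingEE p) grading i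
  /-- the differential; it commutes with `E(1)_*` and with `τ` -/
  d : carrier →ₗ[PE p] carrier
  d_mem : ∀ i x, x ∈ grading i → d x ∈ grading (i + (1, 0))
  d_d : ∀ x, d (d x) = 0
  /-- the differential is a map of comodules -/
  coaction_d : ∀ x, coaction.toHom (d x) =
    (d.restrictScalars (E1 p)).lTensor (EE p) (coaction.toHom x)

attribute [instance] QPComplex.addCommGroup QPComplex.moduleE QPComplex.moduleP
  QPComplex.isScalarTower

namespace QPComplex

variable {p : ℕ}

/-- A morphism of quasi-periodic complexes: a map of complexes of graded comodules which commutes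
with the periodicity isomorphisms. -/
@[ext]
structure Hom (X Y : QPComplex p) where
  toLin : X.carrier →ₗ[PE p] Y.carrier
  map_mem : ∀ i x, x ∈ X.grading i → toLin x ∈ Y.grading i
  map_d : ∀ x, toLin (X.d x) = Y.d (toLin x)
  map_coaction : ∀ x, Y.coaction.toHom (toLin x) =
    (toLin.restrictScalars (E1 p)).lTensor (EE p) (X.coaction.toHom x)

instance : Category (QPComplex p) where
  Hom := Hom
  id X :=
    { toLin := LinearMap.id
      map_mem := fun _ _ h => h
      map_d := fun _ => rfl
      map_coaction := fun x =>
        (congrArg (fun f => f (X.coaction.toHom x)) (LinearMap.lTensor_id (EE p) X.carrier)).symm }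
  comp {X Y Z} f g :=
    { toLin := g.toLin ∘ₗ f.toLin
      map_mem := fun i x h => g.map_mem i _ (f.map_mem i x h)
      map_d := fun x => by simp [f.map_d, g.map_d]
      map_coaction := fun x => by
        have := LinearMap.lTensor_comp_apply (EE p) (g.toLin.restrictScalars (E1 p))
          (f.toLin.restrictScalars (E1 p)) (X.coaction.toHom x)
        rw [LinearMap.comp_apply, g.map_coaction, f.map_coaction, ← this]
        rfl }

@[ext] lemma hom_ext {X Y : QPComplex p} {f g : X ⟶ Y} (h : ∀ x, f.toLin x = g.toLin x) : f = g :=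
  Hom.ext (LinearMap.ext h)

@[simp] lemma id_toLin (X : QPComplex p) : Hom.toLin (𝟙 X) = LinearMap.id := rfl
@[simp] lemma comp_toLin {X Y Z : QPComplex p} (f : X ⟶ Y) (g : Y ⟶ Z) :
    Hom.toLin (f ≫ g) = g.toLin ∘ₗ f.toLin := rfl

/-- The operator multiplying the part of cohomological degree `n` by `φ n`. -/
def scale (X : QPComplex p) (φ : ℤ → ℤ) (hφ : ∀ n j, φ (qdeg p * j + n) = φ n) :
    X.carrier →ₗ[PE p] X.carrier where
  toFun := grLift X.isInternal fun i => φ i.1 • AddMonoidHom.id X.carrier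
  map_add' := map_add _
  map_smul' b x := by
    induction b using PE_induction with
    | add b c hb hc => simp only [add_smul, map_add, hb, hc, RingHom.id_apply]
    | monomial r j k =>
      induction x using gr_induction X.isInternal with
      | zero => simp
      | add x y hx hy => simp only [smul_add, map_add, hx, hy]
      | mem i x hx =>
        rw [grLift_of_mem _ _ (X.smul_mem _ _ _ _ (monomial_mem_gradingPE p r j k) hx),
          grLift_of_mem _ _ hx]
        simp only [Prod.fst_add, hφ, AddMonoidHom.smul_apply, AddMonoidHom.id_apply,
          RingHom.id_apply]
        exact (smul_comm _ _ _)

lemma scale_of_mem (X : QPComplex p) (φ : ℤ → ℤ) (hφ) {i : ℤ × ℤ} {x : X.carrier}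
    (hx : x ∈ X.grading i) : X.scale φ hφ x = φ i.1 • x :=
  grLift_of_mem _ _ hx

lemma gradingEE_eq_zero {i : ℤ × ℤ} (hi : i.1 ≠ 0) {g : EE p} (hg : g ∈ gradingEE p i) : g = 0 := by
  apply Subtype.ext
  ext e
  by_contra h
  have := hg e h
  exact hi (by rw [← this])

lemma coaction_scale (X : QPComplex p) (φ : ℤ → ℤ) (hφ) (x : X.carrier) :
    X.coaction.toHom (X.scale φ hφ x) =
      ((X.scale φ hφ).restrictScalars (E1 p)).lTensor (EE p) (X.coaction.toHom x) := by
  induction x using gr_induction X.isInternal with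
  | zero => simp
  | add x y hx hy => simp only [map_add, hx, hy]
  | mem i x hx =>
    rw [X.scale_of_mem φ hφ hx, map_zsmul]
    refine (lTensor_eq_zsmul _ _ ?_ (X.coaction_mem i x hx)).symm
    intro a c g m hac hg hm
    by_cases ha : a.1 = 0
    · have hc : c.1 = i.1 := by rw [← hac, Prod.fst_add, ha, zero_add]
      exact Or.inr (by rw [LinearMap.restrictScalars_apply, X.scale_of_mem φ hφ hm, hc])
    · exact Or.inl (gradingEE_eq_zero ha hg)

lemma even_qdeg_add (n j : ℤ) : Even (qdeg p * j + n) ↔ Even n := by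
  rw [Int.even_add]
  simp [(even_qdeg p).mul_right j]

/-- The sign operator `x ↦ (-1)^{|x|} x`. -/
def sgn (X : QPComplex p) : X.carrier →ₗ[PE p] X.carrier :=
  X.scale (fun n => if Even n then 1 else -1) fun n j => by simp [even_qdeg_add]

/-- The projection to the part of even cohomological degree. -/
def ev (X : QPComplex p) : X.carrier →ₗ[PE p] X.carrier :=
  X.scale (fun n => if Even n then 1 else 0) fun n j => by simp [even_qdeg_add]

/-- The projection to the part of odd cohomological degree. -/
def od (X : QPComplex p) : X.carrier →ₗ[PE p] X.carrier :=
  X.scale (fun n => if Even n then 0 else 1) fun n j => by simp [even_qdeg_add]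

lemma sgn_of_mem (X : QPComplex p) {i : ℤ × ℤ} {x : X.carrier} (hx : x ∈ X.grading i) :
    X.sgn x = (if Even i.1 then (1 : ℤ) else -1) • x := X.scale_of_mem _ _ hx
lemma ev_of_mem (X : QPComplex p) {i : ℤ × ℤ} {x : X.carrier} (hx : x ∈ X.grading i) :
    X.ev x = (if Even i.1 then (1 : ℤ) else 0) • x := X.scale_of_mem _ _ hx
lemma od_of_mem (X : QPComplex p) {i : ℤ × ℤ} {x : X.carrier} (hx : x ∈ X.grading i) :
    X.od x = (if Even i.1 then (0 : ℤ) else 1) • x := X.scale_of_mem _ _ hx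

/-- Commutation with coactions. -/
def CoactionCompat {M N : Type} [AddCommGroup M] [AddCommGroup N] [Module (E1 p) M]
    [Module (PE p) M] [IsScalarTower (E1 p) (PE p) M] [Module (E1 p) N]
    [Module (PE p) N] [IsScalarTower (E1 p) (PE p) N] (ψ : Coaction (hopf p) M)
    (φ : Coaction (hopf p) N) (f : M →ₗ[PE p] N) : Prop :=
  ∀ x, φ.toHom (f x) = (f.restrictScalars (E1 p)).lTensor (EE p) (ψ.toHom x)

lemma CoactionCompat.map {M N M' N' : Type} [AddCommGroup M] [AddCommGroup N] [Module (E1 p) M]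
    [Module (PE p) M] [IsScalarTower (E1 p) (PE p) M] [Module (E1 p) N]
    [Module (PE p) N] [IsScalarTower (E1 p) (PE p) N] [AddCommGroup M'] [AddCommGroup N']
    [Module (E1 p) M'] [Module (PE p) M'] [IsScalarTower (E1 p) (PE p) M'] [Module (E1 p) N']
    [Module (PE p) N'] [IsScalarTower (E1 p) (PE p) N'] {ψ : Coaction (hopf p) M}
    {φ : Coaction (hopf p) N} {ψ' : Coaction (hopf p) M'} {φ' : Coaction (hopf p) N'}
    (h : ψ.Periodic) (k : φ.Periodic) (h' : ψ'.Periodic) (k' : φ'.Periodic)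
    {f : M →ₗ[PE p] M'} {g : N →ₗ[PE p] N'} (hf : CoactionCompat ψ ψ' f)
    (hg : CoactionCompat φ φ' g) :
    CoactionCompat (ψ.tensor φ h k) (ψ'.tensor φ' h' k') (TensorProduct.map f g) := fun x => by
  induction x using TensorProduct.induction_on with
  | zero => simp
  | add x y hx hy => simp only [map_add, hx, hy]
  | tmul x y =>
    rw [TensorProduct.map_tmul, Coaction.tensor_tmul, Coaction.tensor_tmul, hf, hg, pairing_map]

lemma CoactionCompat.add {M N : Type} [AddCommGroup M] [AddCommGroup N] [Module (E1 p) M]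
    [Module (PE p) M] [IsScalarTower (E1 p) (PE p) M] [Module (E1 p) N]
    [Module (PE p) N] [IsScalarTower (E1 p) (PE p) N] {ψ : Coaction (hopf p) M}
    {φ : Coaction (hopf p) N} {f g : M →ₗ[PE p] N} (hf : CoactionCompat ψ φ f)
    (hg : CoactionCompat ψ φ g) : CoactionCompat ψ φ (f + g) := fun x => by
  rw [LinearMap.add_apply, map_add, hf, hg, ← LinearMap.add_apply, ← LinearMap.lTensor_add]
  rfl

lemma CoactionCompat.comp {M N P : Type} [AddCommGroup M] [AddCommGroup N] [AddCommGroup P]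
    [Module (E1 p) M]
    [Module (PE p) M] [IsScalarTower (E1 p) (PE p) M] [Module (E1 p) N]
    [Module (PE p) N] [IsScalarTower (E1 p) (PE p) N] [Module (E1 p) P]
    [Module (PE p) P] [IsScalarTower (E1 p) (PE p) P] {ψ : Coaction (hopf p) M}
    {φ : Coaction (hopf p) N} {χ : Coaction (hopf p) P} {f : M →ₗ[PE p] N} {g : N →ₗ[PE p] P}
    (hf : CoactionCompat ψ φ f)
    (hg : CoactionCompat φ χ g) : CoactionCompat ψ χ (g ∘ₗ f) := fun x => by
  rw [LinearMap.comp_apply, hg, hf, ← LinearMap.lTensor_comp_apply]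
  rfl

lemma CoactionCompat.id {M : Type} [AddCommGroup M] [Module (E1 p) M]
    [Module (PE p) M] [IsScalarTower (E1 p) (PE p) M] (ψ : Coaction (hopf p) M) :
    CoactionCompat ψ ψ (LinearMap.id : M →ₗ[PE p] M) := fun x =>
  (congrArg (fun f => f (ψ.toHom x)) (LinearMap.lTensor_id (EE p) M)).symm

/-- The differential `x ⊗ y ↦ d x ⊗ y + (-1)^{|x|} x ⊗ d y`. -/
def tensorD (X Y : QPComplex p) :
    X.carrier ⊗[PE p] Y.carrier →ₗ[PE p] X.carrier ⊗[PE p] Y.carrier :=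
  TensorProduct.map X.d LinearMap.id + TensorProduct.map X.sgn Y.d

lemma tensorD_tmul (X Y : QPComplex p) {i : ℤ × ℤ} {x : X.carrier} (hx : x ∈ X.grading i)
    (y : Y.carrier) : tensorD X Y (x ⊗ₜ y) =
      X.d x ⊗ₜ y + (if Even i.1 then (1 : ℤ) else -1) • (x ⊗ₜ[PE p] Y.d y) := by
  rw [tensorD, LinearMap.add_apply, TensorProduct.map_tmul, TensorProduct.map_tmul,
    X.sgn_of_mem hx, LinearMap.id_apply]
  rfl

/-- The tensor product over `E(1)_*` of quasi-periodic complexes. Its part of cohomological degree `n`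
is the sum of the `X^s ⊗_{E(1)_*} Y^t` with `s + t = n`, modulo the identification of
`τ x ⊗ y` with `x ⊗ τ y`; that is, `⨁ X^s ⊗_{E(1)_*} Y^t` over the `s, t ∈ ℤ/(2p - 2)` with
`s + t = n` in `ℤ/(2p - 2)`. The coaction is the diagonal one. -/
def tensorObj (X Y : QPComplex p) : QPComplex p where
  carrier := X.carrier ⊗[PE p] Y.carrier
  grading := tensorGrading (PE p) X.grading Y.grading
  isInternal := tensorGrading_isInternal (gradingPE_isInternal p) X.isInternal Y.isInternal
    X.smul_mem Y.smul_mem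
  smul_mem := tensorGrading_smul_mem X.smul_mem
  concentrated n k hk := by
    rw [eq_bot_iff]
    intro t ht
    refine tensorGrading_le_comap (AddMonoidHom.id _) ⊥ ?_ ht
    intro i j x y hij hx hy
    by_cases hi : qdeg p ∣ i.2
    · have hj : ¬ qdeg p ∣ j.2 := fun h => hk (by
        have : k = i.2 + j.2 := (congrArg Prod.snd hij).symm
        rw [this]; exact dvd_add hi h)
      have : y = 0 := by
        have := Y.concentrated j.1 j.2 hj
        exact (AddSubgroup.eq_bot_iff_forall _).mp this y hy
      simp [this]
    · have : x = 0 := by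
        have := X.concentrated i.1 i.2 hi
        exact (AddSubgroup.eq_bot_iff_forall _).mp this x hx
      simp [this]
  coaction := X.coaction.tensor Y.coaction X.periodic Y.periodic
  periodic := Coaction.tensor_periodic _ _ _ _
  coaction_mem i t ht := by
    refine tensorGrading_le_comap (X.coaction.tensor Y.coaction X.periodic Y.periodic).toHom _ ?_ ht
    intro a b x y hab hx hy
    rw [Coaction.tensor_tmul]
    exact pairing_mem (gradingEE_mul p) hab (X.coaction_mem _ _ hx) (Y.coaction_mem _ _ hy)
  d := tensorD X Y
  d_mem i t ht := by
    refine tensorGrading_le_comap (tensorD X Y).toAddMonoidHom _ ?_ ht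
    intro a b x y hab hx hy
    rw [LinearMap.toAddMonoidHom_coe, tensorD_tmul X Y hx]
    refine add_mem (tmul_mem_tensorGrading ?_ (X.d_mem _ _ hx) hy)
      (zsmul_mem (tmul_mem_tensorGrading ?_ hx (Y.d_mem _ _ hy)) _)
    · rw [← hab]; abel
    · rw [← hab]; abel
  d_d t := by
    refine tensor_gr_induction (motive := fun t => tensorD X Y (tensorD X Y t) = 0)
      X.isInternal Y.isInternal ?_ ?_ ?_ t
    · simp
    · intro x y hx hy
      simp only [map_add, hx, hy, add_zero]
    · intro i j x y hx hy
      rw [tensorD_tmul X Y hx, map_add, map_zsmul, tensorD_tmul X Y (X.d_mem _ _ hx),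
        tensorD_tmul X Y hx, X.d_d, Y.d_d]
      have h1 : Even (i + (1, 0) : ℤ × ℤ).1 ↔ ¬ Even i.1 := Int.even_add_one
      by_cases h : Even i.1
      · rw [if_neg (fun h' => h1.mp h' h), if_pos h]
        simp
      · rw [if_pos (h1.mpr h), if_neg h]
        simp
  coaction_d := CoactionCompat.add
    (CoactionCompat.map _ _ _ _ X.coaction_d (CoactionCompat.id _))
    (CoactionCompat.map _ _ _ _ (X.coaction_scale _ _) Y.coaction_d)

lemma monomial_mul_monomial (r r' : ZLoc p) (k k' l l' : ℤ) :
    (C (E1.monomial r l) * T k : PE p) * (C (E1.monomial r' l') * T k') =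
      C (E1.monomial (r * r') (l + l')) * T (k + k') := by
  have h' : E1.monomial (r * r') (l + l') = E1.monomial r l * E1.monomial r' l' := by
    have : (C (r * r') * T (l + l') : LaurentZ p) = C r * T l * (C r' * T l') := by
      rw [T_add, map_mul, mul_mul_mul_comm]
    exact this
  rw [h', T_add, map_mul, mul_mul_mul_comm]

lemma gradingPE_mul (i j : ℤ × ℤ) (b x : PE p) (hb : b ∈ gradingPE p i) (hx : x ∈ gradingPE p j) :
    b • x ∈ gradingPE p (i + j) := by
  induction hb using AddSubgroup.closure_induction with
  | zero => rw [zero_smul]; exact zero_mem _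
  | add b c _ _ hb hc => rw [add_smul]; exact add_mem hb hc
  | neg b _ hb => rw [neg_smul]; exact neg_mem hb
  | mem b hb =>
    obtain ⟨r, k, l, rfl, rfl⟩ := hb
    induction hx using AddSubgroup.closure_induction with
    | zero => rw [smul_zero]; exact zero_mem _
    | add b c _ _ hb hc => rw [smul_add]; exact add_mem hb hc
    | neg b _ hb => rw [smul_neg]; exact neg_mem hb
    | mem b hb =>
      obtain ⟨r', k', l', rfl, rfl⟩ := hb
      rw [smul_eq_mul, monomial_mul_monomial]
      have := monomial_mem_gradingPE p (r * r') (k + k') (l + l')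
      have h : ((qdeg p * (k + k'), qdeg p * (k + k') + qdeg p * (l + l')) : ℤ × ℤ) =
          (qdeg p * k, qdeg p * k + qdeg p * l) + (qdeg p * k', qdeg p * k' + qdeg p * l') :=
        Prod.ext (by simp only [Prod.fst_add]; ring) (by simp only [Prod.snd_add]; ring)
      rw [← h]
      exact this

/-- The unit complex `E(1)_*[τ, τ⁻¹]`: it is zero in cohomological degrees not divisible by
`2p - 2`, and a shifted copy of `E(1)_*` in the others. -/
def unit (p : ℕ) : QPComplex p where
  carrier := PE p
  grading := gradingPE p
  isInternal := gradingPE_isInternal p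
  smul_mem := gradingPE_mul
  concentrated n k hk := by
    rw [eq_bot_iff]
    intro t ht
    refine gradingPE_le (AddMonoidHom.id _) ⊥ ?_ ht
    intro r j l h
    refine absurd ?_ hk
    have h' : qdeg p * j + qdeg p * l = k := congrArg Prod.snd h
    rw [← h']
    exact dvd_add (dvd_mul_right _ _) (dvd_mul_right _ _)
  coaction := unitCoaction (hopf p)
  periodic := unitCoaction_periodic
  coaction_mem i x hx := by
    refine gradingPE_le (unitCoaction (hopf p)).toHom _ ?_ hx
    rintro r j k rfl
    change unitHom (hopf p) _ ∈ _
    rw [unitHom_monomial]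
    have h1 : (T j : PE p) ∈ gradingPE p (qdeg p * j, qdeg p * j) := by
      have := monomial_mem_gradingPE p 1 j 0
      rw [mul_zero, add_zero] at this
      have h : C (E1.monomial (1 : ZLoc p) 0) * T j = (T j : PE p) := by
        have : E1.monomial (1 : ZLoc p) 0 = 1 := by
          have : (C 1 * T 0 : LaurentZ p) = 1 := by rw [T_zero, map_one, one_mul]
          exact this
        rw [this, map_one, one_mul]
      rwa [h] at this
    refine tmul_mem_tensorGrading ?_ (gradingEE_unitL p k r) h1
    ext <;> simp [add_comm]
  d := 0
  d_mem i x _ := zero_mem _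
  d_d _ := rfl
  coaction_d x := by
    rw [LinearMap.zero_apply, map_zero, LinearMap.restrictScalars_zero, LinearMap.lTensor_zero,
      LinearMap.zero_apply]

/-- The tensor product of morphisms. -/
def tensorMap {X X' Y Y' : QPComplex p} (f : X ⟶ X') (g : Y ⟶ Y') :
    tensorObj X Y ⟶ tensorObj X' Y' where
  toLin := TensorProduct.map f.toLin g.toLin
  map_mem i t ht := by
    refine tensorGrading_le_comap (TensorProduct.map f.toLin g.toLin).toAddMonoidHom _ ?_ ht
    intro a b x y hab hx hy
    exact tmul_mem_tensorGrading hab (f.map_mem _ _ hx) (g.map_mem _ _ hy)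
  map_d t := by
    refine tensor_gr_induction (motive := fun t => TensorProduct.map f.toLin g.toLin
      (tensorD X Y t) = tensorD X' Y' (TensorProduct.map f.toLin g.toLin t))
      X.isInternal Y.isInternal ?_ ?_ ?_ t
    · simp
    · intro x y hx hy
      simp only [map_add, hx, hy]
    · intro i j x y hx hy
      rw [tensorD_tmul X Y hx, TensorProduct.map_tmul, tensorD_tmul X' Y' (f.map_mem _ _ hx),
        map_add, map_zsmul, TensorProduct.map_tmul, TensorProduct.map_tmul, f.map_d, g.map_d]
  map_coaction := CoactionCompat.map _ _ _ _ f.map_coaction g.map_coaction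

/-- Projection to a homogeneous part. -/
def proj (X : QPComplex p) (i : ℤ × ℤ) : X.carrier →+ X.carrier :=
  grLift X.isInternal fun j => if j = i then AddMonoidHom.id _ else 0

lemma proj_of_mem (X : QPComplex p) {i j : ℤ × ℤ} {x : X.carrier} (hx : x ∈ X.grading j) :
    X.proj i x = if j = i then x else 0 := by
  rw [proj, grLift_of_mem _ _ hx]
  split_ifs <;> rfl

lemma proj_mem (X : QPComplex p) (i : ℤ × ℤ) (x : X.carrier) : X.proj i x ∈ X.grading i := by
  induction x using gr_induction X.isInternal with
  | zero => rw [map_zero]; exact zero_mem _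
  | add x y hx hy => rw [map_add]; exact add_mem hx hy
  | mem j x hx =>
    rw [X.proj_of_mem hx]
    split_ifs with h
    · exact h ▸ hx
    · exact zero_mem _

/-- A linear isomorphism that is a morphism of complexes is an isomorphism of complexes. -/
def isoMk {X Y : QPComplex p} (e : X.carrier ≃ₗ[PE p] Y.carrier)
    (map_mem : ∀ i x, x ∈ X.grading i → e x ∈ Y.grading i)
    (map_d : ∀ x, e (X.d x) = Y.d (e x))
    (map_coaction : CoactionCompat X.coaction Y.coaction e.toLinearMap) : X ≅ Y where
  hom := ⟨e.toLinearMap, map_mem, map_d, map_coaction⟩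
  inv :=
    { toLin := e.symm.toLinearMap
      map_mem := fun i y hy => by
        have key : ∀ x, e (X.proj i x) = Y.proj i (e x) := fun x => by
          induction x using gr_induction X.isInternal with
          | zero => simp
          | add x y hx hy => simp only [map_add, hx, hy]
          | mem j x hx =>
            rw [X.proj_of_mem hx, Y.proj_of_mem (map_mem j x hx)]
            split_ifs <;> simp
        have h : e (X.proj i (e.symm y)) = y := by
          rw [key, e.apply_symm_apply, Y.proj_of_mem hy, if_pos rfl]
        have h' : X.proj i (e.symm y) = e.symm y := by
          rw [LinearEquiv.eq_symm_apply, h]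
        change e.symm y ∈ _
        rw [← h']
        exact X.proj_mem i _
      map_d := fun y => by
        change e.symm (Y.d y) = X.d (e.symm y)
        rw [LinearEquiv.symm_apply_eq, map_d, e.apply_symm_apply]
      map_coaction := fun y => by
        obtain ⟨x, rfl⟩ := e.surjective y
        have h := map_coaction x
        rw [LinearEquiv.coe_coe] at h
        rw [LinearEquiv.coe_coe, e.symm_apply_apply, h, ← LinearMap.lTensor_comp_apply]
        have : (e.symm.toLinearMap.restrictScalars (E1 p)) ∘ₗ
            (e.toLinearMap.restrictScalars (E1 p)) = LinearMap.id := by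
          ext x; simp
        rw [this, LinearMap.lTensor_id, LinearMap.id_apply] }
  hom_inv_id := by ext x; simp
  inv_hom_id := by ext x; simp

lemma tensor3_gr_induction (X Y Z : QPComplex p)
    {motive : (X.carrier ⊗[PE p] Y.carrier) ⊗[PE p] Z.carrier → Prop} (zero : motive 0)
    (add : ∀ x y, motive x → motive y → motive (x + y))
    (tmul : ∀ i j k x y z, x ∈ X.grading i → y ∈ Y.grading j → z ∈ Z.grading k →
      motive ((x ⊗ₜ y) ⊗ₜ z)) (t : (X.carrier ⊗[PE p] Y.carrier) ⊗[PE p] Z.carrier) : motive t := by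
  refine tensor_gr_induction (tensorObj X Y).isInternal Z.isInternal zero add ?_ t
  intro _ k s z _ hz
  refine tensor_gr_induction (motive := fun s => motive (s ⊗ₜ z)) X.isInternal Y.isInternal
    ?_ ?_ ?_ s
  · rw [TensorProduct.zero_tmul]; exact zero
  · intro s s' h h'
    rw [TensorProduct.add_tmul]; exact add _ _ h h'
  · intro i j x y hx hy
    exact tmul i j k x y z hx hy hz

lemma assoc_mem (X Y Z : QPComplex p) (i : ℤ × ℤ)
    (t : (X.carrier ⊗[PE p] Y.carrier) ⊗[PE p] Z.carrier)
    (ht : t ∈ tensorGrading (PE p) (tensorGrading (PE p) X.grading Y.grading) Z.grading i) :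
    TensorProduct.assoc (PE p) X.carrier Y.carrier Z.carrier t ∈
      tensorGrading (PE p) X.grading (tensorGrading (PE p) Y.grading Z.grading) i := by
  refine tensorGrading_le_comap
    (TensorProduct.assoc (PE p) X.carrier Y.carrier Z.carrier).toLinearMap.toAddMonoidHom _ ?_ ht
  intro a c s z hac hs hz
  refine tensorGrading_le_comap
    ((TensorProduct.assoc (PE p) X.carrier Y.carrier Z.carrier).toLinearMap.toAddMonoidHom.comp
      (((TensorProduct.mk (PE p) (X.carrier ⊗[PE p] Y.carrier) Z.carrier).flip z).toAddMonoidHom))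
    _ ?_ hs
  intro a b x y hab hx hy
  refine tmul_mem_tensorGrading ?_ hx (tmul_mem_tensorGrading rfl hy hz)
  rw [← hac, ← hab, add_assoc]

lemma assoc_d_aux (X Y Z : QPComplex p)
    (D : (X.carrier ⊗[PE p] Y.carrier) ⊗[PE p] Z.carrier →ₗ[PE p]
      (X.carrier ⊗[PE p] Y.carrier) ⊗[PE p] Z.carrier)
    (D' : X.carrier ⊗[PE p] (Y.carrier ⊗[PE p] Z.carrier) →ₗ[PE p]
      X.carrier ⊗[PE p] (Y.carrier ⊗[PE p] Z.carrier))
    (hD : ∀ i j x y z, x ∈ X.grading i → y ∈ Y.grading j →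
      D ((x ⊗ₜ[PE p] y) ⊗ₜ[PE p] z) = (tensorD X Y (x ⊗ₜ[PE p] y)) ⊗ₜ[PE p] z +
          (if Even (i + j).1 then (1 : ℤ) else -1) • ((x ⊗ₜ[PE p] y) ⊗ₜ[PE p] Z.d z))
    (hD' : ∀ i x y z, x ∈ X.grading i →
      D' (x ⊗ₜ[PE p] (y ⊗ₜ[PE p] z)) = X.d x ⊗ₜ[PE p] (y ⊗ₜ[PE p] z) +
          (if Even i.1 then (1 : ℤ) else -1) • (x ⊗ₜ[PE p] (tensorD Y Z (y ⊗ₜ[PE p] z))))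
    (t : (X.carrier ⊗[PE p] Y.carrier) ⊗[PE p] Z.carrier) :
    TensorProduct.assoc (PE p) X.carrier Y.carrier Z.carrier (D t) =
      D' (TensorProduct.assoc (PE p) X.carrier Y.carrier Z.carrier t) := by
  refine tensor3_gr_induction X Y Z (motive := fun t =>
    TensorProduct.assoc (PE p) X.carrier Y.carrier Z.carrier (D t) =
      D' (TensorProduct.assoc (PE p) X.carrier Y.carrier Z.carrier t))
    ?_ ?_ ?_ t
  · simp only [map_zero]
  · intro x y hx hy
    simp only [map_add, hx, hy]
  · intro i j k x y z hx hy hz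
    have h3 : Even (i.1 + j.1) ↔ (Even i.1 ↔ Even j.1) := Int.even_add
    rw [hD i j x y z hx hy, TensorProduct.assoc_tmul, hD' i x y z hx, tensorD_tmul X Y hx,
      tensorD_tmul Y Z hy]
    by_cases hi : Even i.1 <;> by_cases hj : Even j.1 <;>
      simp only [Prod.fst_add, h3] <;>
      simp [hi, hj, TensorProduct.add_tmul, TensorProduct.tmul_add, TensorProduct.neg_tmul,
        TensorProduct.tmul_neg, add_assoc, -Int.not_even_iff_odd]

lemma assoc_d (X Y Z : QPComplex p) (t : (X.carrier ⊗[PE p] Y.carrier) ⊗[PE p] Z.carrier) :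
    TensorProduct.assoc (PE p) X.carrier Y.carrier Z.carrier (tensorD (tensorObj X Y) Z t) =
      tensorD X (tensorObj Y Z) (TensorProduct.assoc (PE p) X.carrier Y.carrier Z.carrier t) :=
  assoc_d_aux X Y Z (tensorD (tensorObj X Y) Z) (tensorD X (tensorObj Y Z))
    (fun _ _ _ _ z hx hy =>
      tensorD_tmul (tensorObj X Y) Z (tmul_mem_tensorGrading rfl hx hy) z)
    (fun _ _ _ _ hx => tensorD_tmul X (tensorObj Y Z) hx _) t

lemma assoc_coaction (X Y Z : QPComplex p) :
    CoactionCompat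
      ((X.coaction.tensor Y.coaction X.periodic Y.periodic).tensor Z.coaction
        (Coaction.tensor_periodic _ _ _ _) Z.periodic)
      (X.coaction.tensor (Y.coaction.tensor Z.coaction Y.periodic Z.periodic)
        X.periodic (Coaction.tensor_periodic _ _ _ _))
      (TensorProduct.assoc (PE p) X.carrier Y.carrier Z.carrier).toLinearMap := by
  intro t
  refine tensor3_gr_induction X Y Z (motive := fun t =>
    (X.coaction.tensor (Y.coaction.tensor Z.coaction Y.periodic Z.periodic)
        X.periodic (Coaction.tensor_periodic _ _ _ _)).toHom
      ((TensorProduct.assoc (PE p) X.carrier Y.carrier Z.carrier).toLinearMap t) =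
    ((TensorProduct.assoc (PE p) X.carrier Y.carrier Z.carrier).toLinearMap.restrictScalars
      (E1 p)).lTensor (EE p)
      (((X.coaction.tensor Y.coaction X.periodic Y.periodic).tensor Z.coaction
        (Coaction.tensor_periodic _ _ _ _) Z.periodic).toHom t)) ?_ ?_ ?_ t
  · simp only [map_zero]
  · intro x y hx hy
    simp only [map_add, hx, hy]
  · intro i j k x y z hx hy hz
    exact (pairing_assoc (X.coaction.toHom x) (Y.coaction.toHom y) (Z.coaction.toHom z)).symm

/-- The associativity isomorphism `(x ⊗ y) ⊗ z ↦ x ⊗ (y ⊗ z)`. -/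
def assocIso (X Y Z : QPComplex p) :
    tensorObj (tensorObj X Y) Z ≅ tensorObj X (tensorObj Y Z) :=
  isoMk (X := tensorObj (tensorObj X Y) Z) (Y := tensorObj X (tensorObj Y Z))
    (TensorProduct.assoc (PE p) X.carrier Y.carrier Z.carrier)
    (assoc_mem X Y Z) (assoc_d X Y Z) (assoc_coaction X Y Z)

lemma unit_tensor_gr_induction (X : QPComplex p) {motive : PE p ⊗[PE p] X.carrier → Prop}
    (zero : motive 0) (add : ∀ x y, motive x → motive y → motive (x + y))
    (tmul : ∀ r j k x, motive ((C (E1.monomial r k) * T j : PE p) ⊗ₜ x))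
    (t : PE p ⊗[PE p] X.carrier) : motive t := by
  induction t using TensorProduct.induction_on with
  | zero => exact zero
  | add x y hx hy => exact add _ _ hx hy
  | tmul b x =>
    induction b using PE_induction with
    | add b c hb hc => rw [TensorProduct.add_tmul]; exact add _ _ hb hc
    | monomial r j k => exact tmul r j k x

lemma lid_mem (X : QPComplex p) (i : ℤ × ℤ) (t : PE p ⊗[PE p] X.carrier)
    (ht : t ∈ tensorGrading (PE p) (gradingPE p) X.grading i) :
    TensorProduct.lid (PE p) X.carrier t ∈ X.grading i := by
  refine tensorGrading_le_comap (TensorProduct.lid (PE p) X.carrier).toLinearMap.toAddMonoidHom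
    _ ?_ ht
  rintro a b x y rfl hx hy
  exact X.smul_mem a b x y hx hy

lemma lid_d_aux (X : QPComplex p) (D : PE p ⊗[PE p] X.carrier →ₗ[PE p] PE p ⊗[PE p] X.carrier)
    (hD : ∀ r j k x, D ((C (E1.monomial r k) * T j : PE p) ⊗ₜ[PE p] x) =
        (0 : PE p) ⊗ₜ[PE p] x + (if Even (qdeg p * j) then (1 : ℤ) else -1) •
          ((C (E1.monomial r k) * T j : PE p) ⊗ₜ[PE p] X.d x))
    (t : PE p ⊗[PE p] X.carrier) :
    TensorProduct.lid (PE p) X.carrier (D t) = X.d (TensorProduct.lid (PE p) X.carrier t) := by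
  refine unit_tensor_gr_induction X (motive := fun t =>
    TensorProduct.lid (PE p) X.carrier (D t) =
      X.d (TensorProduct.lid (PE p) X.carrier t)) ?_ ?_ ?_ t
  · simp only [map_zero]
  · intro x y hx hy
    simp only [map_add, hx, hy]
  · intro r j k x
    rw [hD, if_pos ((even_qdeg p).mul_right j), one_smul, TensorProduct.zero_tmul, zero_add,
      TensorProduct.lid_tmul, TensorProduct.lid_tmul, map_smul]

lemma lid_d (X : QPComplex p) (t : PE p ⊗[PE p] X.carrier) :
    TensorProduct.lid (PE p) X.carrier (tensorD (unit p) X t) =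
      X.d (TensorProduct.lid (PE p) X.carrier t) :=
  lid_d_aux X (tensorD (unit p) X)
    (fun r j k x => tensorD_tmul (unit p) X (monomial_mem_gradingPE p r j k) x) t

lemma lid_coaction (X : QPComplex p) :
    CoactionCompat ((unitCoaction (hopf p)).tensor X.coaction unitCoaction_periodic X.periodic)
      X.coaction
      (TensorProduct.lid (PE p) X.carrier).toLinearMap := by
  intro t
  refine unit_tensor_gr_induction X (motive := fun t =>
    X.coaction.toHom ((TensorProduct.lid (PE p) X.carrier).toLinearMap t) =
    ((TensorProduct.lid (PE p) X.carrier).toLinearMap.restrictScalars (E1 p)).lTensor (EE p)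
      (((unitCoaction (hopf p)).tensor X.coaction unitCoaction_periodic X.periodic).toHom t))
    ?_ ?_ ?_ t
  · simp only [map_zero]
  · intro x y hx hy
    simp only [map_add, hx, hy]
  · intro r j k x
    refine Eq.trans ?_ (pairing_unit_left (E1.monomial r k) j (X.coaction.toHom x)).symm
    have h : ((C (E1.monomial r k) * T j : PE p)) • x = E1.monomial r k • ((T j : PE p) • x) := by
      rw [mul_smul, C_smul_eq]
    change X.coaction.toHom (TensorProduct.lid (PE p) X.carrier (_ ⊗ₜ[PE p] x)) = _
    rw [TensorProduct.lid_tmul, h, X.coaction.semilinear, X.periodic]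

/-- The left unit isomorphism `b ⊗ x ↦ b x`. -/
def leftUnitIso (X : QPComplex p) : tensorObj (unit p) X ≅ X :=
  isoMk (X := tensorObj (unit p) X) (TensorProduct.lid (PE p) X.carrier)
    (lid_mem X) (lid_d X) (lid_coaction X)

/-- The map `x ⊗ y ↦ (-1)^{|x||y|} y ⊗ x`. -/
def braidLin (X Y : QPComplex p) :
    X.carrier ⊗[PE p] Y.carrier →ₗ[PE p] Y.carrier ⊗[PE p] X.carrier :=
  (TensorProduct.comm (PE p) X.carrier Y.carrier).toLinearMap ∘ₗ
    (TensorProduct.map X.ev LinearMap.id + TensorProduct.map X.od Y.sgn)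

lemma braidLin_tmul (X Y : QPComplex p) {i j : ℤ × ℤ} {x : X.carrier} {y : Y.carrier}
    (hx : x ∈ X.grading i) (hy : y ∈ Y.grading j) : braidLin X Y (x ⊗ₜ y) =
      (if Even i.1 then (1 : ℤ) else if Even j.1 then 1 else -1) • (y ⊗ₜ[PE p] x) := by
  rw [braidLin, LinearMap.comp_apply, LinearMap.add_apply, TensorProduct.map_tmul,
    TensorProduct.map_tmul, X.ev_of_mem hx, X.od_of_mem hx, Y.sgn_of_mem hy]
  by_cases hi : Even i.1 <;> by_cases hj : Even j.1 <;> simp [hi, hj, TensorProduct.tmul_neg]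

lemma braid_braid (X Y : QPComplex p) (t : X.carrier ⊗[PE p] Y.carrier) :
    braidLin Y X (braidLin X Y t) = t := by
  refine tensor_gr_induction (motive := fun t => braidLin Y X (braidLin X Y t) = t)
    X.isInternal Y.isInternal ?_ ?_ ?_ t
  · simp
  · intro x y hx hy
    simp only [map_add, hx, hy]
  · intro i j x y hx hy
    rw [braidLin_tmul X Y hx hy, map_zsmul, braidLin_tmul Y X hy hx]
    by_cases hi : Even i.1 <;> by_cases hj : Even j.1 <;> simp [hi, hj]

lemma braid_mem (X Y : QPComplex p) (i : ℤ × ℤ) (t : X.carrier ⊗[PE p] Y.carrier)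
    (ht : t ∈ tensorGrading (PE p) X.grading Y.grading i) :
    braidLin X Y t ∈ tensorGrading (PE p) Y.grading X.grading i := by
  refine tensorGrading_le_comap (braidLin X Y).toAddMonoidHom _ ?_ ht
  intro a b x y hab hx hy
  rw [LinearMap.toAddMonoidHom_coe, braidLin_tmul X Y hx hy]
  exact zsmul_mem (tmul_mem_tensorGrading (by rw [← hab, add_comm]) hy hx) _

lemma braid_d (X Y : QPComplex p) (t : X.carrier ⊗[PE p] Y.carrier) :
    braidLin X Y (tensorD X Y t) = tensorD Y X (braidLin X Y t) := by
  refine tensor_gr_induction (motive := fun t =>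
    braidLin X Y (tensorD X Y t) = tensorD Y X (braidLin X Y t)) X.isInternal Y.isInternal ?_ ?_ ?_ t
  · simp
  · intro x y hx hy
    simp only [map_add, hx, hy]
  · intro i j x y hx hy
    rw [tensorD_tmul X Y hx, map_add, map_zsmul, braidLin_tmul X Y (X.d_mem _ _ hx) hy,
      braidLin_tmul X Y hx (Y.d_mem _ _ hy), braidLin_tmul X Y hx hy, map_zsmul,
      tensorD_tmul Y X hy]
    have h1 : Even (i + (1, 0) : ℤ × ℤ).1 ↔ ¬ Even i.1 := Int.even_add_one
    have h2 : Even (j + (1, 0) : ℤ × ℤ).1 ↔ ¬ Even j.1 := Int.even_add_one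
    simp only [h1, h2]
    by_cases hi : Even i.1 <;> by_cases hj : Even j.1 <;>
      simp only [hi, hj, if_true, if_false, not_true, not_false_iff, one_smul, neg_smul, smul_add,
        smul_neg, neg_neg] <;> abel

lemma braid_coaction (X Y : QPComplex p) :
    CoactionCompat (X.coaction.tensor Y.coaction X.periodic Y.periodic)
      (Y.coaction.tensor X.coaction Y.periodic X.periodic) (braidLin X Y) := by
  refine CoactionCompat.comp (φ := X.coaction.tensor Y.coaction X.periodic Y.periodic) ?_ ?_
  · exact CoactionCompat.add
      (CoactionCompat.map _ _ _ _ (X.coaction_scale _ _) (CoactionCompat.id _))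
      (CoactionCompat.map _ _ _ _ (X.coaction_scale _ _) (Y.coaction_scale _ _))
  · intro t
    refine TensorProduct.induction_on t ?_ ?_ ?_
    · simp only [map_zero]
    · intro x y
      exact (pairing_comm (X.coaction.toHom x) (Y.coaction.toHom y)).symm
    · intro x y hx hy
      simp only [map_add, hx, hy]

/-- The linear isomorphism `x ⊗ y ↦ (-1)^{|x||y|} y ⊗ x`. -/
def braidEquiv (X Y : QPComplex p) :
    X.carrier ⊗[PE p] Y.carrier ≃ₗ[PE p] Y.carrier ⊗[PE p] X.carrier :=
  LinearEquiv.ofLinearMap (braidLin X Y) (braidLin Y X)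
    (LinearMap.ext (braid_braid Y X)) (LinearMap.ext (braid_braid X Y))

/-- The symmetry isomorphism `x ⊗ y ↦ (-1)^{|x||y|} y ⊗ x`. -/
def braidIso (X Y : QPComplex p) : tensorObj X Y ≅ tensorObj Y X :=
  isoMk (X := tensorObj X Y) (Y := tensorObj Y X) (braidEquiv X Y)
    (braid_mem X Y) (braid_d X Y) (braid_coaction X Y)

lemma braid_unit_aux (X : QPComplex p) (β : X.carrier ⊗[PE p] PE p →ₗ[PE p] PE p ⊗[PE p] X.carrier)
    (hβ : ∀ i j x b, x ∈ X.grading i → b ∈ gradingPE p j → β (x ⊗ₜ b) =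
      (if Even i.1 then (1 : ℤ) else if Even j.1 then 1 else -1) • (b ⊗ₜ[PE p] x))
    (t : X.carrier ⊗[PE p] PE p) :
    TensorProduct.lid (PE p) X.carrier (β t) = TensorProduct.rid (PE p) X.carrier t := by
  refine tensor_gr_induction (motive := fun t =>
    TensorProduct.lid (PE p) X.carrier (β t) =
      TensorProduct.rid (PE p) X.carrier t) X.isInternal (gradingPE_isInternal p) ?_ ?_ ?_ t
  · simp only [map_zero]
  · intro x y hx hy
    simp only [map_add, hx, hy]
  · intro i j x b hx hb
    have h : b = 0 ∨ Even j.1 := by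
      by_contra! h
      refine h.1 (gradingPE_le (AddMonoidHom.id _) ⊥ ?_ hb)
      intro r k l hj
      refine absurd ?_ h.2
      rw [← hj]
      exact (even_qdeg p).mul_right k
    rw [hβ i j x b hx hb]
    rcases h with rfl | h
    · simp
    · rw [if_pos h, ite_self, one_smul]
      simp

lemma braid_unit (X : QPComplex p) (t : X.carrier ⊗[PE p] PE p) :
    TensorProduct.lid (PE p) X.carrier (braidLin X (unit p) t) =
      TensorProduct.rid (PE p) X.carrier t :=
  braid_unit_aux X (braidLin X (unit p)) (fun _ _ _ _ hx hb => braidLin_tmul X (unit p) hx hb) t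

lemma rid_eq (X : QPComplex p) : (TensorProduct.rid (PE p) X.carrier).toLinearMap =
    (TensorProduct.lid (PE p) X.carrier).toLinearMap ∘ₗ braidLin X (unit p) :=
  LinearMap.ext fun t => (braid_unit X t).symm

lemma rid_coaction (X : QPComplex p) :
    CoactionCompat (X.coaction.tensor (unitCoaction (hopf p)) X.periodic unitCoaction_periodic)
      X.coaction (TensorProduct.rid (PE p) X.carrier).toLinearMap := by
  have h : CoactionCompat
      (X.coaction.tensor (unitCoaction (hopf p)) X.periodic unitCoaction_periodic)
      ((unitCoaction (hopf p)).tensor X.coaction unitCoaction_periodic X.periodic)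
      (show X.carrier ⊗[PE p] PE p →ₗ[PE p] PE p ⊗[PE p] X.carrier from braidLin X (unit p)) :=
    braid_coaction X (unit p)
  rw [rid_eq]
  exact h.comp (lid_coaction X)

/-- The right unit isomorphism `x ⊗ b ↦ b x`. -/
def rightUnitIso (X : QPComplex p) : tensorObj X (unit p) ≅ X :=
  isoMk (X := tensorObj X (unit p)) (TensorProduct.rid (PE p) X.carrier)
    (fun i t ht => (congrArg (· ∈ X.grading i) (braid_unit X t)).mp
      (lid_mem X i _ (braid_mem X (unit p) i t ht)))
    (fun t => (braid_unit X _).symm.trans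
      ((congrArg (TensorProduct.lid (PE p) X.carrier) (braid_d X (unit p) t)).trans
        ((lid_d X _).trans (congrArg X.d (braid_unit X t)))))
    (rid_coaction X)

end QPComplex

end Complexes

section Monoidal

variable {p : ℕ}

namespace QPComplex

/-- The tensor product of quasi-periodic complexes over `E(1)_*`. -/
instance : MonoidalCategoryStruct (QPComplex p) where
  tensorObj := tensorObj
  tensorHom := tensorMap
  whiskerLeft X _ _ f := tensorMap (𝟙 X) f
  whiskerRight f Y := tensorMap f (𝟙 Y)
  tensorUnit := unit p
  associator := assocIso
  leftUnitor := leftUnitIso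
  rightUnitor := rightUnitIso

instance : MonoidalCategory (QPComplex p) := MonoidalCategory.ofTensorHom
  (id_tensorHom_id := fun X Y => Hom.ext TensorProduct.map_id)
  (id_tensorHom := fun _ _ _ _ => rfl)
  (tensorHom_id := fun _ _ => rfl)
  (tensorHom_comp_tensorHom := fun f₁ f₂ g₁ g₂ =>
    Hom.ext (TensorProduct.map_comp g₁.toLin g₂.toLin f₁.toLin f₂.toLin).symm)
  (associator_naturality := fun f₁ f₂ f₃ => Hom.ext <| by
    have : (TensorProduct.map f₁.toLin (TensorProduct.map f₂.toLin f₃.toLin)) ∘ₗ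
        (TensorProduct.assoc (PE p) _ _ _).toLinearMap =
      (TensorProduct.assoc (PE p) _ _ _).toLinearMap ∘ₗ
        (TensorProduct.map (TensorProduct.map f₁.toLin f₂.toLin) f₃.toLin) :=
      TensorProduct.ext_threefold fun x y z => rfl
    exact this.symm)
  (leftUnitor_naturality := fun {X Y} f => Hom.ext <| by
    have : (TensorProduct.lid (PE p) Y.carrier).toLinearMap ∘ₗ
        TensorProduct.map LinearMap.id f.toLin =
      f.toLin ∘ₗ (TensorProduct.lid (PE p) X.carrier).toLinearMap :=
      TensorProduct.ext' fun b x => by simp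
    exact this)
  (rightUnitor_naturality := fun {X Y} f => Hom.ext <| by
    have : (TensorProduct.rid (PE p) Y.carrier).toLinearMap ∘ₗ
        TensorProduct.map f.toLin LinearMap.id =
      f.toLin ∘ₗ (TensorProduct.rid (PE p) X.carrier).toLinearMap :=
      TensorProduct.ext' fun b x => by simp
    exact this)
  (pentagon := fun W X Y Z => Hom.ext <| by
    have : TensorProduct.map LinearMap.id
          (TensorProduct.assoc (PE p) X.carrier Y.carrier Z.carrier).toLinearMap ∘ₗ
        ((TensorProduct.assoc (PE p) W.carrier (X.carrier ⊗[PE p] Y.carrier)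
          Z.carrier).toLinearMap ∘ₗ
        TensorProduct.map (TensorProduct.assoc (PE p) W.carrier X.carrier Y.carrier).toLinearMap
          LinearMap.id) =
      (TensorProduct.assoc (PE p) W.carrier X.carrier (Y.carrier ⊗[PE p] Z.carrier)).toLinearMap ∘ₗ
        (TensorProduct.assoc (PE p) (W.carrier ⊗[PE p] X.carrier) Y.carrier
          Z.carrier).toLinearMap :=
      TensorProduct.ext_fourfold fun w x y z => rfl
    exact this)
  (triangle := fun X Y => Hom.ext <| by
    have : TensorProduct.map LinearMap.id (TensorProduct.lid (PE p) Y.carrier).toLinearMap ∘ₗ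
        (TensorProduct.assoc (PE p) X.carrier (PE p) Y.carrier).toLinearMap =
      TensorProduct.map (TensorProduct.rid (PE p) X.carrier).toLinearMap LinearMap.id :=
      TensorProduct.ext_threefold fun x b y => by simp [TensorProduct.smul_tmul]
    exact this)

lemma braid_natural {X X' Y Y' : QPComplex p} (f : X ⟶ X') (g : Y ⟶ Y') :
    braidLin X' Y' ∘ₗ TensorProduct.map f.toLin g.toLin =
      TensorProduct.map g.toLin f.toLin ∘ₗ braidLin X Y := by
  refine LinearMap.ext fun t => ?_
  refine tensor_gr_induction (motive := fun t =>
    (braidLin X' Y' ∘ₗ TensorProduct.map f.toLin g.toLin) t =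
      (TensorProduct.map g.toLin f.toLin ∘ₗ braidLin X Y) t) X.isInternal Y.isInternal ?_ ?_ ?_ t
  · simp
  · intro x y hx hy
    simp only [map_add, hx, hy]
  · intro i j x y hx hy
    rw [LinearMap.comp_apply, LinearMap.comp_apply, TensorProduct.map_tmul,
      braidLin_tmul X' Y' (f.map_mem _ _ hx) (g.map_mem _ _ hy), braidLin_tmul X Y hx hy,
      map_zsmul, TensorProduct.map_tmul]

lemma hexagon_aux (X Y Z : QPComplex p)
    (β : X.carrier ⊗[PE p] (Y.carrier ⊗[PE p] Z.carrier) →ₗ[PE p]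
      (Y.carrier ⊗[PE p] Z.carrier) ⊗[PE p] X.carrier)
    (hβ : ∀ i j k x y z, x ∈ X.grading i → y ∈ Y.grading j → z ∈ Z.grading k →
      β (x ⊗ₜ (y ⊗ₜ z)) = (if Even i.1 then (1 : ℤ) else if Even (j + k).1 then 1 else -1) •
        ((y ⊗ₜ[PE p] z) ⊗ₜ[PE p] x)) :
    (TensorProduct.assoc (PE p) Y.carrier Z.carrier X.carrier).toLinearMap ∘ₗ β ∘ₗ
        (TensorProduct.assoc (PE p) X.carrier Y.carrier Z.carrier).toLinearMap =
      TensorProduct.map LinearMap.id (braidLin X Z) ∘ₗ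
        (TensorProduct.assoc (PE p) Y.carrier X.carrier Z.carrier).toLinearMap ∘ₗ
        TensorProduct.map (braidLin X Y) LinearMap.id := by
  refine LinearMap.ext fun t => ?_
  refine tensor3_gr_induction X Y Z (motive := fun t =>
    ((TensorProduct.assoc (PE p) Y.carrier Z.carrier X.carrier).toLinearMap ∘ₗ β ∘ₗ
        (TensorProduct.assoc (PE p) X.carrier Y.carrier Z.carrier).toLinearMap) t =
      (TensorProduct.map LinearMap.id (braidLin X Z) ∘ₗ
        (TensorProduct.assoc (PE p) Y.carrier X.carrier Z.carrier).toLinearMap ∘ₗ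
        TensorProduct.map (braidLin X Y) LinearMap.id) t) ?_ ?_ ?_ t
  · simp only [map_zero]
  · intro x y hx hy
    simp only [map_add, hx, hy]
  · intro i j k x y z hx hy hz
    have h3 : Even (j.1 + k.1) ↔ (Even j.1 ↔ Even k.1) := Int.even_add
    simp only [LinearMap.comp_apply, LinearEquiv.coe_coe, TensorProduct.assoc_tmul,
      TensorProduct.map_tmul, hβ i j k x y z hx hy hz, braidLin_tmul X Y hx hy,
      LinearMap.id_apply]
    by_cases hi : Even i.1 <;> by_cases hj : Even j.1 <;> by_cases hk : Even k.1 <;>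
      simp only [Prod.fst_add, h3] <;>
      simp [hi, hj, hk, braidLin_tmul X Z hx hz, TensorProduct.neg_tmul, TensorProduct.tmul_neg]

lemma hexagon (X Y Z : QPComplex p) :
    (assocIso X Y Z ≪≫ braidIso X (tensorObj Y Z)) ≪≫ assocIso Y Z X =
      (whiskerRightIso (braidIso X Y) Z ≪≫ assocIso Y X Z) ≪≫ whiskerLeftIso Y (braidIso X Z) :=
  Iso.ext <| Hom.ext <| hexagon_aux X Y Z (braidLin X (tensorObj Y Z))
    fun _ _ _ _ _ _ hx hy hz =>
      braidLin_tmul X (tensorObj Y Z) hx (tmul_mem_tensorGrading rfl hy hz)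

/-- The symmetry is `x ⊗ y ↦ (-1)^{|x||y|} y ⊗ x`. -/
instance : BraidedCategory (QPComplex p) where
  braiding := braidIso
  braiding_naturality_right X _ _ f := Hom.ext (braid_natural (𝟙 X) f)
  braiding_naturality_left f Z := Hom.ext (braid_natural f (𝟙 Z))
  hexagon_forward X Y Z := by
    have h := congrArg Iso.hom (hexagon X Y Z)
    simp only [Iso.trans_hom, Category.assoc] at h
    exact h
  hexagon_reverse X Y Z := by
    have h := congrArg Iso.inv (hexagon Z X Y)
    simp only [Iso.trans_inv] at h
    exact h

instance : SymmetricCategory (QPComplex p) where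
  symmetry X Y := Hom.ext (LinearMap.ext (braid_braid X Y))

end QPComplex

end Monoidal

section Derived

variable {p : ℕ}

/-- The cohomology `ker d / im d`; its part of bidegree `(n, k)` is `H^n(C)_k`. -/
abbrev QPComplex.Cohomology (X : QPComplex p) : Type :=
  LinearMap.ker X.d ⧸ (LinearMap.range X.d).submoduleOf (LinearMap.ker X.d)

/-- The map induced on cohomology. -/
def QPComplex.cohomologyMap {X Y : QPComplex p} (f : X ⟶ Y) :
    X.Cohomology →ₗ[PE p] Y.Cohomology :=
  Submodule.mapQ _ _
    (f.toLin.restrict fun x (hx : x ∈ LinearMap.ker X.d) => by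
      rw [LinearMap.mem_ker] at hx ⊢
      rw [← f.map_d, hx, map_zero])
    (by
      rintro ⟨x, hx⟩ ⟨y, hy⟩
      exact ⟨f.toLin y, (f.map_d y).symm.trans (congrArg f.toLin hy)⟩)

variable (p) in
/-- The class of quasi-isomorphisms. -/
def quasiIso : MorphismProperty (QPComplex p) :=
  fun _ _ f => Function.Bijective (QPComplex.cohomologyMap f)

instance : (quasiIso p).ContainsIdentities where
  id_mem X := by
    have h : QPComplex.cohomologyMap (𝟙 X) = LinearMap.id := by
      refine LinearMap.ext fun x => ?_
      obtain ⟨x, rfl⟩ := Submodule.Quotient.mk_surjective _ x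
      rfl
    change Function.Bijective (QPComplex.cohomologyMap (𝟙 X))
    rw [h]
    exact Function.bijective_id

/-- The derived category: the localization of the category of quasi-periodic complexes at the
quasi-isomorphisms. -/
abbrev DerivedCat (p : ℕ) : Type 1 := (quasiIso p).Localization

/-- The localization functor from complexes to the derived category. -/
abbrev toDerived (p : ℕ) : QPComplex p ⥤ DerivedCat p := (quasiIso p).Q

/-- The flat complexes: those which are flat over `E(1)_*` in each cohomological degree. -/
def isFlat (p : ℕ) : ObjectProperty (QPComplex p) := fun X => Module.Flat (E1 p) X.carrier

/-- The full subcategory of flat complexes. -/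
abbrev CFlat (p : ℕ) : Type 1 := (isFlat p).FullSubcategory

/-- The inclusion of the flat complexes, followed by localization. -/
abbrev gammaFlat (p : ℕ) : CFlat p ⥤ DerivedCat p := (isFlat p).ι ⋙ toDerived p

/-- Homotopy of morphisms of quasi-periodic complexes of comodules: `f - g = d h + h d` for a
comodule map `h` of cohomological degree `-1` and internal degree `0` which commutes with the
periodicity isomorphisms. -/
def Homotopic {X Y : QPComplex p} (f g : X ⟶ Y) : Prop :=
  ∃ h : X.carrier →ₗ[PE p] Y.carrier,
    (∀ i x, x ∈ X.grading i → h x ∈ Y.grading (i - (1, 0))) ∧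
    (∀ x, Y.coaction.toHom (h x) =
      (h.restrictScalars (E1 p)).lTensor (EE p) (X.coaction.toHom x)) ∧
    ∀ x, f.toLin x - g.toLin x = Y.d (h x) + h (X.d x)

/-- The homotopy relation on the morphisms of flat complexes. -/
def homotopyRel (p : ℕ) : HomRel (CFlat p) := fun _ _ f g => Homotopic f.hom g.hom

/-- The homotopy category of flat complexes. -/
abbrev KFlat (p : ℕ) : Type 1 := CategoryTheory.Quotient (homotopyRel p)

/-- The functor from flat complexes to their homotopy category. -/
abbrev toKFlat (p : ℕ) : CFlat p ⥤ KFlat p := CategoryTheory.Quotient.functor (homotopyRel p)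

/-- The quasi-isomorphisms in the homotopy category of flat complexes: the homotopy classes of
quasi-isomorphisms. -/
def quasiIsoKFlat (p : ℕ) : MorphismProperty (KFlat p) := fun X Y f =>
  ∃ g : X.as ⟶ Y.as, (toKFlat p).map g = f ∧ quasiIso p g.hom

/-- The natural transformation `F X ⊗ F Y ⟶ F (X ⊗ Y)` of a lax monoidal functor, as a
transformation of functors on the product category. -/
def laxTensorator {C D : Type*} [Category* C] [Category* D] [MonoidalCategory C]
    [MonoidalCategory D] (F : C ⥤ D) [F.LaxMonoidal] :
    F.prod F ⋙ MonoidalCategory.tensor D ⟶ MonoidalCategory.tensor C ⋙ F where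
  app X := Functor.LaxMonoidal.μ F X.1 X.2
  naturality X Y f := by
    simp [Functor.LaxMonoidal.μ_natural]

end Derived

end FrankeE1

end

open FrankeE1

/-! Three facts carry the proof: flatness of a complex amounts to the absence of `p`-torsion, every
complex is a functorial quotient of a flat one, and tensoring flat complexes preserves
quasi-isomorphisms. The rest is formal.

Flatness. A graded module concentrated in degrees divisible by `N = |v₁|` is the sum of the
`v₁`-translates of its degree `0` part, and `ℤ_(p)` is a valuation ring; so the module is flat over
`E(1)_*` exactly when `p` acts injectively on it (`isFlat_iff_torsionFree`). By periodicity it is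
then flat over `E(1)_*[τ, τ⁻¹]` too, the ring over which the tensor product is formed
(`IsGradedModule.flat_PE`). Subobjects of flat complexes are therefore flat, and resolutions of
length one suffice.

Enough flat comodules. Once the exponents of `u` in `f(u, v)` are bounded, Lagrange interpolation
recovers `f` from finitely many specialisations `f(a^{p-1} v, v)` at units `a` of `ℤ_(p)`. If the
nodes are chosen so that the determinant of the interpolation problem is nonzero of least `p`-adic
valuation, Cramer's rule shows that the interpolation polynomials in `u/v` are stably integral
(`exists_nodes`, `exists_interpolation`). Applied to the coaction on an element `x`, this gives
finitely many elements whose span contains `x` and on which the coaction is given by a matrix over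
the degree `0` part of `E(1)_*E(1)` (`exists_matrixCoefficients`). The free comodule defined by that
matrix maps to the given comodule and hits `x`. The sum of the discs on all such data is a flat
complex, strictly functorial because nothing is chosen, which surjects onto `C`
(`coverπ_surjective`). The replacement `P(C)` is the cone of the inclusion of the kernel of this
surjection.

Tensor products. If `Y` is flat and acyclic, its cycles `Z` are flat, and `d` gives an exact
sequence `0 → Z → Y → Z → 0`. For flat `X`, the connecting map on `H(X ⊗ Z) = H(X) ⊗ Z` is the sign
operator, hence invertible, so `X ⊗ Y` is acyclic (`exists_tensor_boundary`); no boundedness is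
needed. Passing to cones gives the statement on quasi-isomorphisms (`quasiIso_tensorMap_id`).

Formal part. The replacement makes the restriction of `γ` to flat complexes a localization
(`isLocalization_of_resolution`), so the derived category inherits the symmetric monoidal structure
of a localized monoidal category. The transformation `μ` is defined by resolving both factors, and
its axioms are tested on flat objects (`resolvedLaxMonoidal`); being invertible on resolutions, it
exhibits the left derived functor (`isLeftDerivedFunctor_of_resolution`). Finally, homotopic maps
factor through a common cylinder whose projection is a quasi-isomorphism, so they agree after
localization and the passage to `K_flat` changes nothing. -/

noncomputable section

namespace FrankeE1

/-! ### Left derived functors from functorial resolutions. -/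

section LeftDerived

variable {C D H : Type*} [Category* C] [Category* D] [Category* H]

/-- A functor with a comparison map which is invertible on functorial resolutions is a left derived
functor. -/
lemma isLeftDerivedFunctor_of_resolution (L : C ⥤ D) (W : MorphismProperty C) [L.IsLocalization W]
    {F : C ⥤ H} {LF : D ⥤ H} (α : L ⋙ LF ⟶ F) (R : C ⥤ C) (i : R ⟶ 𝟭 C)
    (hi : ∀ X, W (i.app X)) (hα : ∀ X, IsIso (α.app (R.obj X))) :
    LF.IsLeftDerivedFunctor α W := by
  have hLi : ∀ X, IsIso (L.map (i.app X)) := fun X => Localization.inverts L W _ (hi X)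
  rw [Functor.isLeftDerivedFunctor_iff_isRightKanExtension]
  -- The formula is forced: naturality along the isomorphism `L.map (i.app X)` moves a factorization
  -- from `X` to `R.obj X`, where `α` can be inverted.
  let τ : ∀ (G : D ⥤ H) (_ : L ⋙ G ⟶ F), L ⋙ G ⟶ L ⋙ LF := fun G β =>
    { app := fun X => inv (G.map (L.map (i.app X))) ≫ β.app (R.obj X) ≫ inv (α.app (R.obj X)) ≫
        LF.map (L.map (i.app X))
      naturality := fun X Y f => by
        have h1 : G.map (L.map (R.map f)) ≫ G.map (L.map (i.app Y)) =
            G.map (L.map (i.app X)) ≫ G.map (L.map f) := by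
          simp only [← Functor.map_comp, i.naturality, Functor.id_map]
        have h2 : LF.map (L.map (R.map f)) ≫ LF.map (L.map (i.app Y)) =
            LF.map (L.map (i.app X)) ≫ LF.map (L.map f) := by
          simp only [← Functor.map_comp, i.naturality, Functor.id_map]
        have h3 := β.naturality (R.map f)
        have h4 := α.naturality (R.map f)
        simp only [Functor.comp_map, Functor.comp_obj] at h3 h4 ⊢
        rw [← cancel_epi (G.map (L.map (i.app X))), ← reassoc_of% h1]
        simp only [Category.assoc, IsIso.hom_inv_id_assoc]
        rw [← h2, reassoc_of% h3]
        congr 1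
        rw [← cancel_epi (α.app (R.obj X))]
        rw [IsIso.hom_inv_id_assoc, ← reassoc_of% h4, IsIso.hom_inv_id_assoc] }
  have hτ : ∀ (G : D ⥤ H) (β : L ⋙ G ⟶ F), τ G β ≫ α = β := fun G β => by
    ext X
    have h1 := α.naturality (i.app X)
    have h2 := β.naturality (i.app X)
    simp only [Functor.comp_map, Functor.comp_obj, Functor.id_obj] at h1 h2
    simp [τ, h1, ← h2]
  refine ⟨⟨Limits.IsTerminal.ofUniqueHom (fun E => CostructuredArrow.homMk
    (Localization.liftNatTrans L W (L ⋙ E.left) (L ⋙ LF) E.left LF (τ E.left E.hom)) ?_) ?_⟩⟩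
  · refine Eq.trans ?_ (hτ E.left E.hom)
    ext X
    change (Localization.liftNatTrans L W _ _ _ _ _).app _ ≫ _ = _
    rw [Localization.liftNatTrans_app]
    change (𝟙 _ ≫ (τ E.left E.hom).app X ≫ 𝟙 _) ≫ α.app X = _
    rw [Category.id_comp, Category.comp_id]
    rfl
  · intro E m
    ext1
    refine Localization.natTrans_ext L W fun X => ?_
    have hm : ∀ Y, m.left.app (L.obj Y) ≫ α.app Y = E.hom.app Y := fun Y =>
      NatTrans.congr_app (CostructuredArrow.w m) Y
    -- Uniqueness: the same naturality argument recovers the formula for `τ` from any factorization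
    -- `n`.
    have key : ∀ (n : E.left ⟶ LF), (∀ Y, n.app (L.obj Y) ≫ α.app Y = E.hom.app Y) →
        n.app (L.obj X) = (τ E.left E.hom).app X := fun n hn => by
      simp only [τ]
      rw [IsIso.eq_inv_comp, n.naturality, ← hn, Category.assoc, IsIso.hom_inv_id_assoc]
    refine (key m.left hm).trans (Eq.trans ?_ (Localization.liftNatTrans_app L W (L ⋙ E.left)
      (L ⋙ LF) E.left LF (τ E.left E.hom) X).symm)
    change _ = 𝟙 _ ≫ (τ E.left E.hom).app X ≫ 𝟙 _
    rw [Category.id_comp, Category.comp_id]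

end LeftDerived

/-! ### Extending a monoidal structure from resolving objects to a lax one on the whole category. -/

section Lax

variable {C D : Type*} [Category* C] [Category* D] [MonoidalCategory C] [MonoidalCategory D]
  (L : C ⥤ D) (Fl : ObjectProperty C) [Fl.IsMonoidal] [(Fl.ι ⋙ L).Monoidal]
  (R : C ⥤ C) (i : R ⟶ 𝟭 C) (hR : ∀ X, Fl (R.obj X)) (hi : ∀ X, IsIso (L.map (i.app X)))

open Functor.LaxMonoidal

/-- The tensorator of the restriction of `L` to a monoidal full subcategory. -/
abbrev restrictedTensorator (A B : Fl.FullSubcategory) :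
    L.obj A.obj ⊗ L.obj B.obj ⟶ L.obj (A.obj ⊗ B.obj) :=
  μ (Fl.ι ⋙ L) A B

lemma restrictedTensorator_natural {A A' B B' : Fl.FullSubcategory} (f : A.obj ⟶ A'.obj)
    (g : B.obj ⟶ B'.obj) :
    (L.map f ⊗ₘ L.map g) ≫ restrictedTensorator L Fl A' B' =
      restrictedTensorator L Fl A B ≫ L.map (f ⊗ₘ g) :=
  μ_natural (F := Fl.ι ⋙ L) (ObjectProperty.homMk f) (ObjectProperty.homMk g)

/-- The tensorator `L X ⊗ L Y ⟶ L (X ⊗ Y)` obtained by resolving both factors. -/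
def resolvedTensorator (X Y : C) : L.obj X ⊗ L.obj Y ⟶ L.obj (X ⊗ Y) :=
  (inv (L.map (i.app X)) ⊗ₘ inv (L.map (i.app Y))) ≫
    restrictedTensorator L Fl ⟨_, hR X⟩ ⟨_, hR Y⟩ ≫ L.map (i.app X ⊗ₘ i.app Y)

/-- The choice of resolution is irrelevant: arbitrary maps from objects of `Fl` may take the place
of `i`. Naturality of `i` replaces `a`, `b` by `R.map a`, `R.map b`, which are maps between objects
of `Fl`, where the restricted tensorator is natural. Through this formula each coherence law reduces
to the one for `Fl.ι ⋙ L`. -/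
lemma resolvedTensorator_comp (A B : Fl.FullSubcategory) {X Y : C} (a : A.obj ⟶ X)
    (b : B.obj ⟶ Y) :
    (L.map a ⊗ₘ L.map b) ≫ resolvedTensorator L Fl R i hR hi X Y =
      restrictedTensorator L Fl A B ≫ L.map (a ⊗ₘ b) := by
  have h := restrictedTensorator_natural L Fl (A := ⟨_, hR A.obj⟩) (B := ⟨_, hR B.obj⟩)
    (i.app A.obj) (i.app B.obj)
  have h' := restrictedTensorator_natural L Fl (A := ⟨_, hR A.obj⟩) (B := ⟨_, hR B.obj⟩)
    (A' := ⟨_, hR X⟩) (B' := ⟨_, hR Y⟩) (R.map a) (R.map b)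
  have ha := i.naturality a
  have hb := i.naturality b
  simp only [Functor.id_obj, Functor.id_map] at h h' ha hb
  rw [← cancel_epi (L.map (i.app A.obj) ⊗ₘ L.map (i.app B.obj))]
  rw [reassoc_of% h, ← Functor.map_comp, tensorHom_comp_tensorHom, tensorHom_comp_tensorHom_assoc,
    ← L.map_comp, ← L.map_comp, ← ha, ← hb, L.map_comp, L.map_comp, resolvedTensorator,
    tensorHom_comp_tensorHom_assoc, Category.assoc, Category.assoc, IsIso.hom_inv_id,
    IsIso.hom_inv_id, Category.comp_id, Category.comp_id, reassoc_of% h', ← L.map_comp,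
    tensorHom_comp_tensorHom]

lemma resolvedTensorator_eq (A B : Fl.FullSubcategory) :
    resolvedTensorator L Fl R i hR hi A.obj B.obj = restrictedTensorator L Fl A B := by
  simpa using resolvedTensorator_comp L Fl R i hR hi A B (𝟙 A.obj) (𝟙 B.obj)

lemma isIso_resolvedTensorator (A B : Fl.FullSubcategory) :
    IsIso (resolvedTensorator L Fl R i hR hi A.obj B.obj) := by
  rw [resolvedTensorator_eq]
  exact inferInstanceAs (IsIso (μ (Fl.ι ⋙ L) A B))

-- Maps out of a tensor product in `D` can be tested on objects of `Fl`, because `L` inverts the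
-- resolutions.
omit [MonoidalCategory C] [Fl.IsMonoidal] [(Fl.ι ⋙ L).Monoidal] in
include R i hR hi in
lemma hom_ext_of_resolution {X Y : C} {Z : D} {f g : L.obj X ⊗ L.obj Y ⟶ Z}
    (h : ∀ (A B : Fl.FullSubcategory) (a : A.obj ⟶ X) (b : B.obj ⟶ Y),
      (L.map a ⊗ₘ L.map b) ≫ f = (L.map a ⊗ₘ L.map b) ≫ g) : f = g := by
  rw [← cancel_epi (L.map (i.app X) ⊗ₘ L.map (i.app Y))]
  exact h ⟨_, hR X⟩ ⟨_, hR Y⟩ _ _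

omit [MonoidalCategory C] [Fl.IsMonoidal] [(Fl.ι ⋙ L).Monoidal] in
include R i hR hi in
lemma hom_ext_of_resolution₃ {X Y Z : C} {T : D} {f g : (L.obj X ⊗ L.obj Y) ⊗ L.obj Z ⟶ T}
    (h : ∀ (A B E : Fl.FullSubcategory) (a : A.obj ⟶ X) (b : B.obj ⟶ Y) (e : E.obj ⟶ Z),
      ((L.map a ⊗ₘ L.map b) ⊗ₘ L.map e) ≫ f = ((L.map a ⊗ₘ L.map b) ⊗ₘ L.map e) ≫ g) : f = g := by
  rw [← cancel_epi ((L.map (i.app X) ⊗ₘ L.map (i.app Y)) ⊗ₘ L.map (i.app Z))]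
  exact h ⟨_, hR X⟩ ⟨_, hR Y⟩ ⟨_, hR Z⟩ _ _ _

/-- The lax monoidal structure obtained by resolving both factors of a tensor product. -/
@[reducible]
def resolvedLaxMonoidal : L.LaxMonoidal where
  ε := ε (Fl.ι ⋙ L)
  μ := resolvedTensorator L Fl R i hR hi
  μ_natural_left {X Y} f X' := by
    refine hom_ext_of_resolution L Fl R i hR hi fun A B a b => ?_
    have h := resolvedTensorator_comp L Fl R i hR hi A B (a ≫ f) b
    have h' := resolvedTensorator_comp L Fl R i hR hi A B a b
    rw [← tensorHom_id, tensorHom_comp_tensorHom_assoc, ← L.map_comp, Category.comp_id, h,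
      reassoc_of% h', ← L.map_comp, ← tensorHom_id, tensorHom_comp_tensorHom, Category.comp_id]
  μ_natural_right {X Y} X' f := by
    refine hom_ext_of_resolution L Fl R i hR hi fun A B a b => ?_
    have h := resolvedTensorator_comp L Fl R i hR hi A B a (b ≫ f)
    have h' := resolvedTensorator_comp L Fl R i hR hi A B a b
    rw [← id_tensorHom, tensorHom_comp_tensorHom_assoc, ← L.map_comp, Category.comp_id, h,
      reassoc_of% h', ← L.map_comp, ← id_tensorHom, tensorHom_comp_tensorHom, Category.comp_id]
  associativity X Y Z := by
    refine hom_ext_of_resolution₃ L Fl R i hR hi fun A B E a b e => ?_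
    have h1 := resolvedTensorator_comp L Fl R i hR hi A B a b
    -- The object `A ⊗ B` lies in `Fl` and maps to `X ⊗ Y`, so it is an admissible test object for
    -- the outer tensorator.
    have h2 := resolvedTensorator_comp L Fl R i hR hi (A ⊗ B) E (a ⊗ₘ b) e
    have h3 := resolvedTensorator_comp L Fl R i hR hi B E b e
    have h4 := resolvedTensorator_comp L Fl R i hR hi A (B ⊗ E) a (b ⊗ₘ e)
    have h5 : restrictedTensorator L Fl A B ▷ L.obj E.obj ≫ restrictedTensorator L Fl (A ⊗ B) E ≫
        L.map (α_ A.obj B.obj E.obj).hom = (α_ (L.obj A.obj) (L.obj B.obj) (L.obj E.obj)).hom ≫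
        L.obj A.obj ◁ restrictedTensorator L Fl B E ≫ restrictedTensorator L Fl A (B ⊗ E) :=
      associativity (Fl.ι ⋙ L) A B E
    have h6 : ((L.map a ⊗ₘ L.map b) ⊗ₘ L.map e) ≫ resolvedTensorator L Fl R i hR hi X Y ▷ L.obj Z =
        restrictedTensorator L Fl A B ▷ L.obj E.obj ≫ (L.map (a ⊗ₘ b) ⊗ₘ L.map e) := by
      rw [← tensorHom_id, ← tensorHom_id, tensorHom_comp_tensorHom, tensorHom_comp_tensorHom, h1,
        Category.comp_id, Category.id_comp]
    have h7 : (L.map a ⊗ₘ (L.map b ⊗ₘ L.map e)) ≫ L.obj X ◁ resolvedTensorator L Fl R i hR hi Y Z =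
        L.obj A.obj ◁ restrictedTensorator L Fl B E ≫ (L.map a ⊗ₘ L.map (b ⊗ₘ e)) := by
      rw [← id_tensorHom, ← id_tensorHom, tensorHom_comp_tensorHom, tensorHom_comp_tensorHom, h3,
        Category.comp_id, Category.id_comp]
    refine (reassoc_of% h6) _ |>.trans ?_
    refine (congrArg (restrictedTensorator L Fl A B ▷ L.obj E.obj ≫ ·)
      ((reassoc_of% h2) _)).trans ?_
    rw [← L.map_comp, associator_naturality, L.map_comp, reassoc_of% h5,
      associator_naturality_assoc, reassoc_of% h7]
    exact congrArg (fun t => _ ≫ _ ≫ t) h4.symm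
  left_unitality X := by
    -- The unit already lies in `Fl`: it is paired with its identity, and only `X` is resolved.
    have h1 : (𝟙 (L.obj (𝟙_ C)) ⊗ₘ L.map (i.app X)) ≫ resolvedTensorator L Fl R i hR hi (𝟙_ C) X =
        restrictedTensorator L Fl (𝟙_ _) ⟨_, hR X⟩ ≫ L.map (𝟙_ C ◁ i.app X) := by
      rw [← L.map_id, ← id_tensorHom]
      exact resolvedTensorator_comp L Fl R i hR hi (𝟙_ _) ⟨_, hR X⟩ (𝟙 (𝟙_ C)) (i.app X)
    have h2 : (λ_ (L.obj (R.obj X))).hom = ε (Fl.ι ⋙ L) ▷ L.obj (R.obj X) ≫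
        restrictedTensorator L Fl (𝟙_ _) ⟨_, hR X⟩ ≫ L.map (λ_ (R.obj X)).hom :=
      left_unitality (Fl.ι ⋙ L) (⟨_, hR X⟩ : Fl.FullSubcategory)
    rw [← cancel_epi (𝟙_ D ◁ L.map (i.app X)), leftUnitor_naturality, h2]
    refine Eq.trans ?_ (whisker_exchange_assoc (ε (Fl.ι ⋙ L)) (L.map (i.app X)) _).symm
    rw [Category.assoc]
    refine congrArg (_ ≫ ·) ?_
    rw [id_tensorHom] at h1
    refine Eq.trans ?_ ((reassoc_of% h1) _).symm
    rw [← L.map_comp, leftUnitor_naturality, L.map_comp, Category.assoc]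
  right_unitality X := by
    have h1 : (L.map (i.app X) ⊗ₘ 𝟙 (L.obj (𝟙_ C))) ≫ resolvedTensorator L Fl R i hR hi X (𝟙_ C) =
        restrictedTensorator L Fl ⟨_, hR X⟩ (𝟙_ _) ≫ L.map (i.app X ▷ 𝟙_ C) := by
      rw [← L.map_id, ← tensorHom_id]
      exact resolvedTensorator_comp L Fl R i hR hi ⟨_, hR X⟩ (𝟙_ _) (i.app X) (𝟙 (𝟙_ C))
    have h2 : (ρ_ (L.obj (R.obj X))).hom = L.obj (R.obj X) ◁ ε (Fl.ι ⋙ L) ≫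
        restrictedTensorator L Fl ⟨_, hR X⟩ (𝟙_ _) ≫ L.map (ρ_ (R.obj X)).hom :=
      right_unitality (Fl.ι ⋙ L) (⟨_, hR X⟩ : Fl.FullSubcategory)
    rw [← cancel_epi (L.map (i.app X) ▷ 𝟙_ D), rightUnitor_naturality, h2]
    refine Eq.trans ?_ (whisker_exchange_assoc (L.map (i.app X)) (ε (Fl.ι ⋙ L)) _)
    rw [Category.assoc]
    refine congrArg (_ ≫ ·) ?_
    rw [tensorHom_id] at h1
    refine Eq.trans ?_ ((reassoc_of% h1) _).symm
    rw [← L.map_comp, rightUnitor_naturality, L.map_comp, Category.assoc]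

end Lax

/-! ### Compatibility of the resolved tensorator with the symmetry. -/

section Braided

variable {C D : Type*} [Category* C] [Category* D] [MonoidalCategory C] [MonoidalCategory D]
  [BraidedCategory C] [BraidedCategory D]
  (L : C ⥤ D) (Fl : ObjectProperty C) [Fl.IsMonoidal] [(Fl.ι ⋙ L).Braided]
  (R : C ⥤ C) (i : R ⟶ 𝟭 C) (hR : ∀ X, Fl (R.obj X)) (hi : ∀ X, IsIso (L.map (i.app X)))

/-- The lax braided structure obtained by resolving both factors of a tensor product. -/
@[reducible]
def resolvedLaxBraided : L.LaxBraided where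
  toLaxMonoidal := resolvedLaxMonoidal L Fl R i hR hi
  braided X Y := by
    refine hom_ext_of_resolution L Fl R i hR hi fun A B a b => ?_
    have h1 := resolvedTensorator_comp L Fl R i hR hi A B a b
    have h2 := resolvedTensorator_comp L Fl R i hR hi B A b a
    have h3 : restrictedTensorator L Fl A B ≫ L.map (β_ A.obj B.obj).hom =
        (β_ (L.obj A.obj) (L.obj B.obj)).hom ≫ restrictedTensorator L Fl B A :=
      Functor.LaxBraided.braided (F := Fl.ι ⋙ L) A B
    refine ((reassoc_of% h1) _).trans ?_
    rw [BraidedCategory.braiding_naturality_assoc, ← L.map_comp,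
      BraidedCategory.braiding_naturality, L.map_comp, reassoc_of% h3]
    exact congrArg (_ ≫ ·) h2.symm

end Braided

/-! ### The derived tensor product on a localization. -/

section Main

/-- Both natural transformations become isomorphisms after localization, so the localized functors
are quasi-inverse to each other. No adjunction is needed, and both transformations may point towards
the identity. -/
lemma isLocalizedEquivalence_of_counit_of_counit {C₁ C₂ : Type*} [Category* C₁] [Category* C₂]
    {W₁ : MorphismProperty C₁} {W₂ : MorphismProperty C₂} (Φ : LocalizerMorphism W₁ W₂)
    (Ψ : LocalizerMorphism W₂ W₁)
    (ε₁ : Φ.functor ⋙ Ψ.functor ⟶ 𝟭 C₁) (ε₂ : Ψ.functor ⋙ Φ.functor ⟶ 𝟭 C₂)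
    (hε₁ : ∀ X₁, W₁ (ε₁.app X₁)) (hε₂ : ∀ X₂, W₂ (ε₂.app X₂)) :
    Φ.IsLocalizedEquivalence where
  isEquivalence := by
    have : IsIso (Functor.whiskerRight ε₁ W₁.Q) := by
      rw [NatTrans.isIso_iff_isIso_app]
      exact fun _ ↦ Localization.inverts W₁.Q W₁ _ (hε₁ _)
    have : IsIso (Functor.whiskerRight ε₂ W₂.Q) := by
      rw [NatTrans.isIso_iff_isIso_app]
      exact fun _ ↦ Localization.inverts W₂.Q W₂ _ (hε₂ _)
    refine (Localization.equivalence W₁.Q W₁ W₂.Q W₂ (Φ.functor ⋙ W₂.Q)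
      (Φ.localizedFunctor W₁.Q W₂.Q)
      (Ψ.functor ⋙ W₁.Q) (Ψ.localizedFunctor W₂.Q W₁.Q) ?_ ?_).isEquivalence_functor
    · exact Functor.associator _ _ _ ≪≫
        Functor.isoWhiskerLeft _ (CatCommSq.iso Ψ.functor W₂.Q W₁.Q _).symm ≪≫
        (Functor.associator _ _ _).symm ≪≫
        asIso (Functor.whiskerRight ε₁ W₁.Q) ≪≫ Functor.leftUnitor _
    · exact Functor.associator _ _ _ ≪≫
        Functor.isoWhiskerLeft _ (CatCommSq.iso Φ.functor W₁.Q W₂.Q _).symm ≪≫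
        (Functor.associator _ _ _).symm ≪≫
        asIso (Functor.whiskerRight ε₂ W₂.Q) ≪≫ Functor.leftUnitor _

variable {C D : Type*} [Category* C] [Category* D] (W : MorphismProperty C) (L : C ⥤ D)
  [L.IsLocalization W] (Fl : ObjectProperty C)
  (R : C ⥤ C) (i : R ⟶ 𝟭 C) (hR : ∀ X, Fl (R.obj X)) (hi : ∀ X, W (i.app X))

-- Resolution is inverse to the inclusion of `Fl` up to maps in `W`, so the objects of `Fl` alone
-- already present the localization.
include R i hR hi in
lemma isLocalization_of_resolution [W.HasTwoOutOfThreeProperty] :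
    (Fl.ι ⋙ L).IsLocalization (W.inverseImage Fl.ι) := by
  let Φ : LocalizerMorphism (W.inverseImage Fl.ι) W := .ofEq rfl
  let Ψ : LocalizerMorphism W (W.inverseImage Fl.ι) :=
    { functor := Fl.lift R hR
      map := fun X Y f hf => by
        have := i.naturality f
        change W (R.map f)
        -- Two out of three in the naturality square of `i`: the functor `R` preserves `W`.
        rw [← W.postcomp_iff _ _ (hi Y), this]
        exact W.comp_mem _ _ (hi X) hf }
  let ε₁ : Φ.functor ⋙ Ψ.functor ⟶ 𝟭 _ :=
    { app := fun X => ObjectProperty.homMk (i.app X.obj)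
      naturality := fun X Y f => ObjectProperty.hom_ext _ (i.naturality f.hom) }
  have : Φ.IsLocalizedEquivalence :=
    isLocalizedEquivalence_of_counit_of_counit Φ Ψ ε₁ i (fun X => hi X.obj) hi
  have h : (Φ.functor ⋙ L).IsLocalization (W.inverseImage Fl.ι) := inferInstance
  exact h

variable [W.ContainsIdentities] [MonoidalCategory C] [SymmetricCategory C] [Fl.IsMonoidal]

-- Here the tensor product of `D` is already compatible with `L` on `Fl`. Resolving both factors
-- extends this to a lax structure on `L`, and `R.prod R` serves as resolution for the functor of
-- two variables, as `μ` is invertible on pairs of objects of `Fl`.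
include R i hR hi in
lemma exists_derived_of_braided [MonoidalCategory D] [SymmetricCategory D] [(Fl.ι ⋙ L).Braided] :
    ∃ _ : L.LaxBraided, IsIso (Functor.LaxMonoidal.ε L) ∧
      (tensor D).IsLeftDerivedFunctor (laxTensorator L) (W.prod W) ∧
      ∀ X Y, Fl X → Fl Y → IsIso (Functor.LaxMonoidal.μ L X Y) := by
  have hε : IsIso (Functor.LaxMonoidal.ε (Fl.ι ⋙ L)) := inferInstance
  have hi' : ∀ X, IsIso (L.map (i.app X)) := fun X => Localization.inverts L W _ (hi X)
  let l : L.LaxBraided := resolvedLaxBraided L Fl R i hR hi'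
  have hμ : ∀ X Y, Fl X → Fl Y → IsIso (Functor.LaxMonoidal.μ L X Y) := fun X Y hX hY =>
    isIso_resolvedTensorator L Fl R i hR hi' ⟨X, hX⟩ ⟨Y, hY⟩
  refine ⟨l, hε, ?_, hμ⟩
  exact isLeftDerivedFunctor_of_resolution (L.prod L) (W.prod W) (laxTensorator L) (R.prod R)
    { app := fun X => (i.app X.1, i.app X.2)
      naturality := fun X Y f => Prod.ext (i.naturality f.1) (i.naturality f.2) }
    (fun X => ⟨hi X.1, hi X.2⟩) (fun X => hμ _ _ (hR X.1) (hR X.2))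

variable [W.HasTwoOutOfThreeProperty] [(W.inverseImage Fl.ι).IsMonoidal]

include R i hR hi in
/-- The derived tensor product on the localization of a symmetric monoidal category with functorial
resolutions by a monoidal full subcategory on which the tensor product preserves the class of
morphisms to be inverted. -/
theorem exists_derived_symmetricCategory :
    ∃ (_ : MonoidalCategory D) (_ : SymmetricCategory D) (_ : L.LaxBraided),
      IsIso (Functor.LaxMonoidal.ε L) ∧
      (tensor D).IsLeftDerivedFunctor (laxTensorator L) (W.prod W) ∧
      ∀ X Y, Fl X → Fl Y → IsIso (Functor.LaxMonoidal.μ L X Y) := by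
  have := isLocalization_of_resolution W L Fl R i hR hi
  -- The unit of the localized structure is taken to be the image of the unit itself.
  let e := Iso.refl ((Fl.ι ⋙ L).obj (𝟙_ _))
  -- `D'` is the category `D` under another name, carrying the tensor product inherited from `Fl`;
  -- the structures found on `D'` are returned as structures on `D`.
  let D' := LocalizedMonoidal (Fl.ι ⋙ L) (W.inverseImage Fl.ι) e
  let L' : C ⥤ D' := L
  have : L'.IsLocalization W := ‹L.IsLocalization W›
  let b : (Fl.ι ⋙ L').Braided := (inferInstance :
    (Localization.Monoidal.toMonoidalCategory (Fl.ι ⋙ L) (W.inverseImage Fl.ι) e).Braided)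
  exact ⟨(inferInstance : MonoidalCategory D'), (inferInstance : SymmetricCategory D'),
    exists_derived_of_braided W L' Fl R i hR hi⟩

end Main

/-! ### Flatness over Laurent polynomial rings. -/

section LaurentFlat

variable {R M : Type} [CommRing R] [AddCommGroup M] [Module R M] [Module R[T;T⁻¹] M]
  [IsScalarTower R R[T;T⁻¹] M]

omit [Module R[T;T⁻¹] M] [IsScalarTower R R[T;T⁻¹] M] in
lemma flat_range_of_idempotent (e : M →ₗ[R] M) (he : ∀ x, e (e x) = e x) [Module.Flat R M] :
    Module.Flat R (LinearMap.range e) :=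
  Module.Flat.of_retract (LinearMap.range e).subtype e.rangeRestrict (by
    ext ⟨x, y, rfl⟩
    exact he y)

/-- A module over `R[T, T⁻¹]` which is the direct sum of the translates of the image of an
`R`-linear projector is flat if this image is flat over `R`. -/
lemma flat_laurent (e : M →ₗ[R] M) (he : ∀ x, e (e x) = e x)
    (he0 : ∀ k : ℤ, k ≠ 0 → ∀ x, e ((T k : R[T;T⁻¹]) • e x) = 0)
    (hspan : ∀ x, x ∈ AddSubgroup.closure {y | ∃ (k : ℤ) (z : M), (T k : R[T;T⁻¹]) • e z = y})
    [Module.Flat R (LinearMap.range e)] : Module.Flat R[T;T⁻¹] M := by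
  -- `M` will be identified with the base change of the image of `e`, which is flat.
  let φ : R[T;T⁻¹] ⊗[R] LinearMap.range e →ₗ[R[T;T⁻¹]] M :=
    LinearMap.liftBaseChange R[T;T⁻¹] (LinearMap.range e).subtype
  have hφ : ∀ (b : R[T;T⁻¹]) (m : LinearMap.range e), φ (b ⊗ₜ m) = b • (m : M) := fun b m => by
    simp [φ]
  have hsurj : Function.Surjective φ := fun x => by
    have : AddSubgroup.closure {y | ∃ (k : ℤ) (z : M), (T k : R[T;T⁻¹]) • e z = y} ≤
        φ.toAddMonoidHom.range := by
      rw [AddSubgroup.closure_le]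
      rintro _ ⟨k, z, rfl⟩
      exact ⟨T k ⊗ₜ ⟨e z, z, rfl⟩, hφ _ _⟩
    exact this (hspan x)
  let s : (ℤ →₀ LinearMap.range e) →+ R[T;T⁻¹] ⊗[R] LinearMap.range e :=
    Finsupp.liftAddHom fun k => (TensorProduct.mk R R[T;T⁻¹] (LinearMap.range e) (T k)).toAddMonoidHom
  have hs1 : ∀ k m, s (Finsupp.single k m) = T k ⊗ₜ m := fun k m => by simp [s]
  have hs : Function.Surjective s := fun z => by
    induction z using TensorProduct.induction_on with
    | zero => exact ⟨0, map_zero _⟩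
    | add x y hx hy =>
      obtain ⟨a, rfl⟩ := hx
      obtain ⟨b, rfl⟩ := hy
      exact ⟨a + b, map_add _ _ _⟩
    | tmul b m =>
      induction b using LaurentPolynomial.induction_on' with
      | add b c hb hc =>
        obtain ⟨x, hx⟩ := hb
        obtain ⟨y, hy⟩ := hc
        exact ⟨x + y, by rw [map_add, hx, hy, TensorProduct.add_tmul]⟩
      | C_mul_T n a =>
        refine ⟨Finsupp.single n (a • m), ?_⟩
        rw [hs1, TensorProduct.tmul_smul, TensorProduct.smul_tmul', LaurentPolynomial.smul_eq_C_mul]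
  -- After multiplication by `T (-j)` only the summand with index `j` survives the projector, so the
  -- coefficients can be read off and `φ` is injective.
  have hcoeff : ∀ (f : ℤ →₀ LinearMap.range e) (j : ℤ), e ((T (-j) : R[T;T⁻¹]) • φ (s f)) = f j := by
    intro f j
    induction f using Finsupp.induction_linear with
    | zero => simp
    | add f g hf hg => simp only [map_add, smul_add, hf, hg, Finsupp.add_apply, Submodule.coe_add]
    | single k m =>
      obtain ⟨_, x, rfl⟩ := m
      rw [hs1, hφ, smul_smul, ← T_add, Finsupp.single_apply]
      split_ifs with h
      · subst h
        simp [he]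
      · rw [he0 _ (fun h' => h (by omega))]
        rfl
  have hinj : Function.Injective φ := by
    rw [injective_iff_map_eq_zero]
    intro z hz
    obtain ⟨f, rfl⟩ := hs z
    have : f = 0 := by
      ext j
      rw [← hcoeff, hz, smul_zero, map_zero]
      rfl
    rw [this, map_zero]
  exact Module.Flat.of_linearEquiv (LinearEquiv.ofBijective φ ⟨hinj, hsurj⟩).symm

end LaurentFlat

/-! ### Torsion and flatness over `ℤ_(p)`. -/

section ZLoc

variable {p : ℕ}

lemma mem_ZLoc {x : ℚ} : x ∈ ZLoc p ↔ p.Coprime x.den := Iff.rfl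

lemma inv_natCast_mem_ZLoc {m : ℕ} (h : p.Coprime m) : (m : ℚ)⁻¹ ∈ ZLoc p := by
  rw [mem_ZLoc]
  rcases Nat.eq_zero_or_pos m with rfl | hm
  · simp
  · rwa [Rat.inv_natCast_den_of_pos hm]

/-- If `p` divides the denominator of the reduced fraction `a / b`, it does not divide the
numerator; hence one of `a / b` and `b / a` is `p`-integral. -/
instance [Fact p.Prime] : ValuationRing (ZLoc p) := by
  rw [ValuationRing.iff_dvd_total]
  refine ⟨fun a b => ?_⟩
  have key : ∀ a b : ZLoc p, b ≠ 0 → ((a : ℚ) / b ∈ ZLoc p) → b ∣ a := fun a b hb h =>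
    ⟨⟨_, h⟩, Subtype.ext (mul_div_cancel₀ _ (fun h => hb (Subtype.ext h))).symm⟩
  rcases eq_or_ne a 0 with rfl | ha
  · exact Or.inr (dvd_zero _)
  rcases eq_or_ne b 0 with rfl | hb
  · exact Or.inl (dvd_zero _)
  by_cases h : p.Coprime ((a : ℚ) / b).den
  · exact Or.inr (key a b hb h)
  · refine Or.inl (key b a ha ?_)
    have hp : p ∣ ((a : ℚ) / b).den := by
      by_contra h'
      exact h (((Fact.out : p.Prime).coprime_iff_not_dvd).mpr h')
    have hn : p.Coprime ((a : ℚ) / b).num.natAbs :=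
      Nat.Coprime.coprime_dvd_left hp ((a : ℚ) / b).reduced.symm
    have hne : (a : ℚ) / b ≠ 0 := div_ne_zero (fun h => ha (Subtype.ext h))
      (fun h => hb (Subtype.ext h))
    have : (b : ℚ) / a = ((a : ℚ) / b)⁻¹ := (inv_div _ _).symm
    rw [this, mem_ZLoc, Rat.inv_def]
    refine Nat.Coprime.coprime_dvd_right ?_ hn
    have := Rat.den_dvd ((a : ℚ) / b).den ((a : ℚ) / b).num
    rw [← Int.natCast_dvd]
    convert this using 2

/-- A nonzero element of `ℤ_(p)` is a power of `p` times a unit, so `p`-torsion is the only torsion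
that has to be excluded. -/
lemma ZLoc_smul_eq_zero [Fact p.Prime] {M : Type*} [AddCommGroup M] [Module (ZLoc p) M]
    (h : ∀ x : M, p • x = 0 → x = 0) {r : ZLoc p} (hr : r ≠ 0) {x : M} (hx : r • x = 0) : x = 0 := by
  have hpow : ∀ (a : ℕ) (y : M), p ^ a • y = 0 → y = 0 := fun a => by
    induction a with
    | zero => intro y; simp
    | succ a ih => intro y hy; rw [pow_succ, mul_smul] at hy; exact h _ (ih _ hy)
  obtain ⟨a, m, hm, hmr⟩ : ∃ (a m : ℕ), p.Coprime m ∧ (r : ℚ).num.natAbs = p ^ a * m := by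
    have hn : (r : ℚ).num.natAbs ≠ 0 := by
      simpa using fun h => hr (Subtype.ext h)
    obtain ⟨a, m, hm, h⟩ := Nat.exists_eq_pow_mul_and_not_dvd hn p (Fact.out : p.Prime).ne_one
    exact ⟨a, m, ((Fact.out : p.Prime).coprime_iff_not_dvd).mpr hm, h⟩
  have h1 : ((r : ℚ).num : ZLoc p) • x = 0 := by
    have : ((r : ℚ).num : ZLoc p) = ((r : ℚ).den : ZLoc p) * r := by
      apply Subtype.ext
      push_cast
      rw [mul_comm]
      exact (Rat.mul_den_eq_num _).symm
    rw [this, mul_smul, hx, smul_zero]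
  have h2 : (((r : ℚ).num.natAbs : ℕ) : ZLoc p) • x = 0 := by
    rcases Int.natAbs_eq (r : ℚ).num with h | h
    · rw [h] at h1; simpa using h1
    · rw [h] at h1; simpa using h1
  apply hpow a
  let u : ZLoc p := ⟨(m : ℚ)⁻¹, inv_natCast_mem_ZLoc hm⟩
  have hm0 : (m : ℚ) ≠ 0 := by
    rintro h
    have : m = 0 := by exact_mod_cast h
    subst this
    have := (Nat.coprime_zero_right p).mp hm
    exact (Fact.out : p.Prime).ne_one this
  have h3 : ((p ^ a : ℕ) : ZLoc p) = u * (((r : ℚ).num.natAbs : ℕ) : ZLoc p) := by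
    rw [hmr]
    apply Subtype.ext
    push_cast
    simp only [u]
    field_simp
  rw [← Nat.cast_smul_eq_nsmul (ZLoc p), h3, mul_smul, h2, smul_zero]

/-- A valuation ring is Bézout, and over a Bézout domain flat means torsion-free. -/
lemma flat_ZLoc [Fact p.Prime] {M : Type} [AddCommGroup M] [Module (ZLoc p) M]
    (h : ∀ x : M, p • x = 0 → x = 0) : Module.Flat (ZLoc p) M := by
  rw [Module.Flat.flat_iff_torsion_eq_bot_of_isBezout, eq_bot_iff]
  rintro x ⟨⟨r, hr⟩, hx⟩
  exact ZLoc_smul_eq_zero h (nonZeroDivisors.ne_zero hr) hx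

end ZLoc

/-! ### Total degree components, and flatness of `E(1)_*E(1)`. -/

section Components

variable {p n : ℕ}

/-- The component of total degree `j` of a Laurent polynomial. -/
def component (n : ℕ) (j : ℤ) : RatLaurent n →+ RatLaurent n :=
  ((AddMonoidAlgebra.coeffAddEquiv (R := ℚ) (M := Fin n → ℤ)).symm.toAddMonoidHom.comp
    (Finsupp.filterAddHom fun e : Fin n → ℤ => ∑ i, e i = j)).comp
    (AddMonoidAlgebra.coeffAddEquiv (R := ℚ) (M := Fin n → ℤ)).toAddMonoidHom

lemma coeff_component (j : ℤ) (f : RatLaurent n) (e : Fin n → ℤ) :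
    (component n j f).coeff e = if ∑ i, e i = j then f.coeff e else 0 := by
  change Finsupp.filter (fun e : Fin n → ℤ => ∑ i, e i = j) f.coeff e = _
  rw [Finsupp.filter_apply]

lemma component_single (j : ℤ) (e : Fin n → ℤ) (r : ℚ) :
    component n j (AddMonoidAlgebra.single e r) =
      if ∑ i, e i = j then AddMonoidAlgebra.single e r else 0 := by
  ext e'
  rw [coeff_component, AddMonoidAlgebra.coeff_single, Finsupp.single_apply]
  by_cases h : e = e'
  · subst h
    by_cases h' : ∑ i, e i = j <;> simp [h']
  · by_cases h' : ∑ i, e i = j <;> simp [h, h']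

lemma sum_component (f : RatLaurent n) :
    ∑ j ∈ f.coeff.support.image (fun e => ∑ i, e i), component n j f = f := by
  ext e
  rw [AddMonoidAlgebra.coeff_sum, Finset.sum_apply']
  simp only [coeff_component]
  rw [Finset.sum_ite_eq]
  split_ifs with h
  · rfl
  · by_contra h'
    exact h (Finset.mem_image.mpr ⟨e, Finsupp.mem_support_iff.mpr (Ne.symm h'), rfl⟩)

lemma component_single_mul (j : ℤ) (e : Fin n → ℤ) (r : ℚ) (f : RatLaurent n) :
    component n (∑ i, e i + j) (AddMonoidAlgebra.single e r * f) =
      AddMonoidAlgebra.single e r * component n j f := by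
  induction f using AddMonoidAlgebra.induction_linear with
  | zero => simp
  | add f g hf hg => simp only [mul_add, map_add, hf, hg]
  | single e' r' =>
    rw [AddMonoidAlgebra.single_mul_single, component_single, component_single]
    simp only [Pi.add_apply, Finset.sum_add_distrib, add_right_inj]
    split_ifs
    · rw [AddMonoidAlgebra.single_mul_single]
    · simp

lemma component_component (j k : ℤ) (f : RatLaurent n) :
    component n j (component n k f) = if j = k then component n k f else 0 := by
  ext e
  rw [coeff_component, coeff_component]
  by_cases h : j = k
  · subst h
    simp only [coeff_component, if_true]
    split_ifs <;> rfl
  · rw [if_neg h]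
    split_ifs with h1 h2
    · exact absurd (h1.symm.trans h2) h
    · rfl
    · rfl

/-- A substitution sends a monomial of total degree `j` to a multiple of `t^j`, so taking a
component of `f` amounts to taking one coefficient of its image. This is why the components of a
stably integral polynomial are stably integral. -/
lemma subst_component (a : Fin n → (ZLoc p)ˣ) (j : ℤ) (f : RatLaurent n) :
    subst p a (component n j f) = AddMonoidAlgebra.single j ((subst p a f).coeff j) := by
  induction f using AddMonoidAlgebra.induction_linear with
  | zero => simp
  | add f g hf hg =>
    rw [map_add, map_add, hf, hg, map_add, AddMonoidAlgebra.coeff_add, Finsupp.add_apply,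
      AddMonoidAlgebra.single_add]
  | single e r =>
    rw [component_single, subst_single, ← LaurentPolynomial.single_eq_C_mul_T,
      AddMonoidAlgebra.coeff_single, Finsupp.single_apply]
    split_ifs with h
    · rw [subst_single, ← LaurentPolynomial.single_eq_C_mul_T, h]
    · simp

lemma component_mem (j : ℤ) {f : RatLaurent n} (hf : f ∈ stablyIntegral p n) :
    component n j f ∈ stablyIntegral p n := by
  rw [mem_stablyIntegral] at hf ⊢
  intro a
  obtain ⟨g, hg⟩ := hf a
  refine ⟨AddMonoidAlgebra.single j (g.coeff j), ?_⟩
  rw [subst_component, ← hg]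
  simp only [E1toRat, AddMonoidAlgebra.mapRingHom_single]
  congr 1

/-- The component of total degree `j` of a stably integral Laurent polynomial. -/
def integralComponent (p n : ℕ) (j : ℤ) : stablyIntegral p n →+ stablyIntegral p n where
  toFun f := ⟨component n j f, component_mem j f.2⟩
  map_zero' := Subtype.ext (map_zero _)
  map_add' _ _ := Subtype.ext (map_add _ _ _)

lemma coe_integralComponent (j : ℤ) (f : stablyIntegral p n) :
    (integralComponent p n j f : RatLaurent n) = component n j f := rfl

lemma coe_unitMap_T (i : Fin n) (k : ℤ) :
    (unitMap p i (T k) : RatLaurent n) = AddMonoidAlgebra.single (Pi.single i k) 1 := by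
  rw [coe_unitMap]
  have := unitRat_single p i k 1
  rwa [LaurentPolynomial.single_eq_C_mul_T, map_one, one_mul] at this

lemma coe_unitMap_C (i : Fin n) (r : ZLoc p) :
    (unitMap p i (C r) : RatLaurent n) = AddMonoidAlgebra.single 0 (r : ℚ) := by
  rw [coe_unitMap]
  have := unitRat_single p i 0 r
  rwa [LaurentPolynomial.single_eq_C_mul_T, T_zero, mul_one, Pi.single_zero] at this

lemma integralComponent_unitMap_mul (i : Fin n) (j k : ℤ) (f : stablyIntegral p n) :
    integralComponent p n (k + j) (unitMap p i (T k) * f) =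
      unitMap p i (T k) * integralComponent p n j f := by
  apply Subtype.ext
  rw [coe_integralComponent, Subring.coe_mul, Subring.coe_mul, coe_integralComponent, coe_unitMap_T,
    ← component_single_mul]
  simp

lemma coeff_nsmul {R A : Type*} [Semiring R] (m : ℕ) (f : AddMonoidAlgebra R A) (e : A) :
    (m • f).coeff e = m • f.coeff e := by
  rw [AddMonoidAlgebra.coeff_smul, Finsupp.smul_apply]

lemma stablyIntegral_torsionFree [Fact p.Prime] (x : stablyIntegral p n) (hx : p • x = 0) :
    x = 0 := by
  have hp : (p : ℚ) ≠ 0 := by exact_mod_cast (Fact.out : p.Prime).ne_zero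
  apply Subtype.ext
  ext e
  have h1 : p • (x : RatLaurent n) = 0 := congrArg Subtype.val hx
  have h2 := congrArg (fun y : RatLaurent n => y.coeff e) h1
  rw [coeff_nsmul, nsmul_eq_mul] at h2
  simpa [hp] using h2

/-- Multiplication by the powers of `v_i` identifies all total degree components with the one of
degree `0`. The latter is a retract of a `p`-torsion-free `ℤ_(p)`-module, so `flat_laurent` applies
with the projection to degree `0`. -/
lemma flat_stablyIntegral [Fact p.Prime] (i : Fin n) :
    @Module.Flat (LaurentZ p) (stablyIntegral p n) _ _ (unitMap p i).toAlgebra.toModule := by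
  let : Algebra (LaurentZ p) (stablyIntegral p n) := (unitMap p i).toAlgebra
  let : Module (ZLoc p) (stablyIntegral p n) :=
    Module.compHom _ (LaurentPolynomial.C : ZLoc p →+* LaurentZ p)
  have hsmul : ∀ (b : LaurentZ p) (x : stablyIntegral p n), b • x = unitMap p i b * x :=
    fun _ _ => rfl
  have hsmul' : ∀ (r : ZLoc p) (x : stablyIntegral p n), r • x = unitMap p i (C r) * x :=
    fun _ _ => rfl
  have : IsScalarTower (ZLoc p) (LaurentZ p) (stablyIntegral p n) :=
    ⟨fun r b x => by
      rw [hsmul, hsmul, hsmul', LaurentPolynomial.smul_eq_C_mul, map_mul, mul_assoc]⟩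
  let e : stablyIntegral p n →ₗ[ZLoc p] stablyIntegral p n :=
    { integralComponent p n 0 with
      map_smul' := fun r x => by
        change integralComponent p n 0 (unitMap p i (C r) * x) =
          unitMap p i (C r) * integralComponent p n 0 x
        apply Subtype.ext
        rw [coe_integralComponent, Subring.coe_mul, Subring.coe_mul, coe_unitMap_C,
          coe_integralComponent, ← component_single_mul]
        simp }
  have he : ∀ x, e x = integralComponent p n 0 x := fun _ => rfl
  have : Module.Flat (ZLoc p) (stablyIntegral p n) := flat_ZLoc stablyIntegral_torsionFree
  have hcc : ∀ j k (x : stablyIntegral p n), integralComponent p n j (integralComponent p n k x) =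
      if j = k then integralComponent p n k x else 0 := fun j k x => by
    apply Subtype.ext
    rw [coe_integralComponent, coe_integralComponent, component_component]
    split_ifs <;> rfl
  have hee : ∀ x, e (e x) = e x := fun x => by rw [he, he, hcc, if_pos rfl]
  have := flat_range_of_idempotent e hee
  refine flat_laurent (R := ZLoc p) e hee ?_ ?_
  · intro k hk x
    rw [he, he, hsmul]
    have := integralComponent_unitMap_mul (p := p) i (-k) k (integralComponent p n 0 x)
    rw [add_neg_cancel] at this
    rw [this, hcc, if_neg (by omega), mul_zero]
  · intro x
    have hx : ∑ j ∈ (x : RatLaurent n).coeff.support.image (fun e => ∑ i, e i),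
        integralComponent p n j x = x := by
      apply Subtype.ext
      rw [AddSubmonoidClass.coe_finsetSum]
      exact sum_component _
    rw [← hx]
    -- Multiplication by `v_i^{-j}` moves the component of degree `j` to degree `0`, and `T j` moves
    -- it back.
    refine sum_mem fun j _ => AddSubgroup.subset_closure ⟨j, unitMap p i (T (-j)) * x, ?_⟩
    rw [he, hsmul, ← integralComponent_unitMap_mul, ← mul_assoc, ← map_mul, ← T_add]
    simp

instance [Fact p.Prime] : Module.Flat (E1 p) (EE p) := flat_stablyIntegral (p := p) (1 : Fin 2)

instance [Fact p.Prime] : Module.Flat (E1 p) (EEE p) := flat_stablyIntegral (p := p) (2 : Fin 3)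

end Components

/-! ### Flatness of graded modules is the absence of `p`-torsion. -/

section GradedFlat

variable {p : ℕ}

lemma qdeg_pos [Fact p.Prime] : 0 < qdeg p := by
  have := (Fact.out : p.Prime).two_le
  unfold qdeg
  omega

lemma C_monomial_mem_gradingPE (r : ZLoc p) (k : ℤ) :
    (C (E1.monomial r k) : PE p) ∈ gradingPE p (0, qdeg p * k) := by
  have := monomial_mem_gradingPE p r 0 k
  simpa using this

lemma E1.monomial_one_zero : E1.monomial (1 : ZLoc p) 0 = 1 := by
  change (C 1 * T 0 : LaurentZ p) = 1
  rw [T_zero, map_one, one_mul]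

lemma E1.monomial_mul (r s : ZLoc p) (k l : ℤ) :
    E1.monomial r k * E1.monomial s l = E1.monomial (r * s) (k + l) := by
  have : (C r * T k * (C s * T l) : LaurentZ p) = C (r * s) * T (k + l) := by
    rw [T_add, map_mul, mul_mul_mul_comm]
  exact this

lemma E1_induction {motive : E1 p → Prop} (add : ∀ x y, motive x → motive y → motive (x + y))
    (monomial : ∀ (r : ZLoc p) (k : ℤ), motive (E1.monomial r k)) (a : E1 p) : motive a :=
  LaurentPolynomial.induction_on' (R := ZLoc p) (motive := motive) a add fun k r => monomial r k

lemma T_mem_gradingPE (j : ℤ) : (T j : PE p) ∈ gradingPE p (qdeg p * j, qdeg p * j) := by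
  have := monomial_mem_gradingPE p 1 j 0
  rwa [mul_zero, add_zero, E1.monomial_one_zero, map_one, one_mul] at this

variable {M : Type} [AddCommGroup M] [Module (E1 p) M] [Module (PE p) M]
  [IsScalarTower (E1 p) (PE p) M]

/-- A bigrading of an `E(1)_*[τ, τ⁻¹]`-module which is concentrated in internal degrees divisible
by `2p - 2`. -/
structure IsGradedModule (𝓜 : ℤ × ℤ → AddSubgroup M) : Prop where
  isInternal : DirectSum.IsInternal 𝓜
  smul_mem : ∀ i j (b : PE p) x, b ∈ gradingPE p i → x ∈ 𝓜 j → b • x ∈ 𝓜 (i + j)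
  concentrated : ∀ n k, ¬ qdeg p ∣ k → 𝓜 (n, k) = ⊥

lemma QPComplex.isGradedModule (X : QPComplex p) : IsGradedModule (p := p) X.grading :=
  ⟨X.isInternal, X.smul_mem, X.concentrated⟩

/-- Projection to the sum of the homogeneous parts of the degrees in a given set. -/
def partProj {𝓜 : ℤ × ℤ → AddSubgroup M} (h : DirectSum.IsInternal 𝓜) (P : ℤ × ℤ → Prop)
    [DecidablePred P] : M →+ M :=
  grLift h fun i => if P i then AddMonoidHom.id M else 0

lemma partProj_of_mem {𝓜 : ℤ × ℤ → AddSubgroup M} (h : DirectSum.IsInternal 𝓜) (P : ℤ × ℤ → Prop)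
    [DecidablePred P] {i : ℤ × ℤ} {x : M} (hx : x ∈ 𝓜 i) :
    partProj h P x = if P i then x else 0 := by
  rw [partProj, grLift_of_mem h _ hx]
  split_ifs <;> rfl

lemma partProj_partProj {𝓜 : ℤ × ℤ → AddSubgroup M} (h : DirectSum.IsInternal 𝓜)
    (P : ℤ × ℤ → Prop) [DecidablePred P] (x : M) :
    partProj h P (partProj h P x) = partProj h P x := by
  induction x using gr_induction h with
  | zero => simp
  | add x y hx hy => simp only [map_add, hx, hy]
  | mem i x hx =>
    rw [partProj_of_mem h P hx]
    split_ifs with hi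
    · rw [partProj_of_mem h P hx, if_pos hi]
    · simp

variable {𝓜 : ℤ × ℤ → AddSubgroup M}

lemma IsGradedModule.monomial_mem (h : IsGradedModule (p := p) 𝓜) {i : ℤ × ℤ} {x : M}
    (hx : x ∈ 𝓜 i) (r : ZLoc p) (k : ℤ) : E1.monomial r k • x ∈ 𝓜 ((0, qdeg p * k) + i) := by
  rw [← C_smul_eq]
  exact h.smul_mem _ _ _ _ (C_monomial_mem_gradingPE r k) hx

/-- All internal degrees are multiples of the degree of `v₁`, so `M` is the sum of the
`v₁`-translates of its part of internal degree `0`, a direct summand over `ℤ_(p)`. -/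
lemma IsGradedModule.flat_E1 [Fact p.Prime] (h : IsGradedModule (p := p) 𝓜)
    (ht : ∀ x : M, p • x = 0 → x = 0) : Module.Flat (E1 p) M := by
  let : Module (LaurentZ p) M := ‹Module (E1 p) M›
  let : Module (ZLoc p) M := Module.compHom _ (LaurentPolynomial.C : ZLoc p →+* LaurentZ p)
  have hr : ∀ (r : ZLoc p) (x : M), r • x = (E1.monomial r 0) • x := fun r x => by
    have : (C r : LaurentZ p) = C r * T 0 := by rw [T_zero, mul_one]
    exact congrArg (fun b : LaurentZ p => b • x) this
  have hT : ∀ (k : ℤ) (x : M), (T k : LaurentZ p) • x = (E1.monomial (1 : ZLoc p) k) • x := fun k x => by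
    have : (T k : LaurentZ p) = C 1 * T k := by rw [map_one, one_mul]
    exact congrArg (fun b : LaurentZ p => b • x) this
  have : IsScalarTower (ZLoc p) (LaurentZ p) M := ⟨fun r b x => by
    rw [LaurentPolynomial.smul_eq_C_mul, mul_smul]; rfl⟩
  let P : ℤ × ℤ → Prop := fun i => i.2 = 0
  let e : M →ₗ[ZLoc p] M :=
    { partProj h.isInternal P with
      map_smul' := fun r x => by
        change partProj h.isInternal P (r • x) = r • partProj h.isInternal P x
        induction x using gr_induction h.isInternal with
        | zero => simp
        | add x y hx hy => simp only [map_add, smul_add, hx, hy]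
        | mem i x hx =>
          have := h.monomial_mem hx r 0
          simp only [mul_zero, Prod.mk_zero_zero, zero_add] at this
          rw [hr, partProj_of_mem _ _ this, partProj_of_mem _ _ hx]
          split_ifs
          · rw [hr]
          · rw [smul_zero] }
  have he : ∀ x, e x = partProj h.isInternal P x := fun _ => rfl
  have : Module.Flat (ZLoc p) M := flat_ZLoc ht
  have hee : ∀ x, e (e x) = e x := partProj_partProj _ _
  have := flat_range_of_idempotent e hee
  refine flat_laurent (R := ZLoc p) e hee ?_ ?_
  · intro k hk x
    induction x using gr_induction h.isInternal with
    | zero => simp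
    | add x y hx hy => simp only [map_add, smul_add, hx, hy, add_zero]
    | mem i x hx =>
      rw [he, he, partProj_of_mem _ _ hx]
      split_ifs with hi
      · rw [hT, partProj_of_mem _ _ (h.monomial_mem hx 1 k), if_neg]
        change ¬ (qdeg p * k + i.2 = 0)
        rw [show i.2 = 0 from hi, add_zero]
        exact mul_ne_zero qdeg_pos.ne' hk
      · simp
  · intro x
    induction x using gr_induction h.isInternal with
    | zero => exact zero_mem _
    | add x y hx hy => exact add_mem hx hy
    | mem i x hx =>
      by_cases hi : qdeg p ∣ i.2
      · obtain ⟨k, hk⟩ := hi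
        refine AddSubgroup.subset_closure ⟨k, E1.monomial (1 : ZLoc p) (-k) • x, ?_⟩
        rw [he, partProj_of_mem _ _ (h.monomial_mem hx 1 (-k)), if_pos, hT, smul_smul,
          E1.monomial_mul, mul_one, add_neg_cancel, E1.monomial_one_zero, one_smul]
        change qdeg p * -k + i.2 = 0
        rw [hk]; ring
      · have : x = 0 := (AddSubgroup.eq_bot_iff_forall _).mp (h.concentrated i.1 i.2 hi) x hx
        rw [this]
        exact zero_mem _

/-- Since `τ` raises the cohomological degree by `N`, the window of degrees `0 ≤ n < N` is a
fundamental domain for its powers; `P` expresses this window by integer division. The part of `M` in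
the window is an `E(1)_*`-direct summand, hence flat. -/
lemma IsGradedModule.flat_PE [Fact p.Prime] (h : IsGradedModule (p := p) 𝓜)
    (ht : ∀ x : M, p • x = 0 → x = 0) : Module.Flat (PE p) M := by
  let P : ℤ × ℤ → Prop := fun i => i.1 / qdeg p = 0
  let e : M →ₗ[E1 p] M :=
    { partProj h.isInternal P with
      map_smul' := fun a x => by
        change partProj h.isInternal P (a • x) = a • partProj h.isInternal P x
        induction a using E1_induction with
        | add a b ha hb => simp only [add_smul, map_add, ha, hb]
        | monomial r k =>
          induction x using gr_induction h.isInternal with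
          | zero => simp
          | add x y hx hy => simp only [map_add, smul_add, hx, hy]
          | mem i x hx =>
            have : P ((0, qdeg p * k) + i) ↔ P i := by
              change (0 + i.1) / qdeg p = 0 ↔ _
              rw [zero_add]
            rw [partProj_of_mem _ _ (h.monomial_mem hx r k), partProj_of_mem _ _ hx]
            simp only [this]
            split_ifs
            · rfl
            · rw [smul_zero] }
  have he : ∀ x, e x = partProj h.isInternal P x := fun _ => rfl
  have := h.flat_E1 ht
  have hee : ∀ x, e (e x) = e x := partProj_partProj _ _
  have := flat_range_of_idempotent e hee
  have hP : ∀ k i, P ((qdeg p * k, qdeg p * k) + i) ↔ k + i.1 / qdeg p = 0 := fun k i => by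
    change (qdeg p * k + i.1) / qdeg p = 0 ↔ _
    rw [add_comm, Int.add_mul_ediv_left _ _ qdeg_pos.ne', add_comm]
  refine flat_laurent (R := E1 p) e hee ?_ ?_
  · intro k hk x
    induction x using gr_induction h.isInternal with
    | zero => simp
    | add x y hx hy => simp only [map_add, smul_add, hx, hy, add_zero]
    | mem i x hx =>
      rw [he, he, partProj_of_mem _ _ hx]
      split_ifs with hi
      · rw [partProj_of_mem _ _ (h.smul_mem _ _ _ _ (T_mem_gradingPE k) hx), if_neg]
        rw [hP, show i.1 / qdeg p = 0 from hi, add_zero]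
        exact hk
      · simp
  · intro x
    induction x using gr_induction h.isInternal with
    | zero => exact zero_mem _
    | add x y hx hy => exact add_mem hx hy
    | mem i x hx =>
      refine AddSubgroup.subset_closure ⟨i.1 / qdeg p, (T (-(i.1 / qdeg p)) : PE p) • x, ?_⟩
      rw [he, partProj_of_mem _ _ (h.smul_mem _ _ _ _ (T_mem_gradingPE _) hx), if_pos,
        smul_smul, ← T_add, add_neg_cancel, T_zero, one_smul]
      rw [hP, neg_add_cancel]

lemma LaurentZ_torsionFree [Fact p.Prime] (a : LaurentZ p) (ha : p • a = 0) : a = 0 := by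
  ext k
  have h1 := congrArg (fun f : LaurentZ p => ((f.coeff k : ZLoc p) : ℚ)) ha
  have hp : (p : ℚ) ≠ 0 := by exact_mod_cast (Fact.out : p.Prime).ne_zero
  simp only [coeff_nsmul] at h1
  simpa [hp] using h1

/-- The element `p` is regular in `E(1)_*`, and a regular element acts injectively on a flat module.
-/
lemma torsionFree_of_flat_E1 [Fact p.Prime] (M : Type) [AddCommGroup M] [Module (E1 p) M]
    [Module.Flat (E1 p) M] (x : M) (hx : p • x = 0) : x = 0 := by
  have hreg : IsLeftRegular (p : E1 p) := by
    rw [isLeftRegular_iff_right_eq_zero_of_mul]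
    intro a ha
    exact LaurentZ_torsionFree a ((nsmul_eq_mul p a).trans ha)
  refine Module.Flat.isSMulRegular_of_isRegular (M := M) ⟨hreg, hreg.right_of_commute (Commute.all _)⟩
    (show (p : E1 p) • x = (p : E1 p) • 0 from ?_)
  rw [smul_zero, Nat.cast_smul_eq_nsmul, hx]

/-- This form of flatness visibly passes to subobjects and finite sums, and it is the form in which
flatness is checked from here on. -/
lemma isFlat_iff_torsionFree [Fact p.Prime] (X : QPComplex p) :
    isFlat p X ↔ ∀ x : X.carrier, p • x = 0 → x = 0 :=
  ⟨fun h => by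
    have : Module.Flat (E1 p) X.carrier := h
    exact torsionFree_of_flat_E1 _, fun h => X.isGradedModule.flat_E1 h⟩

end GradedFlat

/-! ### Interpolation nodes of minimal valuation. -/

section Nodes

variable {p : ℕ}

/-- The rational number `a ^ (p - 1)`, for a unit `a` of `ℤ_(p)`. -/
def unitPow (p : ℕ) : (ZLoc p)ˣ →* ℚ :=
  ((ZLoc p).subtype : ZLoc p →* ℚ).comp ((Units.coeHom (ZLoc p)).comp (powMonoidHom (p - 1)))

lemma unitPow_ne_zero (a : (ZLoc p)ˣ) : unitPow p a ≠ 0 := fun h => by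
  have : unitPow p (a * a⁻¹) = 0 := by rw [map_mul, h, zero_mul]
  rw [mul_inv_cancel, map_one] at this
  exact one_ne_zero this

lemma unitPow_inv (a : (ZLoc p)ˣ) : unitPow p a⁻¹ = (unitPow p a)⁻¹ :=
  eq_inv_of_mul_eq_one_left (by rw [← map_mul, inv_mul_cancel, map_one])

lemma unitPow_zpow (a : (ZLoc p)ˣ) (k : ℤ) : unitPow p (a ^ k) = unitPow p a ^ k := by
  cases k with
  | ofNat n => rw [Int.ofNat_eq_natCast, zpow_natCast, zpow_natCast, map_pow]
  | negSucc n => rw [zpow_negSucc, zpow_negSucc, unitPow_inv, map_pow]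

lemma unitPow_zpow_mem (a : (ZLoc p)ˣ) (k : ℤ) : unitPow p a ^ k ∈ ZLoc p := by
  rw [← unitPow_zpow]
  exact Subtype.property _

lemma coe_pow_zpow (a : (ZLoc p)ˣ) (k : ℤ) :
    ((((a ^ (p - 1)) ^ k : (ZLoc p)ˣ) : ZLoc p) : ℚ) = unitPow p a ^ k := by
  rw [← unitPow_zpow, ← zpow_natCast, zpow_comm, zpow_natCast]
  rfl

lemma subst_single_unitPow {n : ℕ} (a : Fin n → (ZLoc p)ˣ) (e : Fin n → ℤ) (r : ℚ) :
    subst p a (AddMonoidAlgebra.single e r) =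
      AddMonoidAlgebra.single (∑ i, e i) (r * ∏ i, unitPow p (a i) ^ e i) := by
  rw [subst_single, LaurentPolynomial.single_eq_C_mul_T]
  simp only [coe_pow_zpow]

lemma mem_ZLoc_of_padicValRat [Fact p.Prime] {x : ℚ} (hx : 0 ≤ padicValRat p x) : x ∈ ZLoc p := by
  rw [mem_ZLoc, (Fact.out : p.Prime).coprime_iff_not_dvd]
  intro h
  have hnum : ¬ (p : ℤ) ∣ x.num := fun h' => by
    have h1 := Nat.dvd_gcd (Int.natCast_dvd.mp h') h
    rw [x.reduced.gcd_eq_one] at h1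
    exact (Fact.out : p.Prime).one_lt.ne' (Nat.dvd_one.mp h1)
  have h2 : 1 ≤ padicValNat p x.den := one_le_padicValNat_of_dvd x.den_nz h
  rw [padicValRat_def, padicValInt.eq_zero_of_not_dvd hnum] at hx
  omega

lemma padicValRat_nonneg [Fact p.Prime] {x : ℚ} (hx : x ∈ ZLoc p) : 0 ≤ padicValRat p x := by
  rw [mem_ZLoc, (Fact.out : p.Prime).coprime_iff_not_dvd] at hx
  rw [padicValRat_def, padicValNat.eq_zero_of_not_dvd hx]
  omega

/-- The positive integers `1 + p i` are prime to `p`, and raising to the power `p - 1` is injective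
on natural numbers. -/
lemma exists_unitPow_injective [Fact p.Prime] :
    ∃ a : ℕ → (ZLoc p)ˣ, Function.Injective fun i => unitPow p (a i) := by
  have hc : ∀ i : ℕ, p.Coprime (1 + p * i) := fun i => by simp
  refine ⟨fun i => ⟨⟨((1 + p * i : ℕ) : ℚ), natCast_mem _ _⟩,
    ⟨((1 + p * i : ℕ) : ℚ)⁻¹, inv_natCast_mem_ZLoc (hc i)⟩,
    Subtype.ext (mul_inv_cancel₀ (by positivity)), Subtype.ext (inv_mul_cancel₀ (by positivity))⟩, ?_⟩
  intro i j hij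
  have hp := (Fact.out : p.Prime)
  have h1 : ((1 + p * i : ℕ) : ℚ) ^ (p - 1) = ((1 + p * j : ℕ) : ℚ) ^ (p - 1) := hij
  have h2 : (1 + p * i) = 1 + p * j := by
    have h3 : (1 + p * i) ^ (p - 1) = (1 + p * j) ^ (p - 1) := by exact_mod_cast h1
    exact Nat.pow_left_injective (by have := hp.two_le; omega) h3
  exact Nat.eq_of_mul_eq_mul_left hp.pos (by omega)

/-- The monomials of degree `-K, …, K` at the node `a`. -/
def nodeRow (p K : ℕ) (a : (ZLoc p)ˣ) (e : Fin (2 * K + 1)) : ℚ := unitPow p a ^ ((e : ℤ) - K)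

/-- Dividing each row by its lowest power `x^{-K}` leaves a Vandermonde matrix with distinct nodes.
-/
lemma exists_det_nodeRow_ne_zero [Fact p.Prime] (K : ℕ) :
    ∃ x : Fin (2 * K + 1) → (ZLoc p)ˣ, (Matrix.of fun i => nodeRow p K (x i)).det ≠ 0 := by
  obtain ⟨a, ha⟩ := exists_unitPow_injective (p := p)
  refine ⟨fun i => a i, ?_⟩
  have : (Matrix.of fun i : Fin (2 * K + 1) => nodeRow p K (a i)) =
      Matrix.diagonal (fun i : Fin (2 * K + 1) => unitPow p (a i) ^ (-(K : ℤ))) *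
        Matrix.vandermonde fun i : Fin (2 * K + 1) => unitPow p (a i) := by
    ext i j
    rw [Matrix.diagonal_mul, Matrix.vandermonde_apply, Matrix.of_apply, nodeRow, sub_eq_neg_add,
      zpow_add₀ (unitPow_ne_zero _), zpow_natCast]
  rw [this, Matrix.det_mul, Matrix.det_diagonal]
  refine mul_ne_zero (Finset.prod_ne_zero_iff.mpr fun i _ => zpow_ne_zero _ (unitPow_ne_zero _))
    (Matrix.det_vandermonde_ne_zero_iff.mpr fun i j hij => Fin.ext (ha hij))

/-- There are nodes at which interpolation by Laurent polynomials with exponents in `[-K, K]`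
preserves integrality: the determinant of the interpolation problem has minimal valuation. -/
lemma exists_nodes [Fact p.Prime] (K : ℕ) :
    ∃ (x : Fin (2 * K + 1) → (ZLoc p)ˣ) (M : Matrix (Fin (2 * K + 1)) (Fin (2 * K + 1)) ℚ),
      (Matrix.of fun i => nodeRow p K (x i)) * M = 1 ∧
      M * (Matrix.of fun i => nodeRow p K (x i)) = 1 ∧
      ∀ b j, ∑ e, nodeRow p K b e * M e j ∈ ZLoc p := by
  let W : (Fin (2 * K + 1) → (ZLoc p)ˣ) → Matrix (Fin (2 * K + 1)) (Fin (2 * K + 1)) ℚ :=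
    fun x => Matrix.of fun i => nodeRow p K (x i)
  -- The determinants are integral, so truncating their valuations to natural numbers loses nothing
  -- and the minimum chosen below is a true one.
  have hW : ∀ x, (W x).det ∈ ZLoc p := fun x => by
    rw [Matrix.det_apply]
    refine sum_mem fun σ _ => ?_
    rw [Units.smul_def]
    exact zsmul_mem (prod_mem fun i _ => unitPow_zpow_mem _ _) _
  let S := {x // (W x).det ≠ 0}
  have : Nonempty S := let ⟨x, hx⟩ := exists_det_nodeRow_ne_zero K; ⟨⟨x, hx⟩⟩
  let v : S → ℕ := fun x => (padicValRat p (W x.1).det).toNat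
  obtain ⟨x, hx⟩ : ∃ x : S, ∀ y : S, v x ≤ v y :=
    ⟨Function.argmin v, fun y => Function.argmin_le v y⟩
  have hunit : IsUnit (W x.1).det := isUnit_iff_ne_zero.mpr x.2
  refine ⟨x.1, (W x.1)⁻¹, Matrix.mul_nonsing_inv _ hunit, Matrix.nonsing_inv_mul _ hunit,
    fun b j => ?_⟩
  -- Cramer's rule: the value at `b` of the `j`-th interpolation polynomial is the determinant with
  -- the node `j` replaced by `b`, divided by the original one. Minimality of the valuation makes
  -- this quotient integral.
  have key : ∑ e, nodeRow p K b e * (W x.1)⁻¹ e j =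
      (W (Function.update x.1 j b)).det / (W x.1).det := by
    have h1 : W (Function.update x.1 j b) = (W x.1).updateRow j (nodeRow p K b) := by
      ext i e
      rw [Matrix.updateRow_apply]
      by_cases h : i = j
      · subst h; simp [W]
      · simp [W, h]
    rw [h1, Matrix.inv_def, ← Matrix.cramer_transpose_apply, Matrix.cramer_eq_adjugate_mulVec,
      ← Matrix.adjugate_transpose, Matrix.mulVec, dotProduct, Finset.sum_div]
    refine Finset.sum_congr rfl fun e _ => ?_
    rw [Matrix.smul_apply, Ring.inverse_eq_inv', Matrix.transpose_apply, smul_eq_mul]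
    ring
  rw [key]
  by_cases h0 : (W (Function.update x.1 j b)).det = 0
  · rw [h0, zero_div]
    exact zero_mem _
  · refine mem_ZLoc_of_padicValRat ?_
    rw [padicValRat.div h0 x.2]
    have h1 := hx ⟨_, h0⟩
    have h2 := padicValRat_nonneg (hW x.1)
    have h3 := padicValRat_nonneg (hW (Function.update x.1 j b))
    simp only [v] at h1
    omega

end Nodes

/-! ### Specialising the variables of `E(1)_*E(1)` at units. -/

section Evaluation

variable {p n : ℕ}

/-- The substitution `v_i ↦ a^{p-1} v_i`. -/
def scaleRat (p : ℕ) {n : ℕ} (i : Fin n) (a : (ZLoc p)ˣ) : RatLaurent n →+* RatLaurent n :=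
  AddMonoidAlgebra.liftNCRingHom (AddMonoidAlgebra.singleZeroRingHom : ℚ →+* RatLaurent n)
    { toFun := fun e => AddMonoidAlgebra.single (Multiplicative.toAdd e)
        (unitPow p a ^ (Multiplicative.toAdd e i))
      map_one' := by simp [AddMonoidAlgebra.one_def]
      map_mul' := fun e e' => by
        rw [AddMonoidAlgebra.single_mul_single, toAdd_mul, Pi.add_apply,
          zpow_add₀ (unitPow_ne_zero a)] }
    (fun _ _ => Commute.all _ _)

lemma scaleRat_single (i : Fin n) (a : (ZLoc p)ˣ) (e : Fin n → ℤ) (r : ℚ) :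
    scaleRat p i a (AddMonoidAlgebra.single e r) =
      AddMonoidAlgebra.single e (r * unitPow p a ^ e i) := by
  rw [scaleRat, AddMonoidAlgebra.liftNCRingHom_single]
  change AddMonoidAlgebra.single 0 r * AddMonoidAlgebra.single e _ = _
  rw [AddMonoidAlgebra.single_mul_single, zero_add]
  rfl

/-- Scaling a variable only multiplies the corresponding test unit by `a`, so stable integrality is
preserved. -/
lemma subst_scaleRat (i : Fin n) (a : (ZLoc p)ˣ) (b : Fin n → (ZLoc p)ˣ) (f : RatLaurent n) :
    subst p b (scaleRat p i a f) = subst p (Function.update b i (b i * a)) f := by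
  induction f using AddMonoidAlgebra.induction_linear with
  | zero => simp
  | add f g hf hg => simp only [map_add, hf, hg]
  | single e r =>
    rw [scaleRat_single, subst_single_unitPow, subst_single_unitPow]
    congr 1
    rw [← Finset.mul_prod_erase _ _ (Finset.mem_univ i),
      ← Finset.mul_prod_erase Finset.univ (fun j => unitPow p (Function.update b i (b i * a) j) ^ e j)
        (Finset.mem_univ i), Function.update_self, map_mul, mul_zpow]
    have : ∏ j ∈ Finset.univ.erase i, unitPow p (Function.update b i (b i * a) j) ^ e j =
        ∏ j ∈ Finset.univ.erase i, unitPow p (b j) ^ e j :=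
      Finset.prod_congr rfl fun j hj => by rw [Function.update_of_ne (Finset.ne_of_mem_erase hj)]
    rw [this]
    ring

/-- The substitution `v_i ↦ a^{p-1} v_i` on stably integral Laurent polynomials. -/
def scaleVar (p : ℕ) {n : ℕ} (i : Fin n) (a : (ZLoc p)ˣ) :
    stablyIntegral p n →+* stablyIntegral p n :=
  (scaleRat p i a).restrict _ _ fun f hf => mem_stablyIntegral.mpr fun b => by
    rw [subst_scaleRat]
    exact mem_stablyIntegral.mp hf _

lemma coe_scaleVar (i : Fin n) (a : (ZLoc p)ˣ) (f : stablyIntegral p n) :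
    (scaleVar p i a f : RatLaurent n) = scaleRat p i a f := rfl

lemma scaleVar_unitMap {i j : Fin n} (hij : i ≠ j) (a : (ZLoc p)ˣ) (x : LaurentZ p) :
    scaleVar p i a (unitMap p j x) = unitMap p j x := by
  apply Subtype.ext
  rw [coe_scaleVar, coe_unitMap]
  induction x using AddMonoidAlgebra.induction_linear with
  | zero => simp
  | add f g hf hg => simp only [map_add, hf, hg]
  | single k r => rw [unitRat_single, scaleRat_single, Pi.single_eq_of_ne hij, zpow_zero, mul_one]

lemma ratLaurent_hom_ext {m : ℕ} {f g : RatLaurent n →+* RatLaurent m}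
    (h : ∀ e r, f (AddMonoidAlgebra.single e r) = g (AddMonoidAlgebra.single e r))
    (x : RatLaurent n) : f x = g x := by
  induction x using AddMonoidAlgebra.induction_linear with
  | zero => simp
  | add x y hx hy => simp only [map_add, hx, hy]
  | single e r => exact h e r

/-- `f(u, v) ↦ f(a^{p-1} u, v)`. -/
def scaleEE (a : (ZLoc p)ˣ) : EE p →ₐ[E1 p] EE p :=
  { (scaleVar p (0 : Fin 2) a : stablyIntegral p 2 →+* stablyIntegral p 2) with
    commutes' := fun x => scaleVar_unitMap (by decide) a x }

/-- `f(u, v) ↦ f(a^{p-1} v, v)`. -/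
def evalUnit (a : (ZLoc p)ˣ) : EE p →ₐ[E1 p] E1 p := (hopf p).counit.comp (scaleEE a)

/-- `f(u, v, w) ↦ f(a^{p-1} u, u, v)`. -/
def evalLeft (a : (ZLoc p)ˣ) : EEE p →ₐ[E1 p] EE p :=
  { ((changeVars p ![0, 0, 1]).comp (scaleVar p (0 : Fin 3) a) :
      stablyIntegral p 3 →+* stablyIntegral p 2) with
    commutes' := fun x => by
      have h1 := scaleVar_unitMap (show (0 : Fin 3) ≠ 2 by decide) a x
      have h2 := changeVars_unitMap p ![(0 : Fin 2), 0, 1] 2 x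
      exact (congrArg (changeVars p ![(0 : Fin 2), 0, 1]) h1).trans h2 }

lemma coe_unitMap_counitMap (i : Fin 2) (f : stablyIntegral p 2) :
    (unitMap p i (counitMap p 2 f) : RatLaurent 2) = changeVarsRat ![i, i] f := by
  rw [coe_unitMap, unitRat, RingHom.comp_apply, E1toRat_counitMap]
  refine ratLaurent_hom_ext (f := (AddMonoidAlgebra.mapDomainRingHom ℚ
    (AddMonoidHom.single (fun _ : Fin 2 => ℤ) i)).comp (subst p 1)) (fun e r => ?_) (f : RatLaurent 2)
  rw [RingHom.comp_apply, subst_single_unitPow, changeVarsRat_single]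
  simp only [Pi.one_apply, map_one, one_zpow, Finset.prod_const_one, mul_one]
  rw [AddMonoidAlgebra.mapDomainRingHom_apply, AddMonoidAlgebra.mapDomain_single]
  congr 1
  ext j
  fin_cases i <;> fin_cases j <;> simp [Finset.sum_filter, Fin.sum_univ_two]

/-- Together with the next two lemmas this computes `evalLeft` on the three maps in the
coassociativity axiom: it turns `comul` into a scaling of `u`, `inr` into the identity, and `inl`
into a scalar coming from the left unit. As a result, evaluating one tensor factor of a coaction
yields elements whose coaction is known. -/
lemma evalLeft_comul (a : (ZLoc p)ˣ) (g : EE p) : evalLeft a ((hopf p).comul g) = scaleEE a g := by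
  apply Subtype.ext
  refine ratLaurent_hom_ext (f := (changeVarsRat ![(0 : Fin 2), 0, 1]).comp
    ((scaleRat p (0 : Fin 3) a).comp (changeVarsRat ![0, 2]))) (g := scaleRat p (0 : Fin 2) a)
    (fun e r => ?_) g.1
  simp only [RingHom.comp_apply, changeVarsRat_single, scaleRat_single]
  congr 1
  · ext j
    fin_cases j <;> simp [Finset.sum_filter, Fin.sum_univ_two, Fin.sum_univ_three]
  · simp [Finset.sum_filter, Fin.sum_univ_two]

lemma evalLeft_inr (a : (ZLoc p)ˣ) (g : EE p) : evalLeft a ((hopf p).inr g) = g := by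
  apply Subtype.ext
  refine ratLaurent_hom_ext (f := (changeVarsRat ![(0 : Fin 2), 0, 1]).comp
    ((scaleRat p (0 : Fin 3) a).comp (changeVarsRat ![1, 2]))) (g := RingHom.id _)
    (fun e r => ?_) g.1
  simp only [RingHom.comp_apply, changeVarsRat_single, scaleRat_single, RingHom.id_apply]
  congr 1
  · ext j
    fin_cases j <;> simp [Finset.sum_filter, Fin.sum_univ_two, Fin.sum_univ_three]
  · simp [Finset.sum_filter, Fin.sum_univ_two]

lemma evalLeft_inl (a : (ZLoc p)ˣ) (g : EE p) :
    evalLeft a ((hopf p).inl g) = (hopf p).unitL (evalUnit a g) := by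
  apply Subtype.ext
  refine Eq.trans ?_ (coe_unitMap_counitMap (p := p) 0 (scaleVar p (0 : Fin 2) a g)).symm
  refine ratLaurent_hom_ext (f := (changeVarsRat ![(0 : Fin 2), 0, 1]).comp
    ((scaleRat p (0 : Fin 3) a).comp (changeVarsRat ![0, 1]))) (g := (changeVarsRat ![0, 0]).comp
      (scaleRat p (0 : Fin 2) a)) (fun e r => ?_) g.1
  simp only [RingHom.comp_apply, changeVarsRat_single, scaleRat_single]
  congr 1
  · ext j
    fin_cases j <;> simp [Finset.sum_filter, Fin.sum_univ_two, Fin.sum_univ_three]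
  · simp [Finset.sum_filter, Fin.sum_univ_two]

lemma coe_algebraMap_evalUnit (a : (ZLoc p)ˣ) (g : EE p) :
    (algebraMap (E1 p) (EE p) (evalUnit a g)).val =
      changeVarsRat ![1, 1] (scaleRat p (0 : Fin 2) a g.val) :=
  coe_unitMap_counitMap (p := p) 1 (scaleVar p (0 : Fin 2) a g)

lemma E1toRat_evalUnit (a : (ZLoc p)ˣ) (g : EE p) :
    E1toRat p (evalUnit a g) = subst p (Function.update 1 0 a) g.val := by
  refine (E1toRat_counitMap p 2 (scaleVar p (0 : Fin 2) a g)).trans ?_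
  refine (subst_scaleRat 0 a 1 g.val).trans ?_
  rw [Pi.one_apply, one_mul]

lemma coeff_subst_eq_zero (b : Fin n → (ZLoc p)ˣ) (f : RatLaurent n) (k : ℤ)
    (h : ∀ e : Fin n → ℤ, f.coeff e ≠ 0 → ∑ i, e i ≠ k) : (subst p b f).coeff k = 0 := by
  have hf : f = f.coeff.sum AddMonoidAlgebra.single := (AddMonoidAlgebra.sum_coeff_single f).symm
  rw [hf, Finsupp.sum, map_sum, AddMonoidAlgebra.coeff_sum, Finset.sum_apply']
  refine Finset.sum_eq_zero fun e he => ?_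
  rw [subst_single_unitPow, AddMonoidAlgebra.coeff_single, Finsupp.single_eq_of_ne]
  exact (h e (Finsupp.mem_support_iff.mp he)).symm

lemma C_mem_gradingPE (y : E1 p) (i : ℤ × ℤ)
    (h : ∀ k, E1.coeffs p y k ≠ 0 → (0, qdeg p * k) = i) : (C y : PE p) ∈ gradingPE p i := by
  have hy : y = ∑ k ∈ (E1.coeffs p y).support, E1.monomial (E1.coeffs p y k) k := by
    have : (show LaurentZ p from y) = ∑ k ∈ (E1.coeffs p y).support,
        (C (E1.coeffs p y k) * T k : LaurentZ p) := by
      simp only [← LaurentPolynomial.single_eq_C_mul_T]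
      exact (AddMonoidAlgebra.sum_coeff_single (show LaurentZ p from y)).symm
    exact this
  rw [hy, map_sum]
  refine sum_mem fun k hk => ?_
  rw [← h k (Finsupp.mem_support_iff.mp hk)]
  exact C_monomial_mem_gradingPE _ _

/-- The variable `u` is replaced by a unit multiple of `v`, which has the same degree. -/
lemma evalUnit_mem (a : (ZLoc p)ˣ) {i : ℤ × ℤ} {g : EE p} (hg : g ∈ gradingEE p i) :
    (C (evalUnit a g) : PE p) ∈ gradingPE p i := by
  refine C_mem_gradingPE _ _ fun k hk => ?_
  by_contra h
  apply hk
  have h1 : (E1toRat p (evalUnit a g)).coeff k = 0 := by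
    rw [E1toRat_evalUnit]
    refine coeff_subst_eq_zero _ _ _ fun e he hek => h ?_
    rw [← hg e he, ← hek, Fin.sum_univ_two]
  have h2 : (E1toRat p (evalUnit a g)).coeff k = ((E1.coeffs p (evalUnit a g) k : ZLoc p) : ℚ) := by
    change ((AddMonoidAlgebra.mapRingHom ℤ (ZLoc p).subtype) (show LaurentZ p from evalUnit a g)).coeff k = _
    rw [AddMonoidAlgebra.coeff_mapRingHom]
    rfl
  rw [h2] at h1
  exact Subtype.ext h1

end Evaluation

/-- A square matrix of elements of `E(1)_*E(1)` of degree `0` which satisfies the relations of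
matrix coefficients; equivalently, a graded coaction on a free module with a basis in degree `0`. -/
structure MatrixCoefficients (p n : ℕ) where
  coeff : Fin n → Fin n → EE p
  mem : ∀ i j, coeff i j ∈ gradingEE p 0
  counit : ∀ i j, (hopf p).counit (coeff i j) = if i = j then 1 else 0
  comul : ∀ i j, (hopf p).comul (coeff i j) =
    ∑ k, (hopf p).inl (coeff i k) * (hopf p).inr (coeff k j)

/-! ### Stably integral interpolation and matrix coefficients. -/

section Interpolation

variable {p : ℕ}

lemma single_finsetSum {ι A : Type*} (s : Finset ι) (a : A) (r : ι → ℚ) :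
    AddMonoidAlgebra.single a (∑ i ∈ s, r i) = ∑ i ∈ s, AddMonoidAlgebra.single a (r i) :=
  map_sum (AddMonoidAlgebra.singleAddHom a) r s

/-- The Laurent polynomial `∑ c_e (u / v)^{e - K}`. -/
def ratioPoly {K : ℕ} (c : Fin (2 * K + 1) → ℚ) : RatLaurent 2 :=
  ∑ e : Fin (2 * K + 1), AddMonoidAlgebra.single ![(e : ℤ) - K, K - (e : ℤ)] (c e)

/-- A polynomial in `u/v` is homogeneous of degree `0`, and its substitutions depend only on the
quotient of the two units. Stable integrality thus reduces to integrality of the values at single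
units, which is what `exists_nodes` supplies. -/
lemma subst_ratioPoly {K : ℕ} (c : Fin (2 * K + 1) → ℚ) (a : Fin 2 → (ZLoc p)ˣ) :
    subst p a (ratioPoly c) =
      AddMonoidAlgebra.single 0 (∑ e, nodeRow p K (a 0 * (a 1)⁻¹) e * c e) := by
  rw [ratioPoly, map_sum, single_finsetSum]
  refine Finset.sum_congr rfl fun e _ => ?_
  rw [subst_single_unitPow, nodeRow, map_mul, unitPow_inv]
  congr 1
  · simp [Fin.sum_univ_two]
  · rw [Fin.prod_univ_two, mul_zpow, inv_zpow', mul_comm]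
    simp

lemma ratioPoly_mem {K : ℕ} (c : Fin (2 * K + 1) → ℚ)
    (h : ∀ b : (ZLoc p)ˣ, ∑ e, nodeRow p K b e * c e ∈ ZLoc p) :
    ratioPoly c ∈ stablyIntegral p 2 := by
  rw [mem_stablyIntegral]
  intro a
  refine ⟨AddMonoidAlgebra.single 0 ⟨_, h (a 0 * (a 1)⁻¹)⟩, ?_⟩
  rw [subst_ratioPoly]
  simp only [E1toRat, AddMonoidAlgebra.mapRingHom_single]
  rfl

lemma scaleRat_ratioPoly {K : ℕ} (c : Fin (2 * K + 1) → ℚ) (a : (ZLoc p)ˣ) :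
    scaleRat p 0 a (ratioPoly c) = ratioPoly fun e => nodeRow p K a e * c e := by
  rw [ratioPoly, ratioPoly, map_sum]
  refine Finset.sum_congr rfl fun e _ => ?_
  rw [scaleRat_single, mul_comm (c e)]
  rfl

lemma ratioPoly_degree {K : ℕ} (c : Fin (2 * K + 1) → ℚ) {e : Fin 2 → ℤ}
    (he : (ratioPoly c).coeff e ≠ 0) : e 0 + e 1 = 0 := by
  rw [ratioPoly, AddMonoidAlgebra.coeff_sum, Finset.sum_apply'] at he
  obtain ⟨e', -, he'⟩ := Finset.exists_ne_zero_of_sum_ne_zero he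
  rw [AddMonoidAlgebra.coeff_single, Finsupp.single_apply] at he'
  split_ifs at he' with h
  · subst h
    simp
  · exact absurd rfl he'

/-- The exponents of `u` in `g(u, v)` are bounded by `K`. -/
def ExponentsBounded (K : ℕ) (g : EE p) : Prop :=
  ∀ e : Fin 2 → ℤ, (Subtype.val g : RatLaurent 2).coeff e ≠ 0 → (e 0).natAbs ≤ K

lemma exists_exponentsBounded (g : EE p) : ∃ K, ExponentsBounded K g :=
  ⟨(Subtype.val g : RatLaurent 2).coeff.support.sup fun e => (e 0).natAbs, fun _ he =>
    Finset.le_sup (f := fun e : Fin 2 → ℤ => (e 0).natAbs) (Finsupp.mem_support_iff.mpr he)⟩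

/-- The interpolation formula, for a bound `K` on the exponents: the matrix coefficients, the nodes,
and the values at `1` of the interpolation polynomials. -/
lemma exists_interpolation [Fact p.Prime] (K : ℕ) :
    ∃ (n : ℕ) (c : MatrixCoefficients p n) (x : Fin n → (ZLoc p)ˣ) (l : Fin n → EE p),
      (∀ j, l j ∈ gradingEE p 0) ∧
      (∀ g, ExponentsBounded K g → g = ∑ j, l j * algebraMap (E1 p) (EE p) (evalUnit (x j) g)) ∧
      ∀ i j, c.coeff i j = scaleEE (x i) (l j) := by
  obtain ⟨x, M, h1, h2, h3⟩ := exists_nodes (p := p) K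
  -- The `j`-th Lagrange polynomial in `u/v`: its coefficients form the `j`-th column of `M`.
  let l : Fin (2 * K + 1) → EE p := fun j => ⟨ratioPoly fun e => M e j, ratioPoly_mem _ fun b => h3 b j⟩
  have hc : ∀ i j, (scaleEE (x i) (l j)).val =
      ratioPoly fun e => nodeRow p K (x i) e * M e j := fun i j => scaleRat_ratioPoly _ _
  -- The two inverse relations have different uses. This one says that `l j` is `1` at the node `j`
  -- and `0` at the others, which gives the counit relation; the next one gives the comultiplication
  -- and the reproduction of monomials.
  have h1' : ∀ i j, ∑ e, nodeRow p K (x i) e * M e j = if i = j then 1 else 0 := fun i j => by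
    have := congrFun (congrFun h1 i) j
    rwa [Matrix.mul_apply, Matrix.one_apply] at this
  have h2' : ∀ e e', ∑ k, M e k * nodeRow p K (x k) e' = if e = e' then 1 else 0 := fun i j => by
    have := congrFun (congrFun h2 i) j
    rwa [Matrix.mul_apply, Matrix.one_apply] at this
  refine ⟨2 * K + 1, ⟨fun i j => scaleEE (x i) (l j), ?_, ?_, ?_⟩, x, l, ?_, ?_, fun _ _ => rfl⟩
  · intro i j e he
    rw [hc] at he
    rw [ratioPoly_degree _ he, mul_zero]
    rfl
  · intro i j
    apply E1toRat_injective
    refine (E1toRat_counitMap p 2 (scaleEE (x i) (l j))).trans ?_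
    rw [hc, subst_ratioPoly]
    have : ∑ e, nodeRow p K ((1 : Fin 2 → (ZLoc p)ˣ) 0 * ((1 : Fin 2 → (ZLoc p)ˣ) 1)⁻¹) e *
        (nodeRow p K (x i) e * M e j) = if i = j then 1 else 0 := by
      rw [← h1' i j]
      refine Finset.sum_congr rfl fun e _ => ?_
      simp [nodeRow]
    rw [this]
    split_ifs
    · exact (map_one (E1toRat p)).symm
    · exact (AddMonoidAlgebra.single_zero _).trans (map_zero (E1toRat p)).symm
  · intro i j
    apply Subtype.ext
    -- Expanding in powers of `u/v` and `v/w`, the coefficient of the mixed term `(u/v)^{e-K}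
    -- (v/w)^{e'-K}` in the sum over `k` contains the factor `∑ k, M e k * nodeRow p K (x k) e'`. By
    -- `h2'` only `e = e'` survives, and the `v`'s cancel.
    have hL : ((hopf p).comul (scaleEE (x i) (l j))).val =
        ∑ e : Fin (2 * K + 1), AddMonoidAlgebra.single ![(e : ℤ) - K, 0, K - (e : ℤ)]
          (nodeRow p K (x i) e * M e j) := by
      refine (congrArg (changeVarsRat ![(0 : Fin 3), 2]) (hc i j)).trans ?_
      rw [ratioPoly, map_sum]
      refine Finset.sum_congr rfl fun e _ => ?_
      rw [changeVarsRat_single]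
      congr 1
      ext j
      fin_cases j <;> simp [Finset.sum_filter, Fin.sum_univ_two]
    have hl : ∀ k, ((hopf p).inl (scaleEE (x i) (l k))).val =
        ∑ e : Fin (2 * K + 1), AddMonoidAlgebra.single ![(e : ℤ) - K, K - (e : ℤ), 0]
          (nodeRow p K (x i) e * M e k) := fun k => by
      refine (congrArg (changeVarsRat ![(0 : Fin 3), 1]) (hc i k)).trans ?_
      rw [ratioPoly, map_sum]
      refine Finset.sum_congr rfl fun e _ => ?_
      rw [changeVarsRat_single]
      congr 1
      ext j
      fin_cases j <;> simp [Finset.sum_filter, Fin.sum_univ_two]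
    have hr : ∀ k, ((hopf p).inr (scaleEE (x k) (l j))).val =
        ∑ e : Fin (2 * K + 1), AddMonoidAlgebra.single ![0, (e : ℤ) - K, K - (e : ℤ)]
          (nodeRow p K (x k) e * M e j) := fun k => by
      refine (congrArg (changeVarsRat ![(1 : Fin 3), 2]) (hc k j)).trans ?_
      rw [ratioPoly, map_sum]
      refine Finset.sum_congr rfl fun e _ => ?_
      rw [changeVarsRat_single]
      congr 1
      ext j
      fin_cases j <;> simp [Finset.sum_filter, Fin.sum_univ_two]
    have hsum : (∑ k, (hopf p).inl (scaleEE (x i) (l k)) * (hopf p).inr (scaleEE (x k) (l j))).val =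
        ∑ k, ((hopf p).inl (scaleEE (x i) (l k))).val * ((hopf p).inr (scaleEE (x k) (l j))).val :=
      map_sum (stablyIntegral p 3).subtype _ _
    rw [hL, hsum]
    simp only [hl, hr, Finset.sum_mul_sum, AddMonoidAlgebra.single_mul_single]
    rw [Finset.sum_comm]
    refine Finset.sum_congr rfl fun e _ => ?_
    rw [Finset.sum_comm, Finset.sum_eq_single e]
    · rw [← single_finsetSum]
      congr 1
      · simp
      · have := h2' e e
        rw [if_pos rfl] at this
        calc nodeRow p K (x i) e * M e j
            = nodeRow p K (x i) e * (∑ k, M e k * nodeRow p K (x k) e) * M e j := by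
              rw [this, mul_one]
          _ = _ := by
              rw [Finset.mul_sum, Finset.sum_mul]
              exact Finset.sum_congr rfl fun k _ => by ring
    · intro e' _ he'
      rw [← single_finsetSum]
      have := h2' e e'
      rw [if_neg he'.symm] at this
      have h0 : ∑ k, nodeRow p K (x i) e * M e k * (nodeRow p K (x k) e' * M e' j) = 0 := by
        calc _ = nodeRow p K (x i) e * (∑ k, M e k * nodeRow p K (x k) e') * M e' j := by
              rw [Finset.mul_sum, Finset.sum_mul]
              exact Finset.sum_congr rfl fun k _ => by ring
          _ = 0 := by rw [this, mul_zero, zero_mul]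
      rw [h0, AddMonoidAlgebra.single_zero]
    · simp
  · intro j e he
    rw [ratioPoly_degree _ he, mul_zero]
    rfl
  · intro g hg
    apply Subtype.ext
    have hsum : (∑ j, l j * algebraMap (E1 p) (EE p) (evalUnit (x j) g)).val =
        ∑ j, ratioPoly (fun e => M e j) * changeVarsRat ![1, 1] (scaleRat p (0 : Fin 2) (x j) g.val) := by
      refine (map_sum (stablyIntegral p 2).subtype _ _).trans (Finset.sum_congr rfl fun j _ => ?_)
      rw [← coe_algebraMap_evalUnit]
      rfl
    rw [hsum]
    -- By linearity it suffices to reproduce monomials: `u^s v^t` with `|s| ≤ K` equals `(u/v)^s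
    -- v^{s+t}`, and `(u/v)^s` is interpolated exactly.
    have hterm : ∀ (e : Fin 2 → ℤ) (r : ℚ), (e 0).natAbs ≤ K → AddMonoidAlgebra.single e r =
        ∑ j, ratioPoly (fun e => M e j) *
          changeVarsRat ![1, 1] (scaleRat p (0 : Fin 2) (x j) (AddMonoidAlgebra.single e r)) := by
      intro e r he
      -- The columns are numbered from `0` to `2K` while the exponents run from `-K` to `K`.
      obtain ⟨e0, he0⟩ : ∃ e0 : Fin (2 * K + 1), e 0 = (e0 : ℤ) - K :=
        ⟨⟨(e 0 + K).toNat, by omega⟩, by simp only; omega⟩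
      have : ∀ j, ratioPoly (fun e => M e j) *
          changeVarsRat ![1, 1] (scaleRat p (0 : Fin 2) (x j) (AddMonoidAlgebra.single e r)) =
          ∑ e' : Fin (2 * K + 1), AddMonoidAlgebra.single
            ![(e' : ℤ) - K, K - (e' : ℤ) + (e 0 + e 1)] (M e' j * nodeRow p K (x j) e0 * r) := by
        intro j
        rw [scaleRat_single, changeVarsRat_single, ratioPoly, Finset.sum_mul]
        refine Finset.sum_congr rfl fun e' _ => ?_
        rw [AddMonoidAlgebra.single_mul_single]
        congr 1
        · ext k
          fin_cases k <;> simp [Finset.sum_filter, Fin.sum_univ_two]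
        · rw [he0, nodeRow]
          ring
      simp only [this]
      rw [Finset.sum_comm, Finset.sum_eq_single e0]
      · rw [← single_finsetSum, ← Finset.sum_mul, h2', if_pos rfl, one_mul]
        congr 1
        ext k
        fin_cases k
        · simp [he0]
        · simp only [Fin.mk_one, Matrix.cons_val_one, Matrix.cons_val_fin_one, he0]
          ring
      · intro e' _ he'
        rw [← single_finsetSum, ← Finset.sum_mul, h2', if_neg he', zero_mul,
          AddMonoidAlgebra.single_zero]
      · simp
    have hg' : (Subtype.val g : RatLaurent 2) = _ := (AddMonoidAlgebra.sum_coeff_single g.val).symm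
    rw [Finsupp.sum] at hg'
    calc (Subtype.val g : RatLaurent 2)
        = ∑ e ∈ (Subtype.val g : RatLaurent 2).coeff.support, ∑ j, ratioPoly (fun e => M e j) *
          changeVarsRat ![1, 1] (scaleRat p (0 : Fin 2) (x j)
            (AddMonoidAlgebra.single e ((Subtype.val g : RatLaurent 2).coeff e))) := by
          conv_lhs => rw [hg']
          exact Finset.sum_congr rfl fun e he => hterm e _ (hg e (Finsupp.mem_support_iff.mp he))
      _ = _ := by
          rw [Finset.sum_comm]
          refine Finset.sum_congr rfl fun j _ => ?_
          rw [← Finset.mul_sum, ← map_sum, ← map_sum, ← hg']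

end Interpolation

/-! ### Finite matrix coefficients for a given element of a comodule. -/

section Extraction

variable {p : ℕ} {M : Type} [AddCommGroup M] [Module (E1 p) M]

/-- The map `g ⊗ m ↦ g(a^{p-1} v, v) m`. -/
def evalTensor (a : (ZLoc p)ˣ) : EE p ⊗[E1 p] M →ₗ[E1 p] M :=
  (TensorProduct.lid (E1 p) M).toLinearMap ∘ₗ (evalUnit a).toLinearMap.rTensor M

lemma evalTensor_tmul (a : (ZLoc p)ˣ) (g : EE p) (m : M) :
    evalTensor a (g ⊗ₜ[E1 p] m) = evalUnit a g • m := rfl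

/-- Evaluation in the first factor commutes with applying the coaction in the second one. Combined
with coassociativity, this shows that the coaction of `evalTensor a (ψ x)` is `ψ x` with `u` scaled
in its left factor. -/
lemma coaction_evalTensor (ψ : Coaction (hopf p) M) (a : (ZLoc p)ˣ) (t : EE p ⊗[E1 p] M) :
    ψ.toHom (evalTensor a t) =
      (evalLeft a).toLinearMap.rTensor M ((hopf p).oneTensor ψ.toHom ψ.semilinear t) := by
  induction t using TensorProduct.induction_on with
  | zero => simp
  | add x y hx hy => simp only [map_add, hx, hy]
  | tmul g m =>
    have h : (evalLeft a).toLinearMap ∘ₗ (hopf p).inr.toLinearMap = LinearMap.id :=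
      LinearMap.ext fun g => evalLeft_inr a g
    rw [evalTensor_tmul, ψ.semilinear, HopfAlgebroid.oneTensor_tmul, rTensor_smul', evalLeft_inl,
      ← LinearMap.rTensor_comp_apply, h, LinearMap.rTensor_id, LinearMap.id_apply]

lemma exists_bound (t : EE p ⊗[E1 p] M) :
    ∃ (K : ℕ) (S : Finset (EE p × M)), t = ∑ s ∈ S, s.1 ⊗ₜ s.2 ∧
      ∀ s ∈ S, ExponentsBounded K s.1 := by
  obtain ⟨S, hS⟩ := TensorProduct.exists_finset t
  choose k hk using fun g : EE p => exists_exponentsBounded g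
  exact ⟨S.sup fun s => k s.1, S, hS, fun s hs e he => (hk _ e he).trans
    (Finset.le_sup (f := fun s : EE p × M => k s.1) hs)⟩

/-- The interpolation formula is applied to the left factor of each tensor; the values at the nodes
are scalars from the right unit and move across the tensor sign. -/
lemma rTensor_eq_sum_evalTensor {n K : ℕ} {a : Fin n → (ZLoc p)ˣ} {l : Fin n → EE p}
    (hl : ∀ g, ExponentsBounded K g →
      g = ∑ j, l j * algebraMap (E1 p) (EE p) (evalUnit (a j) g))
    {S : Finset (EE p × M)} (hK : ∀ s ∈ S, ExponentsBounded K s.1) {t : EE p ⊗[E1 p] M}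
    (hS : t = ∑ s ∈ S, s.1 ⊗ₜ s.2) (f : EE p →ₐ[E1 p] EE p) :
    f.toLinearMap.rTensor M t = ∑ j, f (l j) ⊗ₜ evalTensor (a j) t := by
  have hm : ∀ j, evalTensor (a j) t = ∑ s ∈ S, evalUnit (a j) s.1 • s.2 := fun j => by
    rw [hS, map_sum]
    rfl
  conv_lhs => rw [hS]
  simp only [hm, map_sum, TensorProduct.tmul_sum]
  rw [Finset.sum_comm]
  refine Finset.sum_congr rfl fun s hs => ?_
  rw [LinearMap.rTensor_tmul]
  conv_lhs => rw [hl s.1 (hK s hs)]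
  rw [map_sum, TensorProduct.sum_tmul]
  refine Finset.sum_congr rfl fun j _ => ?_
  rw [AlgHom.toLinearMap_apply, map_mul, AlgHom.commutes, mul_comm, ← Algebra.smul_def,
    TensorProduct.smul_tmul]

/-- Interpolation writes `t` as the sum of the `l j ⊗ evalTensor (a j) t` with `l j` of degree `0`.
Homogeneity of a tensor is therefore detected by its evaluations, which is how the coaction on a
kernel is seen to be graded. -/
lemma mem_tensorGrading_of_evalTensor_mem [Fact p.Prime] {𝓜 : ℤ × ℤ → AddSubgroup M} {i : ℤ × ℤ}
    {t : EE p ⊗[E1 p] M} (h : ∀ a, evalTensor a t ∈ 𝓜 i) :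
    t ∈ tensorGrading (E1 p) (gradingEE p) 𝓜 i := by
  obtain ⟨K, S, hS, hK⟩ := exists_bound t
  obtain ⟨n, c, a, l, hl0, hl, hc⟩ := exists_interpolation (p := p) K
  have key := rTensor_eq_sum_evalTensor hl hK hS (AlgHom.id _ _)
  have h0 : (AlgHom.id (E1 p) (EE p)).toLinearMap = LinearMap.id := rfl
  rw [h0, LinearMap.rTensor_id, LinearMap.id_apply] at key
  rw [key]
  exact sum_mem fun j _ => tmul_mem_tensorGrading (zero_add i) (hl0 j) (h (a j))

/-- Every element of a comodule lies in the span of finitely many elements, obtained from it by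
evaluation of the coaction, on which the coaction is given by matrix coefficients. -/
lemma exists_matrixCoefficients [Fact p.Prime] (ψ : Coaction (hopf p) M) (x : M) :
    ∃ (n : ℕ) (c : MatrixCoefficients p n) (a : Fin n → (ZLoc p)ˣ),
      (∀ i, ψ.toHom (evalTensor (a i) (ψ.toHom x)) =
        ∑ j, c.coeff i j ⊗ₜ evalTensor (a j) (ψ.toHom x)) ∧
      x ∈ Submodule.span (E1 p) (Set.range fun i => evalTensor (a i) (ψ.toHom x)) := by
  obtain ⟨K, S, hS, hK⟩ := exists_bound (ψ.toHom x)
  obtain ⟨n, c, a, l, -, hl, hc⟩ := exists_interpolation (p := p) K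
  have key := rTensor_eq_sum_evalTensor hl hK hS
  refine ⟨n, c, a, fun i => ?_, ?_⟩
  -- By coassociativity the coaction of the `i`-th evaluation is obtained from `ψ x` by scaling `u`,
  -- and interpolation expands it with the coefficients `scaleEE (a i) (l j)`.
  · have h : (evalLeft (a i)).toLinearMap ∘ₗ (hopf p).comul.toLinearMap =
        (scaleEE (a i)).toLinearMap := LinearMap.ext fun g => evalLeft_comul (a i) g
    rw [coaction_evalTensor, ← ψ.coassoc, ← LinearMap.rTensor_comp_apply, h, key]
    simp only [hc]
  -- The counit axiom expresses `x` as the combination of its evaluations with coefficients the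
  -- counits of the `l j`.
  · have h := key (AlgHom.id _ _)
    have h' := ψ.counit x
    have h0 : (AlgHom.id (E1 p) (EE p)).toLinearMap = LinearMap.id := rfl
    rw [h0, LinearMap.rTensor_id, LinearMap.id_apply] at h
    rw [h, map_sum, map_sum] at h'
    simp only [LinearMap.rTensor_tmul, TensorProduct.lid_tmul] at h'
    refine (congrArg (· ∈ Submodule.span (E1 p) (Set.range fun i => evalTensor (a i) (ψ.toHom x)))
      h').mp ?_
    exact sum_mem fun j _ => Submodule.smul_mem _ _ (Submodule.subset_span ⟨j, rfl⟩)

lemma QPComplex.evalTensor_mem (X : QPComplex p) (a : (ZLoc p)ˣ) {i : ℤ × ℤ}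
    {t : EE p ⊗[E1 p] X.carrier} (ht : t ∈ tensorGrading (E1 p) (gradingEE p) X.grading i) :
    evalTensor a t ∈ X.grading i := by
  refine tensorGrading_le_comap (evalTensor a).toAddMonoidHom _ ?_ ht
  rintro j k g m rfl hg hm
  rw [LinearMap.toAddMonoidHom_coe, evalTensor_tmul, ← C_smul_eq]
  exact X.smul_mem _ _ _ _ (evalUnit_mem a hg) hm

end Extraction

/-- A family of matrices of matrix coefficients, with bidegrees. -/
structure CoeffFamily (p : ℕ) where
  index : Type
  size : index → ℕ
  mat : ∀ s, MatrixCoefficients p (size s)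
  deg : index → ℤ × ℤ
  dvd : ∀ s, qdeg p ∣ (deg s).2

/-! ### Free comodules defined by matrix coefficients. -/

namespace CoeffFamily

variable {p : ℕ} (S : CoeffFamily p)

/-- The basis elements of the free comodule with the given matrix coefficients. -/
abbrev Basis : Type := Σ s : S.index, Fin (S.size s)

/-- The free `E(1)_*[τ, τ⁻¹]`-module on the basis elements. -/
abbrev Free : Type := S.Basis →₀ PE p

variable {S} in
lemma Free.induction {motive : S.Free → Prop} (zero : motive 0)
    (add : ∀ x y, motive x → motive y → motive (x + y))
    (single : ∀ (s : S.index) (a : Fin (S.size s)) (r : E1 p) (k : ℤ),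
      motive (Finsupp.single ⟨s, a⟩ (C r * T k))) (x : S.Free) : motive x := by
  induction x using Finsupp.induction_linear with
  | zero => exact zero
  | add x y hx hy => exact add x y hx hy
  | single b f =>
    induction f using LaurentPolynomial.induction_on' with
    | add f g hf hg =>
      rw [Finsupp.single_add]
      exact add _ _ hf hg
    | C_mul_T k r => exact single b.1 b.2 r k

/-- The coaction on the free comodule, as an additive map. -/
def freeHom : S.Free →+ EE p ⊗[E1 p] S.Free :=
  Finsupp.liftAddHom (M := PE p) fun b =>
    { toFun := fun f => ∑ a, (S.mat b.1).coeff b.2 a •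
        (Finsupp.lsingle (⟨b.1, a⟩ : S.Basis) : PE p →ₗ[E1 p] S.Free).lTensor (EE p)
          (unitHom (hopf p) f)
      map_zero' := by simp
      map_add' := fun f g => by simp only [map_add, smul_add, Finset.sum_add_distrib] }

lemma freeHom_single (s : S.index) (a : Fin (S.size s)) (r : E1 p) (k : ℤ) :
    S.freeHom (Finsupp.single ⟨s, a⟩ (C r * T k)) =
      ∑ b, ((hopf p).unitL r * (S.mat s).coeff a b) ⊗ₜ
        Finsupp.single (⟨s, b⟩ : S.Basis) (T k : PE p) := by
  rw [freeHom, Finsupp.liftAddHom_apply_single]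
  change ∑ b, (S.mat s).coeff a b •
    (Finsupp.lsingle (⟨s, b⟩ : S.Basis) : PE p →ₗ[E1 p] S.Free).lTensor (EE p)
      (unitHom (hopf p) (C r * T k)) = _
  refine Finset.sum_congr rfl fun b _ => ?_
  rw [unitHom_monomial, LinearMap.lTensor_tmul, TensorProduct.smul_tmul', smul_eq_mul, mul_comm]
  rfl

lemma freeHom_smul (r : E1 p) (x : S.Free) :
    S.freeHom (r • x) = (hopf p).unitL r • S.freeHom x := by
  induction x using Free.induction with
  | zero => simp
  | add x y hx hy => simp only [smul_add, map_add, hx, hy]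
  | single s a r' k =>
    rw [Finsupp.smul_single, LaurentPolynomial.smul_eq_C_mul, ← mul_assoc, ← map_mul,
      freeHom_single, freeHom_single, Finset.smul_sum]
    refine Finset.sum_congr rfl fun b _ => ?_
    rw [map_mul, TensorProduct.smul_tmul', smul_eq_mul, mul_assoc]

/-- The coaction on the free comodule. -/
def freeCoaction : Coaction (hopf p) S.Free where
  toHom := S.freeHom
  semilinear := S.freeHom_smul
  counit x := by
    induction x using Free.induction with
    | zero => simp
    | add x y hx hy => simp only [map_add, hx, hy]
    | single s a r k =>
      rw [freeHom_single, map_sum, map_sum, Finset.sum_eq_single a]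
      · rw [LinearMap.rTensor_tmul, TensorProduct.lid_tmul, AlgHom.toLinearMap_apply, map_mul,
          (hopf p).counit_unitL, (S.mat s).counit, if_pos rfl, mul_one, Finsupp.smul_single,
          LaurentPolynomial.smul_eq_C_mul]
      · intro b _ hb
        rw [LinearMap.rTensor_tmul, TensorProduct.lid_tmul, AlgHom.toLinearMap_apply, map_mul,
          (S.mat s).counit, if_neg hb.symm, mul_zero, zero_smul]
      · simp
  coassoc x := by
    induction x using Free.induction with
    | zero => simp
    | add x y hx hy => simp only [map_add, hx, hy]
    | single s a r k =>
      have h1 : ∀ b, S.freeHom (Finsupp.single (⟨s, b⟩ : S.Basis) (T k : PE p)) =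
          ∑ c, (S.mat s).coeff b c ⊗ₜ Finsupp.single (⟨s, c⟩ : S.Basis) (T k : PE p) := fun b => by
        have := S.freeHom_single s b 1 k
        simpa only [map_one, one_mul] using this
      rw [freeHom_single, map_sum, map_sum]
      simp only [LinearMap.rTensor_tmul, HopfAlgebroid.oneTensor_tmul, h1, map_sum, Finset.smul_sum,
        TensorProduct.smul_tmul', AlgHom.toLinearMap_apply, smul_eq_mul]
      rw [Finset.sum_comm]
      refine Finset.sum_congr rfl fun c _ => ?_
      rw [map_mul, (S.mat s).comul, (hopf p).comul_unitL, ← TensorProduct.sum_tmul, Finset.mul_sum]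
      simp only [map_mul, mul_assoc]

lemma freeCoaction_single (s : S.index) (a : Fin (S.size s)) (r : E1 p) (k : ℤ) :
    S.freeCoaction.toHom (Finsupp.single ⟨s, a⟩ (C r * T k)) =
      ∑ b, ((hopf p).unitL r * (S.mat s).coeff a b) ⊗ₜ
        Finsupp.single (⟨s, b⟩ : S.Basis) (T k : PE p) := S.freeHom_single s a r k

lemma freeCoaction_single_one (s : S.index) (a : Fin (S.size s)) :
    S.freeCoaction.toHom (Finsupp.single ⟨s, a⟩ 1) =
      ∑ b, (S.mat s).coeff a b ⊗ₜ Finsupp.single (⟨s, b⟩ : S.Basis) (1 : PE p) := by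
  have := S.freeCoaction_single s a 1 0
  simpa only [map_one, one_mul, T_zero] using this

lemma freeCoaction_periodic : S.freeCoaction.Periodic := fun k x => by
  induction x using Free.induction with
  | zero => simp
  | add x y hx hy => simp only [smul_add, map_add, hx, hy]
  | single s a r l =>
    rw [Finsupp.smul_single, smul_eq_mul, mul_left_comm, ← T_add, freeCoaction_single,
      freeCoaction_single, map_sum]
    refine Finset.sum_congr rfl fun b _ => ?_
    rw [LinearMap.lTensor_tmul, scalarMap_apply, Finsupp.smul_single, smul_eq_mul, T_add]

/-- Semilinearity along the left unit and periodicity propagate the compatibility from the basis to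
all monomial multiples, so only the matrix coefficients have to match. -/
lemma coactionCompat_linearCombination {M : Type} [AddCommGroup M] [Module (E1 p) M]
    [Module (PE p) M] [IsScalarTower (E1 p) (PE p) M] (ψ : Coaction (hopf p) M) (hψ : ψ.Periodic)
    (m : S.Basis → M) (hm : ∀ s a, ψ.toHom (m ⟨s, a⟩) =
      ∑ b, (S.mat s).coeff a b ⊗ₜ m ⟨s, b⟩) :
    QPComplex.CoactionCompat S.freeCoaction ψ (Finsupp.linearCombination (PE p) m) := fun x => by
  induction x using Free.induction with
  | zero => simp
  | add x y hx hy => simp only [map_add, hx, hy]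
  | single s a r k =>
    rw [freeCoaction_single, Finsupp.linearCombination_single, map_sum, hψ.map_monomial, hm, map_sum,
      Finset.smul_sum]
    refine Finset.sum_congr rfl fun b _ => ?_
    rw [LinearMap.lTensor_tmul, LinearMap.lTensor_tmul, LinearMap.restrictScalars_apply,
      Finsupp.linearCombination_single, TensorProduct.smul_tmul', scalarMap_apply, smul_eq_mul]

/-- The grading of the free comodule. -/
def freeGrading (i : ℤ × ℤ) : AddSubgroup S.Free :=
  ⨅ b : S.Basis, (gradingPE p (i - S.deg b.1)).comap (Finsupp.applyAddHom b)

lemma mem_freeGrading {i : ℤ × ℤ} {x : S.Free} :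
    x ∈ S.freeGrading i ↔ ∀ b, x b ∈ gradingPE p (i - S.deg b.1) := by
  rw [freeGrading, AddSubgroup.mem_iInf]
  rfl

lemma single_mem_freeGrading {s : S.index} (a : Fin (S.size s)) {i : ℤ × ℤ} {f : PE p}
    (hf : f ∈ gradingPE p i) : Finsupp.single (⟨s, a⟩ : S.Basis) f ∈ S.freeGrading (i + S.deg s) := by
  classical
  rw [mem_freeGrading]
  intro b
  rw [Finsupp.single_apply]
  split_ifs with h
  · subst h
    rwa [add_sub_cancel_right]
  · exact zero_mem _

/-- A homogeneous element is a sum of homogeneous multiples of basis elements. -/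
lemma freeGrading_le {i : ℤ × ℤ} {Q : Type} [AddCommGroup Q] (f : S.Free →+ Q) (𝓠 : AddSubgroup Q)
    (h : ∀ s a j g, j + S.deg s = i → g ∈ gradingPE p j → f (Finsupp.single ⟨s, a⟩ g) ∈ 𝓠)
    {x : S.Free} (hx : x ∈ S.freeGrading i) : f x ∈ 𝓠 := by
  rw [← Finsupp.sum_single x, Finsupp.sum, map_sum]
  exact sum_mem fun b _ => h b.1 b.2 _ _ (sub_add_cancel _ _) (S.mem_freeGrading.mp hx b)

lemma freeGrading_isInternal : DirectSum.IsInternal S.freeGrading := by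
  let δ : S.Free →+ (ℤ × ℤ →₀ S.Free) := Finsupp.liftAddHom fun b =>
    grLift (M := PE p) (P := ℤ × ℤ →₀ S.Free) (gradingPE_isInternal p) fun i =>
      (Finsupp.singleAddHom (i + S.deg b.1)).comp (Finsupp.singleAddHom b)
  refine isInternal_of_delta δ (fun i x hx => ?_) ?_
  · refine S.freeGrading_le (AddMonoidHom.id _)
      (δ.eqLocus (Finsupp.singleAddHom i : S.Free →+ (ℤ × ℤ →₀ S.Free))) ?_ hx
    rintro s a j g rfl hg
    change δ _ = _
    simp only [δ, AddMonoidHom.id_apply]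
    rw [Finsupp.liftAddHom_apply_single, grLift_of_mem _ _ hg]
    rfl
  · rw [eq_top_iff]
    rintro x -
    induction x using Finsupp.induction_linear with
    | zero => exact zero_mem _
    | add x y hx hy => exact add_mem hx hy
    | single b f =>
      induction f using gr_induction (gradingPE_isInternal p) with
      | zero => rw [Finsupp.single_zero]; exact zero_mem _
      | add x y hx hy => rw [Finsupp.single_add]; exact add_mem hx hy
      | mem i f hf => exact AddSubgroup.mem_iSup_of_mem _ (S.single_mem_freeGrading b.2 hf)

lemma freeGrading_smul_mem (i j : ℤ × ℤ) (f : PE p) (x : S.Free) (hf : f ∈ gradingPE p i)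
    (hx : x ∈ S.freeGrading j) : f • x ∈ S.freeGrading (i + j) := by
  rw [mem_freeGrading] at hx ⊢
  intro b
  rw [Finsupp.smul_apply, add_sub_assoc]
  exact QPComplex.gradingPE_mul _ _ _ _ hf (hx b)

lemma freeGrading_concentrated (n k : ℤ) (hk : ¬ qdeg p ∣ k) : S.freeGrading (n, k) = ⊥ := by
  rw [eq_bot_iff]
  intro x hx
  refine Finsupp.ext fun b => ?_
  have h := (QPComplex.unit p).concentrated (n - (S.deg b.1).1) (k - (S.deg b.1).2) fun h =>
    hk ((dvd_sub_left (S.dvd b.1)).mp h)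
  exact (AddSubgroup.eq_bot_iff_forall _).mp h _ (S.mem_freeGrading.mp hx b)

lemma freeCoaction_mem (i : ℤ × ℤ) (x : S.Free) (hx : x ∈ S.freeGrading i) :
    S.freeCoaction.toHom x ∈ tensorGrading (E1 p) (gradingEE p) S.freeGrading i := by
  refine S.freeGrading_le S.freeCoaction.toHom _ ?_ hx
  rintro s a j g rfl hg
  refine gradingPE_le (S.freeCoaction.toHom.comp (Finsupp.singleAddHom (⟨s, a⟩ : S.Basis))) _ ?_ hg
  rintro r k l rfl
  rw [AddMonoidHom.comp_apply, Finsupp.singleAddHom_apply, freeCoaction_single]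
  refine sum_mem fun b _ => ?_
  refine tmul_mem_tensorGrading ?_ (gradingEE_mul p _ _ _ _ (gradingEE_unitL p l r)
    ((S.mat s).mem a b)) (S.single_mem_freeGrading b (T_mem_gradingPE k))
  ext
  · simp
  · simp only [add_zero, Prod.snd_add]
    ring

lemma free_torsionFree [Fact p.Prime] (x : S.Free) (hx : p • x = 0) : x = 0 := by
  refine Finsupp.ext fun b => ?_
  have h1 : p • x b = 0 := by rw [← Finsupp.smul_apply, hx, Finsupp.zero_apply]
  refine AddMonoidAlgebra.ext (Finsupp.ext fun k => ?_)
  have h2 : p • (x b).coeff k = 0 := by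
    rw [← coeff_nsmul, h1]
    rfl
  exact LaurentZ_torsionFree _ h2

end CoeffFamily

/-! ### Naturality of the coaction constructions in the module. -/

section Naturality

variable {p : ℕ} {M N : Type} [AddCommGroup M] [AddCommGroup N] [Module (E1 p) M] [Module (E1 p) N]

lemma rTensor_lTensor {S S' : Type} [CommRing S] [CommRing S'] [Algebra (E1 p) S] [Algebra (E1 p) S']
    (f : S →ₐ[E1 p] S') (g : M →ₗ[E1 p] N) (t : S ⊗[E1 p] M) :
    f.toLinearMap.rTensor N (g.lTensor S t) = g.lTensor S' (f.toLinearMap.rTensor M t) := by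
  rw [← LinearMap.comp_apply, ← LinearMap.comp_apply, LinearMap.rTensor_comp_lTensor,
    LinearMap.lTensor_comp_rTensor]

lemma oneTensor_lTensor {ψ : M →+ EE p ⊗[E1 p] M}
    (hψ : ∀ a m, ψ (a • m) = (hopf p).unitL a • ψ m) {φ : N →+ EE p ⊗[E1 p] N}
    (hφ : ∀ a m, φ (a • m) = (hopf p).unitL a • φ m) (f : M →ₗ[E1 p] N)
    (h : ∀ m, φ (f m) = f.lTensor (EE p) (ψ m)) (t : EE p ⊗[E1 p] M) :
    (hopf p).oneTensor φ hφ (f.lTensor (EE p) t) =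
      f.lTensor (EEE p) ((hopf p).oneTensor ψ hψ t) := by
  induction t using TensorProduct.induction_on with
  | zero => simp
  | add x y hx hy => simp only [map_add, hx, hy]
  | tmul g m =>
    rw [LinearMap.lTensor_tmul, HopfAlgebroid.oneTensor_tmul, HopfAlgebroid.oneTensor_tmul, h,
      lTensor_smul', rTensor_lTensor]

lemma evalTensor_lTensor (a : (ZLoc p)ˣ) (f : M →ₗ[E1 p] N) (t : EE p ⊗[E1 p] M) :
    evalTensor a (f.lTensor (EE p) t) = f (evalTensor a t) := by
  induction t using TensorProduct.induction_on with
  | zero => simp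
  | add x y hx hy => simp only [map_add, hx, hy]
  | tmul g m => rw [LinearMap.lTensor_tmul, evalTensor_tmul, evalTensor_tmul, map_smul]

end Naturality

/-! ### Gradings on subgroups and products. -/

section Internal

variable {ι : Type} [DecidableEq ι] {M N : Type} [AddCommGroup M] [AddCommGroup N]

/-- Independence of the homogeneous parts is inherited along an injective degree-preserving map;
only spanning must be supplied. -/
lemma isInternal_of_injective {𝓜 : ι → AddSubgroup M} {𝓝 : ι → AddSubgroup N}
    (hN : DirectSum.IsInternal 𝓝) (f : M →+ N) (hf : Function.Injective f)
    (hmem : ∀ i, ∀ x ∈ 𝓜 i, f x ∈ 𝓝 i) (htop : ⨆ i, 𝓜 i = ⊤) : DirectSum.IsInternal 𝓜 := by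
  let δ : N →+ (ι →₀ N) := grLift hN fun i => Finsupp.singleAddHom i
  constructor
  · rw [injective_iff_map_eq_zero]
    intro x hx
    have key : ∀ (y : DirectSum ι fun i => 𝓜 i) (i : ι),
        δ (f (DirectSum.coeAddMonoidHom 𝓜 y)) i = f (y i) := by
      intro y i
      induction y using DirectSum.induction_on with
      | zero => simp
      | of j y =>
        simp only [δ]
        rw [DirectSum.coeAddMonoidHom_of, grLift_of_mem _ _ (hmem j _ y.2),
          DirectSum.coe_of_apply, Finsupp.singleAddHom_apply, Finsupp.single_apply]
        split_ifs <;> simp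
      | add y z hy hz => simp [hy, hz]
    ext i
    apply hf
    rw [← key x i, hx]
    simp
  · rw [← AddMonoidHom.range_eq_top, eq_top_iff, ← htop]
    refine iSup_le fun i x hx => ⟨DirectSum.of (fun i => 𝓜 i) i ⟨x, hx⟩, by simp⟩

lemma isInternal_prod {𝓜 : ι → AddSubgroup M} {𝓝 : ι → AddSubgroup N}
    (hM : DirectSum.IsInternal 𝓜) (hN : DirectSum.IsInternal 𝓝) :
    DirectSum.IsInternal fun i => (𝓜 i).prod (𝓝 i) := by
  let δ : M × N →+ (ι →₀ M × N) := AddMonoidHom.coprod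
    (grLift (P := ι →₀ M × N) hM fun i =>
      (Finsupp.singleAddHom i : M × N →+ _).comp (AddMonoidHom.inl M N))
    (grLift (P := ι →₀ M × N) hN fun i =>
      (Finsupp.singleAddHom i : M × N →+ _).comp (AddMonoidHom.inr M N))
  refine isInternal_of_delta δ (fun i x hx => ?_) ?_
  · simp only [δ]
    rw [AddMonoidHom.coprod_apply, grLift_of_mem _ _ hx.1, grLift_of_mem _ _ hx.2]
    simp only [AddMonoidHom.comp_apply, Finsupp.singleAddHom_apply, AddMonoidHom.inl_apply,
      AddMonoidHom.inr_apply]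
    rw [← Finsupp.single_add]
    simp
  · rw [eq_top_iff]
    rintro ⟨x, y⟩ -
    have h1 : ((x, 0) : M × N) ∈ ⨆ i, (𝓜 i).prod (𝓝 i) := by
      induction x using gr_induction hM with
      | zero => exact zero_mem _
      | add x y hx hy =>
        have := add_mem hx hy
        rwa [Prod.mk_add_mk, add_zero] at this
      | mem i x hx => exact AddSubgroup.mem_iSup_of_mem i ⟨hx, zero_mem _⟩
    have h2 : ((0, y) : M × N) ∈ ⨆ i, (𝓜 i).prod (𝓝 i) := by
      induction y using gr_induction hN with
      | zero => exact zero_mem _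
      | add x y hx hy =>
        have := add_mem hx hy
        rwa [Prod.mk_add_mk, add_zero] at this
      | mem i x hx => exact AddSubgroup.mem_iSup_of_mem i ⟨zero_mem _, hx⟩
    have := add_mem h1 h2
    rwa [Prod.mk_add_mk, add_zero, zero_add] at this

end Internal

/-! ### Shifts, direct sums and twisted differentials. -/

namespace QPComplex

variable {p : ℕ}

/-- A homogeneous subgroup of a quasi-periodic complex inherits the grading. -/
lemma isInternal_of_proj_mem (X : QPComplex p) {K : Type} [AddCommGroup K] (j : K →+ X.carrier)
    (hj : Function.Injective j) (h : ∀ i x, ∃ y, j y = X.proj i (j x)) :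
    DirectSum.IsInternal fun i => (X.grading i).comap j := by
  classical
  refine isInternal_of_injective X.isInternal j hj (fun i x hx => hx) ?_
  -- Each element is a finite sum of its projections, indexed by the support of its decomposition.
  -- Since `K` contains the projections of its elements, its homogeneous parts span.
  have hsum : ∀ x : X.carrier, ∃ s : Finset (ℤ × ℤ), x = ∑ i ∈ s, X.proj i x := by
    intro x
    obtain ⟨y, rfl⟩ := X.isInternal.2 x
    refine ⟨DFinsupp.support y, ?_⟩
    have hp : ∀ i, X.proj i (DirectSum.coeAddMonoidHom X.grading y) = y i := by
      intro i
      induction y using DirectSum.induction_on with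
      | zero => simp
      | of k y =>
        rw [DirectSum.coeAddMonoidHom_of, X.proj_of_mem y.2, DirectSum.coe_of_apply]
        split_ifs <;> simp
      | add y z hy hz => simp [hy, hz]
    simp only [hp]
    exact DirectSum.coeAddMonoidHom_eq_dfinsuppSum X.grading y
  rw [eq_top_iff]
  rintro x -
  choose π hπ using fun i => h i x
  obtain ⟨s, hs⟩ := hsum (j x)
  have hx : x = ∑ i ∈ s, π i := hj (by
    rw [map_sum]
    exact hs.trans (Finset.sum_congr rfl fun i _ => (hπ i).symm))
  rw [hx]
  exact sum_mem fun i _ => AddSubgroup.mem_iSup_of_mem i (by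
    rw [AddSubgroup.mem_comap, hπ]
    exact X.proj_mem i _)

/-- The shift: `X[1]^n = X^{n+1}` with differential `-d`. -/
def shift (X : QPComplex p) : QPComplex p where
  carrier := X.carrier
  grading i := X.grading (i + (1, 0))
  isInternal := by
    have h := isInternal_of_delta (M := X.carrier) (𝓜 := fun i => X.grading (i + (1, 0)))
      ((Finsupp.mapDomain.addMonoidHom (fun i : ℤ × ℤ => i - (1, 0))).comp
        (grLift (P := ℤ × ℤ →₀ X.carrier) X.isInternal fun i => Finsupp.singleAddHom i)) ?_ ?_
    · exact h
    · intro i x hx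
      rw [AddMonoidHom.comp_apply, grLift_of_mem _ _ hx]
      simp
    · rw [eq_top_iff, ← isInternal_iSup_eq_top X.isInternal]
      refine iSup_le fun i => ?_
      have := le_iSup (fun i => X.grading (i + (1, 0))) (i - (1, 0))
      simpa only [sub_add_cancel] using this
  smul_mem i j b x hb hx := by
    rw [add_assoc]
    exact X.smul_mem _ _ _ _ hb hx
  concentrated n k hk := by
    have h : ((n, k) : ℤ × ℤ) + (1, 0) = (n + 1, k) := by simp
    change X.grading ((n, k) + (1, 0)) = ⊥
    rw [h]
    exact X.concentrated _ _ hk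
  coaction := X.coaction
  periodic := X.periodic
  coaction_mem i x hx := by
    refine tensorGrading_le_comap (AddMonoidHom.id _) _ ?_ (X.coaction_mem _ _ hx)
    intro a b g m hab hg hm
    refine tmul_mem_tensorGrading (j := b - (1, 0)) ?_ hg ?_
    · rw [← add_sub_assoc, hab, add_sub_cancel_right]
    · rwa [sub_add_cancel]
  d := -X.d
  d_mem i x hx := neg_mem (X.d_mem _ _ hx)
  d_d x := by simp [X.d_d]
  coaction_d x := by
    have : (-X.d).restrictScalars (E1 p) = -(X.d.restrictScalars (E1 p)) := rfl
    rw [this, LinearMap.lTensor_neg, LinearMap.neg_apply, LinearMap.neg_apply, map_neg, X.coaction_d]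

/-- The coaction on a product. -/
def prodCoaction {M N : Type} [AddCommGroup M] [AddCommGroup N] [Module (E1 p) M]
    [Module (E1 p) N] (ψ : Coaction (hopf p) M) (φ : Coaction (hopf p) N) :
    Coaction (hopf p) (M × N) where
  toHom := AddMonoidHom.coprod
    (((LinearMap.inl (E1 p) M N).lTensor (EE p)).toAddMonoidHom.comp ψ.toHom)
    (((LinearMap.inr (E1 p) M N).lTensor (EE p)).toAddMonoidHom.comp φ.toHom)
  semilinear a m := by
    simp only [AddMonoidHom.coprod_apply, AddMonoidHom.comp_apply, LinearMap.toAddMonoidHom_coe,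
      Prod.smul_fst, Prod.smul_snd, ψ.semilinear, φ.semilinear, lTensor_smul', smul_add]
  counit m := by
    have key : ∀ {P Q : Type} [AddCommGroup P] [AddCommGroup Q] [Module (E1 p) P] [Module (E1 p) Q]
        (f : P →ₗ[E1 p] Q) (t : E1 p ⊗[E1 p] P),
        TensorProduct.lid (E1 p) Q (f.lTensor (E1 p) t) = f (TensorProduct.lid (E1 p) P t) := by
      intro P Q _ _ _ _ f t
      induction t using TensorProduct.induction_on with
      | zero => simp
      | add x y hx hy => simp only [map_add, hx, hy]
      | tmul g m => simp
    simp only [AddMonoidHom.coprod_apply, AddMonoidHom.comp_apply, LinearMap.toAddMonoidHom_coe,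
      map_add, rTensor_lTensor, key, ψ.counit, φ.counit]
    simp
  coassoc m := by
    simp only [AddMonoidHom.coprod_apply, AddMonoidHom.comp_apply, LinearMap.toAddMonoidHom_coe,
      map_add, rTensor_lTensor, ψ.coassoc, φ.coassoc]
    refine congrArg₂ (· + ·) (oneTensor_lTensor ψ.semilinear _ _ (fun m => ?_) _).symm
      (oneTensor_lTensor φ.semilinear _ _ (fun m => ?_) _).symm <;> simp

lemma prodCoaction_apply {M N : Type} [AddCommGroup M] [AddCommGroup N] [Module (E1 p) M]
    [Module (E1 p) N] (ψ : Coaction (hopf p) M) (φ : Coaction (hopf p) N) (m : M × N) :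
    (prodCoaction ψ φ).toHom m = (LinearMap.inl (E1 p) M N).lTensor (EE p) (ψ.toHom m.1) +
      (LinearMap.inr (E1 p) M N).lTensor (EE p) (φ.toHom m.2) := rfl

/-- A linear map from a product commutes with the coactions if its components do. -/
lemma CoactionCompat.coprod {X Y Z : QPComplex p} {f : X.carrier →ₗ[PE p] Z.carrier}
    {g : Y.carrier →ₗ[PE p] Z.carrier} (hf : CoactionCompat X.coaction Z.coaction f)
    (hg : CoactionCompat Y.coaction Z.coaction g) :
    CoactionCompat (prodCoaction X.coaction Y.coaction) Z.coaction (f.coprod g) := fun x => by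
  rw [LinearMap.coprod_apply, map_add, hf, hg, prodCoaction_apply, map_add,
    ← LinearMap.lTensor_comp_apply, ← LinearMap.lTensor_comp_apply]
  congr 3 <;> (ext; simp)

lemma CoactionCompat.prod {X Y Z : QPComplex p} {f : Z.carrier →ₗ[PE p] X.carrier}
    {g : Z.carrier →ₗ[PE p] Y.carrier} (hf : CoactionCompat Z.coaction X.coaction f)
    (hg : CoactionCompat Z.coaction Y.coaction g) :
    CoactionCompat Z.coaction (prodCoaction X.coaction Y.coaction) (f.prod g) := fun x => by
  rw [prodCoaction_apply]
  change (LinearMap.inl (E1 p) _ _).lTensor (EE p) (X.coaction.toHom (f x)) +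
    (LinearMap.inr (E1 p) _ _).lTensor (EE p) (Y.coaction.toHom (g x)) = _
  rw [hf, hg, ← LinearMap.lTensor_comp_apply, ← LinearMap.lTensor_comp_apply, ← LinearMap.add_apply,
    ← LinearMap.lTensor_add]
  congr 2
  ext <;> simp

/-- A homomorphism of comodules `φ : X → Y` of degree `1` anticommuting with the differentials, which
twists the differential of the direct sum. -/
structure Twist (X Y : QPComplex p) where
  map : X.carrier →ₗ[PE p] Y.carrier
  map_mem : ∀ i x, x ∈ X.grading i → map x ∈ Y.grading (i + (1, 0))
  map_d : ∀ x, map (X.d x) + Y.d (map x) = 0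
  map_coaction : CoactionCompat X.coaction Y.coaction map

/-- The direct sum of `X` and `Y` with the differential `(x, y) ↦ (d x, φ x + d y)`. -/
def twisted {X Y : QPComplex p} (φ : Twist X Y) : QPComplex p where
  carrier := X.carrier × Y.carrier
  grading i := (X.grading i).prod (Y.grading i)
  isInternal := isInternal_prod X.isInternal Y.isInternal
  smul_mem i j b x hb hx := ⟨X.smul_mem _ _ _ _ hb hx.1, Y.smul_mem _ _ _ _ hb hx.2⟩
  concentrated n k hk := by
    rw [X.concentrated n k hk, Y.concentrated n k hk]
    exact AddSubgroup.bot_prod_bot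
  coaction := prodCoaction X.coaction Y.coaction
  periodic k m := by
    rw [prodCoaction_apply, prodCoaction_apply, Prod.smul_fst, Prod.smul_snd, X.periodic, Y.periodic,
      map_add, ← LinearMap.lTensor_comp_apply, ← LinearMap.lTensor_comp_apply,
      ← LinearMap.lTensor_comp_apply, ← LinearMap.lTensor_comp_apply]
    congr 3 <;> (ext <;> simp)
  coaction_mem i x hx := by
    rw [prodCoaction_apply]
    refine add_mem ?_ ?_
    · refine tensorGrading_le_comap
        ((LinearMap.inl (E1 p) X.carrier Y.carrier).lTensor (EE p)).toAddMonoidHom _ ?_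
        (X.coaction_mem i _ hx.1)
      intro a b g m hab hg hm
      exact tmul_mem_tensorGrading hab hg ⟨hm, zero_mem _⟩
    · refine tensorGrading_le_comap
        ((LinearMap.inr (E1 p) X.carrier Y.carrier).lTensor (EE p)).toAddMonoidHom _ ?_
        (Y.coaction_mem i _ hx.2)
      intro a b g m hab hg hm
      exact tmul_mem_tensorGrading hab hg ⟨zero_mem _, hm⟩
  d := (X.d ∘ₗ LinearMap.fst (PE p) _ _).prod (φ.map.coprod Y.d)
  d_mem i x hx := ⟨X.d_mem i _ hx.1, add_mem (φ.map_mem i _ hx.1) (Y.d_mem i _ hx.2)⟩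
  d_d x := by
    refine Prod.ext (X.d_d _) ?_
    change φ.map (X.d x.1) + Y.d (φ.map x.1 + Y.d x.2) = 0
    rw [map_add, Y.d_d, add_zero, φ.map_d]
  coaction_d x := by
    have h1 := CoactionCompat.coprod φ.map_coaction Y.coaction_d x
    have h2 : CoactionCompat (prodCoaction X.coaction Y.coaction) X.coaction
        (X.d ∘ₗ LinearMap.fst (PE p) X.carrier Y.carrier) := by
      have : X.d ∘ₗ LinearMap.fst (PE p) X.carrier Y.carrier = X.d.coprod 0 := by ext <;> simp
      rw [this]
      refine CoactionCompat.coprod X.coaction_d fun y => ?_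
      rw [LinearMap.zero_apply, map_zero, LinearMap.restrictScalars_zero, LinearMap.lTensor_zero,
        LinearMap.zero_apply]
    rw [prodCoaction_apply]
    change (LinearMap.inl (E1 p) _ _).lTensor (EE p) (X.coaction.toHom
        ((X.d ∘ₗ LinearMap.fst (PE p) X.carrier Y.carrier) x)) +
      (LinearMap.inr (E1 p) _ _).lTensor (EE p) (Y.coaction.toHom (φ.map.coprod Y.d x)) = _
    rw [h1, h2, ← LinearMap.lTensor_comp_apply, ← LinearMap.lTensor_comp_apply, ← LinearMap.add_apply,
      ← LinearMap.lTensor_add]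
    congr 2
    ext <;> simp

end QPComplex

namespace QPComplex

variable {p : ℕ}

lemma map_proj {X Y : QPComplex p} (f : X ⟶ Y) (i : ℤ × ℤ) (x : X.carrier) :
    f.toLin (X.proj i x) = Y.proj i (f.toLin x) := by
  induction x using gr_induction X.isInternal with
  | zero => simp
  | add x y hx hy => simp only [map_add, hx, hy]
  | mem j x hx =>
    rw [X.proj_of_mem hx, Y.proj_of_mem (f.map_mem j x hx)]
    split_ifs <;> simp

/-! ### Kernels of morphisms of complexes. -/

section Kernel

variable [Fact p.Prime] {X Y : QPComplex p} (f : X ⟶ Y)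

/-- The underlying module of the kernel. -/
abbrev Ker : Type := LinearMap.ker f.toLin

/-- The inclusion of the kernel. -/
abbrev kerIncl : Ker f →ₗ[E1 p] X.carrier := (LinearMap.ker f.toLin).subtype.restrictScalars (E1 p)

lemma kerIncl_lTensor_injective :
    Function.Injective ((kerIncl f).lTensor (EE p)) :=
  Module.Flat.lTensor_preserves_injective_linearMap _ (Submodule.subtype_injective _)

/-- By flatness of `E(1)_*E(1)`, tensoring with it keeps the kernel sequence exact. The coaction of
a kernel element is killed by `1 ⊗ f`, because `f` is a comodule map, and hence comes from the
tensor product with the kernel. -/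
lemma coaction_mem_range (x : Ker f) :
    X.coaction.toHom (x : X.carrier) ∈ LinearMap.range ((kerIncl f).lTensor (EE p)) := by
  have hex : Function.Exact (kerIncl f) (f.toLin.restrictScalars (E1 p)) := fun y =>
    ⟨fun hy => ⟨⟨y, hy⟩, rfl⟩, by rintro ⟨z, rfl⟩; exact z.2⟩
  refine (Module.Flat.lTensor_exact (EE p) hex _).mp ?_
  rw [← f.map_coaction, LinearMap.mem_ker.mp x.2, map_zero]

/-- The coaction on the kernel, as an additive map. -/
def kerHom : Ker f →+ EE p ⊗[E1 p] Ker f :=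
  (LinearEquiv.ofInjective _ (kerIncl_lTensor_injective f)).symm.toLinearMap.toAddMonoidHom.comp
    { toFun := fun x => ⟨X.coaction.toHom (x : X.carrier), coaction_mem_range f x⟩
      map_zero' := Subtype.ext (map_zero _)
      map_add' := fun _ _ => Subtype.ext (map_add _ _ _) }

lemma lTensor_kerHom (x : Ker f) :
    (kerIncl f).lTensor (EE p) (kerHom f x) = X.coaction.toHom (x : X.carrier) :=
  congrArg Subtype.val ((LinearEquiv.ofInjective _ (kerIncl_lTensor_injective f)).apply_symm_apply
    ⟨X.coaction.toHom (x : X.carrier), coaction_mem_range f x⟩)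

lemma kerHom_smul (a : E1 p) (x : Ker f) : kerHom f (a • x) = (hopf p).unitL a • kerHom f x := by
  apply kerIncl_lTensor_injective f
  rw [lTensor_smul', lTensor_kerHom, lTensor_kerHom, ← X.coaction.semilinear]
  rfl

/-- The coaction on the kernel. -/
def kerCoaction : Coaction (hopf p) (Ker f) where
  toHom := kerHom f
  semilinear := kerHom_smul f
  counit x := by
    have key : ∀ t : E1 p ⊗[E1 p] Ker f, ((TensorProduct.lid (E1 p) (Ker f) t : Ker f) : X.carrier) =
        TensorProduct.lid (E1 p) X.carrier ((kerIncl f).lTensor (E1 p) t) := fun t => by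
      induction t using TensorProduct.induction_on with
      | zero => simp
      | add x y hx hy => simp only [map_add, Submodule.coe_add, hx, hy]
      | tmul g m => rfl
    apply Subtype.ext
    rw [key, ← rTensor_lTensor, lTensor_kerHom, X.coaction.counit]
  coassoc x := by
    -- Coassociativity is an identity in the triple product, so it is flatness of `EEE p` that
    -- allows it to be checked in `X`.
    apply Module.Flat.lTensor_preserves_injective_linearMap (M := EEE p) (kerIncl f)
      (Submodule.subtype_injective _)
    rw [← rTensor_lTensor, lTensor_kerHom, X.coaction.coassoc,
      ← oneTensor_lTensor (kerHom_smul f) X.coaction.semilinear (kerIncl f)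
        (fun m => (lTensor_kerHom f m).symm), lTensor_kerHom]

/-- The kernel of a morphism. -/
def kernel : QPComplex p where
  carrier := Ker f
  grading i := (X.grading i).comap (kerIncl f).toAddMonoidHom
  isInternal := X.isInternal_of_proj_mem (kerIncl f).toAddMonoidHom (Submodule.subtype_injective _)
    fun i x => ⟨⟨X.proj i x, by rw [LinearMap.mem_ker, map_proj, LinearMap.mem_ker.mp x.2, map_zero]⟩,
      rfl⟩
  smul_mem i j b x hb hx := X.smul_mem i j b _ hb hx
  concentrated n k hk := by
    rw [X.concentrated n k hk, eq_bot_iff]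
    exact fun x hx => Subtype.ext hx
  coaction := kerCoaction f
  periodic k x := by
    apply kerIncl_lTensor_injective f
    have h1 : kerIncl f ∘ₗ scalarMap (E1 p) (Ker f) (T k : PE p) =
        scalarMap (E1 p) X.carrier (T k : PE p) ∘ₗ kerIncl f := rfl
    refine (lTensor_kerHom f _).trans ?_
    rw [← LinearMap.lTensor_comp_apply, h1, LinearMap.lTensor_comp_apply]
    refine (X.periodic k x).trans (congrArg _ (lTensor_kerHom f x).symm)
  coaction_mem i x hx := by
    -- The degree of a tensor over the kernel is tested by evaluations, which can be computed in
    -- `X`.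
    refine mem_tensorGrading_of_evalTensor_mem fun a => ?_
    change kerIncl f (evalTensor a (kerHom f x)) ∈ X.grading i
    rw [← evalTensor_lTensor, lTensor_kerHom]
    exact X.evalTensor_mem a (X.coaction_mem i _ hx)
  d := X.d.restrict fun x (hx : x ∈ LinearMap.ker f.toLin) => by
    rw [LinearMap.mem_ker] at hx ⊢
    rw [f.map_d, hx, map_zero]
  d_mem i x hx := X.d_mem i _ hx
  d_d x := Subtype.ext (X.d_d _)
  coaction_d x := by
    apply kerIncl_lTensor_injective f
    refine (lTensor_kerHom f _).trans ((X.coaction_d x).trans ?_)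
    rw [← LinearMap.lTensor_comp_apply, ← lTensor_kerHom, ← LinearMap.lTensor_comp_apply]
    rfl

/-- The inclusion of the kernel. -/
def kernelι : kernel f ⟶ X where
  toLin := (LinearMap.ker f.toLin).subtype
  map_mem _ _ hx := hx
  map_d _ := rfl
  map_coaction x := (lTensor_kerHom f x).symm

/-- The map of kernels induced by a commutative square. -/
def kernelMap {X' Y' : QPComplex p} {f : X ⟶ Y} {f' : X' ⟶ Y'} (a : X ⟶ X') (b : Y ⟶ Y')
    (h : f ≫ b = a ≫ f') : kernel f ⟶ kernel f' :=
  have ha : ∀ x ∈ LinearMap.ker f.toLin, a.toLin x ∈ LinearMap.ker f'.toLin := fun x hx => by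
    rw [LinearMap.mem_ker] at hx ⊢
    have := congrArg (fun g : X ⟶ Y' => Hom.toLin g x) h
    simp only [comp_toLin, LinearMap.comp_apply, hx, map_zero] at this
    exact this.symm
  have key : ∀ x : Ker f, kerHom f' (a.toLin.restrict ha x) =
      ((a.toLin.restrict ha).restrictScalars (E1 p)).lTensor (EE p) (kerHom f x) := fun x => by
    have h1 : kerIncl f' ∘ₗ (a.toLin.restrict ha).restrictScalars (E1 p) =
      a.toLin.restrictScalars (E1 p) ∘ₗ kerIncl f := rfl
    apply kerIncl_lTensor_injective f'
    rw [lTensor_kerHom, ← LinearMap.lTensor_comp_apply, h1, LinearMap.lTensor_comp_apply,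
      lTensor_kerHom, ← a.map_coaction]
    rfl
  { toLin := a.toLin.restrict ha
    map_mem := fun i x hx => a.map_mem i _ hx
    map_d := fun x => Subtype.ext (a.map_d x.1)
    map_coaction := key }

end Kernel

/-! ### Mapping cones. -/

section Cone

variable {X Y : QPComplex p}

lemma prodCoaction_compat {X' Y' : QPComplex p} {a : X.carrier →ₗ[PE p] X'.carrier}
    {b : Y.carrier →ₗ[PE p] Y'.carrier} (ha : CoactionCompat X.coaction X'.coaction a)
    (hb : CoactionCompat Y.coaction Y'.coaction b) :
    CoactionCompat (prodCoaction X.coaction Y.coaction) (prodCoaction X'.coaction Y'.coaction)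
      (a.prodMap b) := fun x => by
  have h : (prodCoaction X'.coaction Y'.coaction).toHom (a.prodMap b x) =
      (LinearMap.inl (E1 p) _ _).lTensor (EE p) (X'.coaction.toHom (a x.1)) +
      (LinearMap.inr (E1 p) _ _).lTensor (EE p) (Y'.coaction.toHom (b x.2)) := rfl
  rw [h, ha, hb, prodCoaction_apply, map_add,
    ← LinearMap.lTensor_comp_apply, ← LinearMap.lTensor_comp_apply,
    ← LinearMap.lTensor_comp_apply, ← LinearMap.lTensor_comp_apply]
  congr 3 <;> (ext <;> simp)

/-- A morphism of complexes as a twist from the shift of its source to its target. -/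
def coneTwist (f : X ⟶ Y) : Twist (shift X) Y where
  map := f.toLin
  map_mem _ _ hx := f.map_mem _ _ hx
  map_d :=
    have h : ∀ x : X.carrier, f.toLin (-X.d x) + Y.d (f.toLin x) = 0 := fun x => by
      rw [map_neg, f.map_d, neg_add_cancel]
    h
  map_coaction := f.map_coaction

/-- The mapping cone. -/
def cone (f : X ⟶ Y) : QPComplex p := twisted (coneTwist f)

/-- Acyclicity of the cone in coordinates, the differential being `(x, y) ↦ (-d x, f x + d y)`. -/
lemma cone_acyclic_iff (f : X ⟶ Y) : (∀ z, (cone f).d z = 0 → ∃ w, (cone f).d w = z) ↔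
    ∀ (x : X.carrier) (y : Y.carrier), X.d x = 0 → f.toLin x + Y.d y = 0 →
      ∃ (u : X.carrier) (v : Y.carrier), -X.d u = x ∧ f.toLin u + Y.d v = y := by
  refine ⟨fun h x y hx hy => ?_, fun h z hz => ?_⟩
  · obtain ⟨w, hw⟩ := h (x, y) (Prod.ext (neg_eq_zero.mpr hx) hy)
    exact ⟨w.1, w.2, congrArg Prod.fst hw, congrArg Prod.snd hw⟩
  · obtain ⟨u, v, hu, hv⟩ := h z.1 z.2 (neg_eq_zero.mp (congrArg Prod.fst hz)) (congrArg Prod.snd hz)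
    exact ⟨(u, v), Prod.ext hu hv⟩

/-- A morphism out of the mapping cone. -/
def coneDesc {Z : QPComplex p} (f : X ⟶ Y) (h : X.carrier →ₗ[PE p] Z.carrier) (g : Y ⟶ Z)
    (h_mem : ∀ i x, x ∈ X.grading (i + (1, 0)) → h x ∈ Z.grading i)
    (h_coaction : CoactionCompat X.coaction Z.coaction h)
    (hd : ∀ x, g.toLin (f.toLin x) = Z.d (h x) + h (X.d x)) : cone f ⟶ Z where
  toLin := h.coprod g.toLin
  map_mem i x hx := add_mem (h_mem i _ hx.1) (g.map_mem i _ hx.2)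
  map_d :=
    have key : ∀ x : X.carrier × Y.carrier,
        h (-X.d x.1) + g.toLin (f.toLin x.1 + Y.d x.2) = Z.d (h x.1 + g.toLin x.2) := fun x => by
      rw [map_neg, map_add, map_add, hd, g.map_d]
      abel
    key
  map_coaction x := CoactionCompat.coprod (X := shift X) (Y := Y) h_coaction g.map_coaction x

/-- The map of cones induced by a commutative square. -/
def coneMap {X' Y' : QPComplex p} {f : X ⟶ Y} {f' : X' ⟶ Y'} (a : X ⟶ X') (b : Y ⟶ Y')
    (h : f ≫ b = a ≫ f') : cone f ⟶ cone f' where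
  toLin := a.toLin.prodMap b.toLin
  map_mem i x hx := ⟨a.map_mem _ _ hx.1, b.map_mem _ _ hx.2⟩
  map_d :=
    have key : ∀ x : X.carrier × Y.carrier,
        b.toLin (f.toLin x.1 + Y.d x.2) = f'.toLin (a.toLin x.1) + Y'.d (b.toLin x.2) := fun x => by
      have := congrArg (fun g : X ⟶ Y' => Hom.toLin g x.1) h
      simp only [comp_toLin, LinearMap.comp_apply] at this
      rw [map_add, this, b.map_d]
    fun x => Prod.ext ((map_neg _ _).trans (congrArg Neg.neg (a.map_d x.1))) (key x)
  map_coaction := prodCoaction_compat a.map_coaction b.map_coaction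

end Cone

/-! ### Quasi-isomorphisms in terms of elements and of cones. -/

section QuasiIso

variable {X Y Z : QPComplex p}

/-- The two conditions are injectivity and surjectivity on cohomology, freed from quotients for use
in diagram chases. -/
lemma quasiIso_iff (f : X ⟶ Y) : quasiIso p f ↔
    (∀ x, X.d x = 0 → ∀ y, Y.d y = f.toLin x → ∃ z, X.d z = x) ∧
    (∀ y, Y.d y = 0 → ∃ x z, X.d x = 0 ∧ f.toLin x = y + Y.d z) := by
  refine ⟨fun ⟨h1, h2⟩ => ⟨fun x hx y hy => ?_, fun y hy => ?_⟩, fun ⟨h1, h2⟩ => ⟨?_, fun y => ?_⟩⟩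
  · have : cohomologyMap f (Submodule.Quotient.mk ⟨x, hx⟩) = cohomologyMap f 0 := by
      rw [map_zero]
      exact (Submodule.Quotient.mk_eq_zero _).mpr ⟨y, hy⟩
    exact (Submodule.Quotient.mk_eq_zero _).mp (h1 this)
  · obtain ⟨x, hx⟩ := h2 (Submodule.Quotient.mk ⟨y, hy⟩)
    obtain ⟨⟨x, hx'⟩, rfl⟩ := Submodule.Quotient.mk_surjective _ x
    obtain ⟨z, hz⟩ := (Submodule.Quotient.eq _).mp hx
    refine ⟨x, z, hx', ?_⟩
    have : Y.d z = f.toLin x - y := hz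
    rw [this, add_sub_cancel]
  · rw [injective_iff_map_eq_zero]
    intro x hx
    obtain ⟨⟨x, hx'⟩, rfl⟩ := Submodule.Quotient.mk_surjective _ x
    obtain ⟨y, hy⟩ := (Submodule.Quotient.mk_eq_zero _).mp hx
    obtain ⟨z, hz⟩ := h1 x hx' y hy
    exact (Submodule.Quotient.mk_eq_zero _).mpr ⟨z, hz⟩
  · obtain ⟨⟨y, hy⟩, rfl⟩ := Submodule.Quotient.mk_surjective _ y
    obtain ⟨x, z, hx, hxz⟩ := h2 y hy
    refine ⟨Submodule.Quotient.mk ⟨x, hx⟩, (Submodule.Quotient.eq _).mpr ⟨z, ?_⟩⟩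
    change Y.d z = f.toLin x - y
    rw [hxz, add_sub_cancel_left]

lemma cohomologyMap_comp (f : X ⟶ Y) (g : Y ⟶ Z) :
    cohomologyMap (f ≫ g) = cohomologyMap g ∘ₗ cohomologyMap f := by
  refine LinearMap.ext fun x => ?_
  obtain ⟨x, rfl⟩ := Submodule.Quotient.mk_surjective _ x
  rfl

instance : (quasiIso p).HasTwoOutOfThreeProperty where
  comp_mem f g hf hg := by
    change Function.Bijective (cohomologyMap (f ≫ g))
    rw [cohomologyMap_comp]
    exact hg.comp hf
  of_postcomp f g hg hfg := by
    change Function.Bijective (cohomologyMap (f ≫ g)) at hfg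
    rw [cohomologyMap_comp] at hfg
    exact (Function.Bijective.of_comp_iff' hg _).mp hfg
  of_precomp f g hf hfg := by
    change Function.Bijective (cohomologyMap (f ≫ g)) at hfg
    rw [cohomologyMap_comp] at hfg
    exact (Function.Bijective.of_comp_iff _ hf).mp hfg

/-- The cone of a morphism is acyclic if and only if the morphism is a quasi-isomorphism. -/
lemma quasiIso_iff_cone (f : X ⟶ Y) : quasiIso p f ↔
    ∀ z, (cone f).d z = 0 → ∃ w, (cone f).d w = z := by
  rw [quasiIso_iff, cone_acyclic_iff]
  refine ⟨?_, fun h => ⟨fun x hx y hy => ?_, fun y hy => ?_⟩⟩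
  · rintro ⟨h1, h2⟩ x y hx hxy
    obtain ⟨w, hw⟩ := h1 x hx (-y) (by rw [map_neg, neg_eq_iff_add_eq_zero, add_comm, hxy])
    obtain ⟨x', z, hx', hz'⟩ := h2 (y + f.toLin w) (by rw [map_add, ← f.map_d, hw, add_comm, hxy])
    refine ⟨x' - w, -z, ?_, ?_⟩
    · rw [map_sub, hx', hw, zero_sub, neg_neg]
    · rw [map_sub, hz', map_neg]
      abel
  · obtain ⟨u, v, hu, -⟩ := h x (-y) hx (by rw [map_neg, hy, add_neg_cancel])
    exact ⟨-u, by rw [map_neg, hu]⟩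
  · obtain ⟨u, v, hu, hv⟩ := h 0 y (map_zero _) (by rw [map_zero, hy, add_zero])
    exact ⟨u, -v, neg_eq_zero.mp hu, by rw [map_neg, ← hv]; abel⟩

end QuasiIso

/-! ### Stability of flatness under twisted sums, cones and kernels. -/

section Flat

variable [Fact p.Prime] {X Y : QPComplex p}

omit [Fact p.Prime] in
lemma isFlat_shift (hX : isFlat p X) : isFlat p (shift X) := hX

lemma isFlat_twisted (φ : Twist X Y) (hX : isFlat p X) (hY : isFlat p Y) : isFlat p (twisted φ) := by
  rw [isFlat_iff_torsionFree] at *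
  rintro ⟨x, y⟩ h
  have h1 : p • x = 0 := congrArg Prod.fst h
  have h2 : p • y = 0 := congrArg Prod.snd h
  exact Prod.ext (hX x h1) (hY y h2)

lemma isFlat_cone (f : X ⟶ Y) (hX : isFlat p X) (hY : isFlat p Y) : isFlat p (cone f) :=
  isFlat_twisted _ (isFlat_shift hX) hY

/-- A submodule of a `p`-torsion-free module is `p`-torsion-free. This is the reason why one step of
resolution is enough. -/
lemma isFlat_kernel (f : X ⟶ Y) (hX : isFlat p X) : isFlat p (kernel f) := by
  rw [isFlat_iff_torsionFree] at *
  exact fun x h => Subtype.ext (hX x.1 (congrArg Subtype.val h))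

end Flat

end QPComplex

/-! ### Contractible complexes on free comodules. -/

namespace CoeffFamily

variable {p : ℕ} (S : CoeffFamily p)

/-- Two copies of a family, the second one shifted by one cohomological degree. -/
def double : CoeffFamily p where
  index := S.index × Bool
  size s := S.size s.1
  mat s := S.mat s.1
  deg s := S.deg s.1 + if s.2 then (1, 0) else 0
  dvd s := by
    obtain ⟨s, ε⟩ := s
    cases ε <;> simpa using S.dvd s

/-- The values of the differential of the sum of discs on the basis. -/
def discD (b : S.double.Basis) : S.double.Free :=
  if b.1.2 then 0 else Finsupp.single ⟨(b.1.1, true), b.2⟩ 1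

/-- The basis values of the morphism of complexes from the sum of discs determined by given elements
of the target. -/
def discLiftFun {X : QPComplex p} (m : S.Basis → X.carrier) (b : S.double.Basis) : X.carrier :=
  if b.1.2 then X.d (m ⟨b.1.1, b.2⟩) else m ⟨b.1.1, b.2⟩

lemma coactionCompat_discD : QPComplex.CoactionCompat S.double.freeCoaction S.double.freeCoaction
    (Finsupp.linearCombination (PE p) S.discD) := by
  refine coactionCompat_linearCombination _ _ S.double.freeCoaction_periodic _ fun s a => ?_
  obtain ⟨s, ε⟩ := s
  cases ε
  · exact S.double.freeCoaction_single_one (s, true) a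
  · change S.double.freeCoaction.toHom 0 = ∑ b, (S.mat s).coeff a b ⊗ₜ[E1 p] (0 : S.double.Free)
    simp

lemma linearCombination_mem {X : QPComplex p} {i : ℤ × ℤ} {S : CoeffFamily p}
    (m : S.Basis → X.carrier) (j : ℤ × ℤ)
    (hm : ∀ b, m b ∈ X.grading (S.deg b.1 + j)) {x : S.Free} (hx : x ∈ S.freeGrading i) :
    Finsupp.linearCombination (PE p) m x ∈ X.grading (i + j) := by
  refine S.freeGrading_le (Finsupp.linearCombination (PE p) m).toAddMonoidHom _ ?_ hx
  rintro s a k g rfl hg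
  rw [LinearMap.toAddMonoidHom_coe, Finsupp.linearCombination_single, add_assoc]
  exact X.smul_mem _ _ _ _ hg (hm ⟨s, a⟩)

/-- The sum of the contractible complexes generated by the elements of a family. -/
def discs : QPComplex p where
  carrier := S.double.Free
  grading := S.double.freeGrading
  isInternal := S.double.freeGrading_isInternal
  smul_mem := S.double.freeGrading_smul_mem
  concentrated := S.double.freeGrading_concentrated
  coaction := S.double.freeCoaction
  periodic := S.double.freeCoaction_periodic
  coaction_mem := S.double.freeCoaction_mem
  d := Finsupp.linearCombination (PE p) S.discD
  d_mem i x hx := by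
    refine S.double.freeGrading_le (Finsupp.linearCombination (PE p) S.discD).toAddMonoidHom _ ?_ hx
    rintro ⟨s, ε⟩ a k g rfl hg
    rw [LinearMap.toAddMonoidHom_coe, Finsupp.linearCombination_single]
    cases ε
    · have h : g • S.discD ⟨(s, false), a⟩ = Finsupp.single ⟨(s, true), a⟩ g := by
        change g • (Finsupp.single ⟨(s, true), a⟩ 1 : S.double.Free) = _
        rw [Finsupp.smul_single, smul_eq_mul, mul_one]
      rw [h]
      have := S.double.single_mem_freeGrading (s := (s, true)) a hg
      have h' : k + S.double.deg (s, false) + (1, 0) = k + S.double.deg (s, true) := by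
        simp [double, add_assoc]
      rwa [h']
    · have h : g • S.discD ⟨(s, true), a⟩ = 0 := smul_zero g
      rw [h]
      exact zero_mem _
  d_d x := by
    induction x using Finsupp.induction_linear with
    | zero => simp
    | add x y hx hy => simp only [map_add, hx, hy, add_zero]
    | single b f =>
      obtain ⟨⟨s, ε⟩, a⟩ := b
      rw [Finsupp.linearCombination_single, map_smul]
      cases ε
      · change f • Finsupp.linearCombination (PE p) S.discD (Finsupp.single ⟨(s, true), a⟩ 1) = 0
        rw [Finsupp.linearCombination_single]
        change f • (1 : PE p) • (0 : S.double.Free) = 0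
        rw [smul_zero, smul_zero]
      · change f • Finsupp.linearCombination (PE p) S.discD 0 = 0
        rw [map_zero, smul_zero]
  coaction_d := S.coactionCompat_discD

/-- The generators of the sum of discs. -/
def gen (s : S.index) (a : Fin (S.size s)) : S.discs.carrier :=
  (Finsupp.single ⟨(s, false), a⟩ 1 : S.double.Free)

lemma discs_d_gen (s : S.index) (a : Fin (S.size s)) :
    S.discs.d (S.gen s a) = (Finsupp.single ⟨(s, true), a⟩ 1 : S.double.Free) :=
  (Finsupp.linearCombination_single (PE p) (v := S.discD) 1 ⟨(s, false), a⟩).trans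
    (one_smul (PE p) (Finsupp.single ⟨(s, true), a⟩ 1 : S.double.Free))

variable {S} in
/-- The morphism of complexes from the sum of discs determined by given elements of the target. -/
def discLift {X : QPComplex p} (m : S.Basis → X.carrier)
    (hmem : ∀ b, m b ∈ X.grading (S.deg b.1))
    (hm : ∀ s a, X.coaction.toHom (m ⟨s, a⟩) = ∑ b, (S.mat s).coeff a b ⊗ₜ m ⟨s, b⟩) :
    S.discs ⟶ X where
  toLin := Finsupp.linearCombination (PE p) (S.discLiftFun m)
  map_mem i x hx := by
    have := linearCombination_mem (X := X) (S.discLiftFun m) 0 (fun b => ?_) hx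
    · rwa [add_zero] at this
    · obtain ⟨⟨s, ε⟩, a⟩ := b
      rw [add_zero]
      cases ε
      · simpa [double, discLiftFun] using hmem ⟨s, a⟩
      · simpa [double, discLiftFun] using X.d_mem _ _ (hmem ⟨s, a⟩)
  map_d x := by
    refine DFunLike.congr_fun (f := Finsupp.linearCombination (PE p) (S.discLiftFun m) ∘ₗ
      Finsupp.linearCombination (PE p) S.discD)
      (g := X.d ∘ₗ Finsupp.linearCombination (PE p) (S.discLiftFun m)) (Finsupp.lhom_ext' ?_) x
    rintro ⟨⟨s, ε⟩, a⟩
    refine LinearMap.ext_ring ?_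
    simp only [LinearMap.comp_apply, Finsupp.lsingle_apply, Finsupp.linearCombination_single, one_smul]
    cases ε
    · change Finsupp.linearCombination (PE p) (S.discLiftFun m) (Finsupp.single ⟨(s, true), a⟩ 1) = _
      rw [Finsupp.linearCombination_single, one_smul]
      rfl
    · change Finsupp.linearCombination (PE p) (S.discLiftFun m) 0 = X.d (X.d _)
      rw [X.d_d, map_zero]
  map_coaction := by
    refine coactionCompat_linearCombination _ _ X.periodic _ ?_
    rintro ⟨s, ε⟩ a
    cases ε
    · exact hm s a
    · refine (X.coaction_d _).trans ((congrArg _ (hm s a)).trans ?_)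
      rw [map_sum]
      rfl

variable {S} in
lemma discLift_gen {X : QPComplex p} (m : S.Basis → X.carrier) (hmem) (hm)
    (s : S.index) (a : Fin (S.size s)) :
    (discLift m hmem hm).toLin (S.gen s a) = m ⟨s, a⟩ :=
  (Finsupp.linearCombination_single (PE p) (v := S.discLiftFun m) 1 ⟨(s, false), a⟩).trans
    (one_smul (PE p) (m ⟨s, a⟩))

-- The basis elements of the second copy are the differentials of the generators, so a morphism of
-- complexes is determined by its values on the generators.
variable {S} in
lemma discs_hom_ext {X : QPComplex p} {f g : S.discs ⟶ X}
    (h : ∀ s a, f.toLin (S.gen s a) = g.toLin (S.gen s a)) : f = g := by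
  refine QPComplex.Hom.ext (Finsupp.lhom_ext' ?_)
  rintro ⟨⟨s, ε⟩, a⟩
  refine LinearMap.ext_ring ?_
  cases ε
  · exact h s a
  · have key : ∀ k : S.discs ⟶ X, k.toLin (Finsupp.single ⟨(s, true), a⟩ 1 : S.double.Free) =
        X.d (k.toLin (S.gen s a)) := fun k =>
      (congrArg k.toLin (S.discs_d_gen s a)).symm.trans (k.map_d _)
    exact (key f).trans ((congrArg X.d (h s a)).trans (key g).symm)

lemma isFlat_discs [Fact p.Prime] : isFlat p S.discs := by
  rw [isFlat_iff_torsionFree]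
  exact S.double.free_torsionFree

end CoeffFamily

/-! ### The functorial flat cover. -/

namespace QPComplex

variable {p : ℕ}

/-- A finite family of homogeneous elements of the same degree on which the coaction is given by
matrix coefficients. -/
structure Generator (X : QPComplex p) where
  size : ℕ
  mat : MatrixCoefficients p size
  deg : ℤ × ℤ
  dvd : qdeg p ∣ deg.2
  elt : Fin size → X.carrier
  elt_mem : ∀ a, elt a ∈ X.grading deg
  elt_coaction : ∀ a, X.coaction.toHom (elt a) = ∑ b, mat.coeff a b ⊗ₜ elt b

/-- The image of a generator under a morphism. -/
def Generator.map {X Y : QPComplex p} (f : X ⟶ Y) (g : Generator X) : Generator Y where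
  size := g.size
  mat := g.mat
  deg := g.deg
  dvd := g.dvd
  elt a := f.toLin (g.elt a)
  elt_mem a := f.map_mem _ _ (g.elt_mem a)
  elt_coaction a := by
    rw [f.map_coaction, g.elt_coaction, map_sum]
    rfl

/-- The family of all generators. -/
def generators (X : QPComplex p) : CoeffFamily p where
  index := Generator X
  size g := g.size
  mat g := g.mat
  deg g := g.deg
  dvd g := g.dvd

/-- The map of sums of discs induced by a morphism. -/
def coverMap {X Y : QPComplex p} (f : X ⟶ Y) : X.generators.discs ⟶ Y.generators.discs :=
  CoeffFamily.discLift (S := X.generators)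
    (fun b => Y.generators.gen (Generator.map f b.1) b.2)
    (fun b => by
      have h1 : (1 : PE p) ∈ gradingPE p 0 := by
        have := T_mem_gradingPE (p := p) 0
        rwa [mul_zero, Prod.mk_zero_zero, T_zero] at this
      have := Y.generators.double.single_mem_freeGrading (s := (Generator.map f b.1, false)) b.2 h1
      have h : 0 + Y.generators.double.deg (Generator.map f b.1, false) = X.generators.deg b.1 :=
        (zero_add _).trans (add_zero _)
      rwa [h] at this)
    (fun g a => Y.generators.double.freeCoaction_single_one (Generator.map f g, false) a)

lemma coverMap_gen {X Y : QPComplex p} (f : X ⟶ Y) (g : Generator X) (a : Fin g.size) :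
    (coverMap f).toLin (X.generators.gen g a) = Y.generators.gen (g.map f) a :=
  CoeffFamily.discLift_gen (S := X.generators)
    (fun b => Y.generators.gen (Generator.map f b.1) b.2) _ _ g a

variable (p) in
/-- A functorial flat complex which surjects onto a given complex. -/
def cover : QPComplex p ⥤ QPComplex p where
  obj X := X.generators.discs
  map f := coverMap f
  -- All generators are used at once and a morphism acts on them by composition, without changing
  -- matrices or degrees; this makes the cover strictly functorial.
  map_id X := CoeffFamily.discs_hom_ext fun g a => coverMap_gen (𝟙 X) g a
  map_comp f g := CoeffFamily.discs_hom_ext fun s a =>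
    (coverMap_gen (f ≫ g) s a).trans ((congrArg (coverMap g).toLin (coverMap_gen f s a)).trans
      (coverMap_gen g (Generator.map f s) a)).symm

/-- The surjection from the cover of a complex. -/
def coverπApp (X : QPComplex p) : (cover p).obj X ⟶ X :=
  CoeffFamily.discLift (S := X.generators) (fun b => Generator.elt b.1 b.2)
    (fun b => Generator.elt_mem b.1 b.2) (fun g a => Generator.elt_coaction g a)

lemma coverπApp_gen (X : QPComplex p) (g : Generator X) (a : Fin g.size) :
    (coverπApp X).toLin (X.generators.gen g a) = g.elt a :=
  CoeffFamily.discLift_gen (S := X.generators) _ _ _ g a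

variable (p) in
/-- The surjection from the cover. -/
def coverπ : cover p ⟶ 𝟭 (QPComplex p) where
  app := coverπApp
  naturality X Y f := CoeffFamily.discs_hom_ext fun s a =>
    (congrArg (coverπApp Y).toLin (coverMap_gen f s a)).trans
      ((coverπApp_gen Y (Generator.map f s) a).trans (congrArg f.toLin (coverπApp_gen X s a)).symm)

/-- Let `x` be homogeneous. Its evaluations have the same bidegree and form a generator by
`exists_matrixCoefficients`; the image of the cover contains them, hence their span, which contains
`x`. In internal degrees not divisible by `N` there is nothing to hit. -/
lemma coverπ_surjective [Fact p.Prime] (X : QPComplex p) :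
    Function.Surjective ((coverπ p).app X).toLin := by
  rw [← LinearMap.range_eq_top, eq_top_iff]
  rintro x -
  induction x using gr_induction X.isInternal with
  | zero => exact zero_mem _
  | add x y hx hy => exact add_mem hx hy
  | mem i x hx =>
    by_cases hi : qdeg p ∣ i.2
    · obtain ⟨n, c, a, h1, h2⟩ := exists_matrixCoefficients X.coaction x
      let g : Generator X :=
        { size := n
          mat := c
          deg := i
          dvd := hi
          elt := fun j => evalTensor (a j) (X.coaction.toHom x)
          elt_mem := fun j => X.evalTensor_mem _ (X.coaction_mem i x hx)
          elt_coaction := h1 }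
      have h3 : Submodule.span (E1 p) (Set.range g.elt) ≤
          (LinearMap.range ((coverπ p).app X).toLin).restrictScalars (E1 p) := by
        rw [Submodule.span_le]
        rintro _ ⟨j, rfl⟩
        exact ⟨_, coverπApp_gen X g j⟩
      exact h3 h2
    · have : x = 0 := (AddSubgroup.eq_bot_iff_forall _).mp (X.concentrated i.1 i.2 hi) x hx
      rw [this]
      exact zero_mem _

/-! ### The flat replacement as a cone. -/

section Replacement

variable [Fact p.Prime]

/-- The cone of the inclusion of the kernel of the cover, which resolves the given complex. -/
def replacementObj (X : QPComplex p) : QPComplex p := cone (kernelι ((coverπ p).app X))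

variable (p) in
/-- A functorial flat replacement. -/
def replacement : QPComplex p ⥤ QPComplex p where
  obj X := replacementObj X
  map f := coneMap (kernelMap ((cover p).map f) f ((coverπ p).naturality f).symm) ((cover p).map f) rfl
  map_id X := by
    refine hom_ext fun x => ?_
    have : (cover p).map (𝟙 X) = 𝟙 _ := (cover p).map_id X
    refine Prod.ext (Subtype.ext ?_) ?_
    · exact congrArg (fun g : (cover p).obj X ⟶ (cover p).obj X => g.toLin x.1.1) this
    · exact congrArg (fun g : (cover p).obj X ⟶ (cover p).obj X => g.toLin x.2) this
  map_comp {X Y Z} f g := by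
    refine hom_ext fun x => ?_
    have : (cover p).map (f ≫ g) = (cover p).map f ≫ (cover p).map g := (cover p).map_comp f g
    refine Prod.ext (Subtype.ext ?_) ?_
    · exact congrArg (fun g : (cover p).obj X ⟶ (cover p).obj Z => g.toLin x.1.1) this
    · exact congrArg (fun g : (cover p).obj X ⟶ (cover p).obj Z => g.toLin x.2) this

/-- The projection from the flat replacement. -/
def replacementπApp (X : QPComplex p) : replacementObj X ⟶ X :=
  coneDesc _ 0 ((coverπ p).app X) (fun _ _ _ => zero_mem _) (fun x => by
    rw [LinearMap.zero_apply, map_zero, LinearMap.restrictScalars_zero, LinearMap.lTensor_zero,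
      LinearMap.zero_apply]) (fun x => by
    rw [LinearMap.zero_apply, LinearMap.zero_apply, map_zero, add_zero]
    exact x.2)

lemma replacementπApp_apply (X : QPComplex p)
    (x : (kernel ((coverπ p).app X)).carrier × ((cover p).obj X).carrier) :
    (replacementπApp X).toLin x = ((coverπ p).app X).toLin x.2 := by
  refine (LinearMap.coprod_apply _ _ _).trans ?_
  rw [LinearMap.zero_apply, zero_add]

variable (p) in
/-- The quasi-isomorphism from the flat replacement. -/
def replacementπ : replacement p ⟶ 𝟭 (QPComplex p) where
  app X := replacementπApp X
  naturality X Y f := by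
    refine hom_ext fun x => ?_
    refine (replacementπApp_apply Y _).trans (Eq.trans ?_
      (congrArg f.toLin (replacementπApp_apply X x).symm))
    exact congrArg (fun g : (cover p).obj X ⟶ Y => g.toLin x.2) ((coverπ p).naturality f)

lemma isFlat_replacement (X : QPComplex p) : isFlat p ((replacement p).obj X) :=
  isFlat_cone _ (isFlat_kernel _ (CoeffFamily.isFlat_discs _)) (CoeffFamily.isFlat_discs _)

/-- The cone of an injective map is quasi-isomorphic to its cokernel, and the cokernel of the kernel
of a surjection `ε` is its target. Lifts along `ε` give the witnesses: their defects lie in the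
kernel and become first coordinates in the cone. -/
lemma quasiIso_replacementπ (X : QPComplex p) : quasiIso p ((replacementπ p).app X) := by
  set ε := (coverπ p).app X
  have key : ∀ x, ((replacementπ p).app X).toLin x = ε.toLin x.2 := replacementπApp_apply X
  rw [quasiIso_iff]
  refine ⟨fun x hx y hy => ?_, fun y hy => ?_⟩
  · obtain ⟨w, rfl⟩ := coverπ_surjective X y
    have hx2 : x.1.1 + ((cover p).obj X).d x.2 = 0 := congrArg Prod.snd hx
    have hk : x.2 - ((cover p).obj X).d w ∈ LinearMap.ker ε.toLin := by
      rw [LinearMap.mem_ker, map_sub, ε.map_d, sub_eq_zero, ← key]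
      exact hy.symm
    refine ⟨(⟨_, hk⟩, w), Prod.ext (Subtype.ext ?_) ?_⟩
    · change -((cover p).obj X).d (x.2 - ((cover p).obj X).d w) = x.1.1
      rw [map_sub, ((cover p).obj X).d_d, sub_zero, neg_eq_iff_add_eq_zero, add_comm, hx2]
    · change (x.2 - ((cover p).obj X).d w) + ((cover p).obj X).d w = x.2
      rw [sub_add_cancel]
  · obtain ⟨u, rfl⟩ := coverπ_surjective X y
    have hk : -((cover p).obj X).d u ∈ LinearMap.ker ε.toLin := by
      rw [LinearMap.mem_ker, map_neg, ε.map_d, neg_eq_zero]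
      exact hy
    refine ⟨(⟨_, hk⟩, u), 0, Prod.ext (Subtype.ext ?_) ?_, ?_⟩
    · change -((cover p).obj X).d (-((cover p).obj X).d u) = 0
      rw [map_neg, ((cover p).obj X).d_d, neg_zero, neg_zero]
    · change -((cover p).obj X).d u + ((cover p).obj X).d u = 0
      rw [neg_add_cancel]
    · rw [map_zero, add_zero]
      exact key _

end Replacement

end QPComplex

/-! ### The tensor product of a flat complex with a flat acyclic complex. Differentials on tensors
have the form `δ ⊗ 1 + σ ⊗ d`, where `σ` is the sign operator. -/

section Acyclic

variable {R M N B I Z : Type} [CommRing R] [AddCommGroup M] [AddCommGroup N] [Module R M]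
  [Module R N] [AddCommGroup B] [AddCommGroup I] [AddCommGroup Z] [Module R B] [Module R I]
  [Module R Z]

lemma map_neg_left (f : M →ₗ[R] I) (g : N →ₗ[R] B) (t : M ⊗[R] N) :
    TensorProduct.map (-f) g t = -TensorProduct.map f g t := by
  rw [← neg_one_smul R f, TensorProduct.map_smul_left, LinearMap.smul_apply, neg_one_smul]

/-- A cycle of a tensor product of complexes can be moved into the tensor product
with the cycles of the second factor. -/
lemma exists_tensor_cycle {δ σ : M →ₗ[R] M} {d : N →ₗ[R] N}
    (hσ : σ ∘ₗ σ = LinearMap.id) (hδσ : δ ∘ₗ σ = -(σ ∘ₗ δ)) {j : B →ₗ[R] N} {q : N →ₗ[R] B}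
    (hjq : j ∘ₗ q = d) (hdd : d ∘ₗ d = 0) (hq : Function.Surjective q)
    (hex : Function.Exact j q)
    (hj : Function.Injective (TensorProduct.map (LinearMap.id : M →ₗ[R] M) j))
    {δ' : M →ₗ[R] I} {i : I →ₗ[R] M} (hiδ : i ∘ₗ δ' = δ) (hδ' : Function.Surjective δ')
    (hi : Function.Injective (TensorProduct.map i (LinearMap.id : B →ₗ[R] B)))
    (w : M ⊗[R] N)
    (hw : TensorProduct.map δ LinearMap.id w + TensorProduct.map σ d w = 0) :
    ∃ w' : M ⊗[R] N, TensorProduct.map δ q w' = TensorProduct.map LinearMap.id q w := by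
  have hD : TensorProduct.map δ d w = 0 := by
    have := congrArg (TensorProduct.map (LinearMap.id : M →ₗ[R] M) d) hw
    simpa only [map_add, TensorProduct.map_map, LinearMap.id_comp, LinearMap.comp_id, hdd, map_zero,
      TensorProduct.map_zero_right, LinearMap.zero_apply, add_zero] using this
  have hb : TensorProduct.map δ q w = 0 := hj <| by
    rw [TensorProduct.map_map, LinearMap.id_comp, hjq, hD, map_zero]
  -- Here `I` plays the role of the image of `δ`. Since `(δ ⊗ q) w` vanishes, `-(δ' ⊗ 1) w` comes
  -- from `I ⊗ B`; injectivity of `I ⊗ B → M ⊗ B` is used to see this.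
  obtain ⟨k, hk⟩ := (lTensor_exact I hex hq
    (-TensorProduct.map δ' LinearMap.id w)).mp <| hi <| by
      rw [LinearMap.lTensor, map_neg, map_neg, map_zero, TensorProduct.map_map,
        TensorProduct.map_map, neg_eq_zero, LinearMap.comp_id, hiδ, LinearMap.id_comp,
        LinearMap.comp_id, hb]
  rw [LinearMap.lTensor] at hk
  -- Both sides have image `-(δ ⊗ 1) w` in `M ⊗ N`, the right one by the cycle condition. So `(σ ⊗
  -- q) w` is a boundary of `M ⊗ B`; what remains is to remove `σ`, which anticommutes with `δ`.
  have hk' : TensorProduct.map i LinearMap.id k = TensorProduct.map σ q w := hj <| by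
    have := congrArg (TensorProduct.map i (LinearMap.id : N →ₗ[R] N)) hk
    rw [map_neg, TensorProduct.map_map, TensorProduct.map_map, LinearMap.id_comp, LinearMap.comp_id,
      LinearMap.id_comp, hiδ] at this
    rw [TensorProduct.map_map, TensorProduct.map_map, LinearMap.id_comp, LinearMap.comp_id,
      LinearMap.id_comp, hjq, this, neg_eq_iff_add_eq_zero, hw]
  obtain ⟨b, rfl⟩ := LinearMap.rTensor_surjective B hδ' k
  rw [LinearMap.rTensor, TensorProduct.map_map, hiδ, LinearMap.id_comp] at hk'
  obtain ⟨w', hw'⟩ := LinearMap.lTensor_surjective M hq (-TensorProduct.map σ LinearMap.id b)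
  rw [LinearMap.lTensor] at hw'
  have h2 := congrArg (TensorProduct.map δ (LinearMap.id : B →ₗ[R] B)) hw'
  have h3 := congrArg (TensorProduct.map σ (LinearMap.id : B →ₗ[R] B)) hk'
  rw [TensorProduct.map_map, TensorProduct.map_map, hσ, LinearMap.id_comp, LinearMap.id_comp] at h3
  rw [map_neg, TensorProduct.map_map, TensorProduct.map_map, hδσ, LinearMap.id_comp,
    LinearMap.id_comp, LinearMap.comp_id, map_neg_left, neg_neg] at h2
  exact ⟨w', h2.trans h3⟩

/-- Boundaries for cycles in the tensor product with the cycles of the second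
factor. -/
lemma exists_boundary_of_cycle {δ σ : M →ₗ[R] M} {d : N →ₗ[R] N}
    (hσ : σ ∘ₗ σ = LinearMap.id) (hδσ : δ ∘ₗ σ = -(σ ∘ₗ δ)) {j : B →ₗ[R] N} {q : N →ₗ[R] B}
    (hjq : j ∘ₗ q = d) (hdj : d ∘ₗ j = 0) (hq : Function.Surjective q)
    (hj : Function.Injective (TensorProduct.map (LinearMap.id : M →ₗ[R] M) j))
    {κ : Z →ₗ[R] M} (hδκ : δ ∘ₗ κ = 0)
    (hex : Function.Exact (TensorProduct.map κ (LinearMap.id : B →ₗ[R] B))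
      (TensorProduct.map δ (LinearMap.id : B →ₗ[R] B)))
    (v : M ⊗[R] B)
    (hv : TensorProduct.map δ LinearMap.id (TensorProduct.map LinearMap.id j v) +
      TensorProduct.map σ d (TensorProduct.map LinearMap.id j v) = 0) :
    ∃ u, TensorProduct.map δ LinearMap.id u + TensorProduct.map σ d u =
      TensorProduct.map LinearMap.id j v := by
  have hδv : TensorProduct.map δ LinearMap.id v = 0 := hj <| by
    simpa only [TensorProduct.map_map, hdj, LinearMap.id_comp, LinearMap.comp_id,
      TensorProduct.map_zero_right, LinearMap.zero_apply, add_zero, map_zero] using hv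
  obtain ⟨v, rfl⟩ := (hex v).mp hδv
  obtain ⟨c, rfl⟩ := LinearMap.lTensor_surjective _ hq v
  -- The factor `σ` in the witness cancels the sign in `σ ⊗ d`, and the term with `δ` vanishes
  -- because `κ` takes values in cycles.
  refine ⟨TensorProduct.map (σ ∘ₗ κ) LinearMap.id c, ?_⟩
  have h3 : δ ∘ₗ σ ∘ₗ κ = 0 := by
    rw [← LinearMap.comp_assoc, hδσ, LinearMap.neg_comp, LinearMap.comp_assoc, hδκ,
      LinearMap.comp_zero, neg_zero]
  have h4 : σ ∘ₗ σ ∘ₗ κ = κ := by rw [← LinearMap.comp_assoc, hσ, LinearMap.id_comp]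
  simp only [LinearMap.lTensor, TensorProduct.map_map, h3, h4, TensorProduct.map_zero_left,
    LinearMap.zero_apply, LinearMap.id_comp, LinearMap.comp_id, zero_add, hjq]

/-- The tensor product of a flat complex with an acyclic complex with flat cycles is acyclic. -/
lemma exists_tensor_boundary {δ σ : M →ₗ[R] M} {d : N →ₗ[R] N} (hδ : δ ∘ₗ δ = 0)
    (hσ : σ ∘ₗ σ = LinearMap.id) (hδσ : δ ∘ₗ σ = -(σ ∘ₗ δ)) (hdd : d ∘ₗ d = 0)
    {j : B →ₗ[R] N} {q : N →ₗ[R] B} (hjq : j ∘ₗ q = d) (hinj : Function.Injective j)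
    (hq : Function.Surjective q) (hex : Function.Exact j q) [Module.Flat R M] [Module.Flat R B]
    (w : M ⊗[R] N)
    (hw : TensorProduct.map δ LinearMap.id w + TensorProduct.map σ d w = 0) :
    ∃ u, TensorProduct.map δ LinearMap.id u + TensorProduct.map σ d u = w := by
  have hqj : q ∘ₗ j = 0 := LinearMap.ext fun x => hex.apply_apply_eq_zero x
  have hdj : d ∘ₗ j = 0 := by rw [← hjq, LinearMap.comp_assoc, hqj, LinearMap.comp_zero]
  have hqd : q ∘ₗ d = 0 := by rw [← hjq, ← LinearMap.comp_assoc, hqj, LinearMap.zero_comp]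
  have hj : Function.Injective (TensorProduct.map (LinearMap.id : M →ₗ[R] M) j) :=
    Module.Flat.lTensor_preserves_injective_linearMap j hinj
  have hi : Function.Injective (TensorProduct.map (LinearMap.range δ).subtype
      (LinearMap.id : B →ₗ[R] B)) :=
    Module.Flat.rTensor_preserves_injective_linearMap _ (Submodule.subtype_injective _)
  -- Injectivity of the connecting map for `0 → B → N → B → 0`: the image of the cycle `w` in `M ⊗
  -- B` is a boundary, so subtracting the boundary of `w'` moves `w` into the image of `M ⊗ B`.
  obtain ⟨w', h1⟩ := exists_tensor_cycle hσ hδσ hjq hdd hq hex hj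
    (LinearMap.ext fun _ => rfl : (LinearMap.range δ).subtype ∘ₗ δ.rangeRestrict = δ)
    δ.surjective_rangeRestrict hi w hw
  have hDD : TensorProduct.map δ LinearMap.id (TensorProduct.map δ LinearMap.id w' +
      TensorProduct.map σ d w') + TensorProduct.map σ d (TensorProduct.map δ LinearMap.id w' +
      TensorProduct.map σ d w') = 0 := by
    have : TensorProduct.map (δ ∘ₗ σ) d w' = - TensorProduct.map (σ ∘ₗ δ) d w' := by
      rw [hδσ, map_neg_left]
    simp only [map_add, TensorProduct.map_map, hδ, hdd, TensorProduct.map_zero_left,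
      TensorProduct.map_zero_right, LinearMap.zero_apply, LinearMap.id_comp, LinearMap.comp_id, this]
    abel
  obtain ⟨v, hv⟩ := (lTensor_exact M hex hq (w - (TensorProduct.map δ LinearMap.id w' +
      TensorProduct.map σ d w'))).mp <| by
    simp only [LinearMap.lTensor, map_sub, map_add, TensorProduct.map_map, hqd, LinearMap.id_comp,
      LinearMap.comp_id, TensorProduct.map_zero_right, LinearMap.zero_apply, h1, add_zero, sub_self]
  rw [LinearMap.lTensor] at hv
  -- Surjectivity of the connecting map. Flatness of `B` identifies the cycles of `M ⊗ B` with the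
  -- image of `ker δ ⊗ B`.
  obtain ⟨u, hu⟩ := exists_boundary_of_cycle hσ hδσ hjq hdj hq hj
    (LinearMap.ext fun x => x.2 : δ ∘ₗ (LinearMap.ker δ).subtype = 0)
    (Module.Flat.rTensor_exact B δ.exact_subtype_ker_map) v (by
      rw [hv, map_sub, map_sub, sub_add_sub_comm, hDD, hw, sub_zero])
  refine ⟨w' + u, ?_⟩
  rw [map_add, map_add, add_add_add_comm, hu, hv, add_sub_cancel]

/-- A tensor product with the mapping cone of `f` is the mapping cone of the tensor product with `f`:
acyclicity of the first gives that of the second. -/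
lemma exists_tensor_cone_boundary {δ σ : M →ₗ[R] M} {dB : B →ₗ[R] B} {dI : I →ₗ[R] I} {f : B →ₗ[R] I}
    {e : B × I →ₗ[R] B × I} (he₁ : LinearMap.fst R B I ∘ₗ e = -(dB ∘ₗ LinearMap.fst R B I))
    (he₂ : LinearMap.snd R B I ∘ₗ e = f ∘ₗ LinearMap.fst R B I + dI ∘ₗ LinearMap.snd R B I)
    (hσ : σ ∘ₗ σ = LinearMap.id) (hδσ : δ ∘ₗ σ = -(σ ∘ₗ δ))
    (h : ∀ w : M ⊗[R] (B × I), TensorProduct.map δ LinearMap.id w + TensorProduct.map σ e w = 0 →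
      ∃ u, TensorProduct.map δ LinearMap.id u + TensorProduct.map σ e u = w)
    (t : M ⊗[R] B) (s : M ⊗[R] I)
    (ht : TensorProduct.map δ LinearMap.id t + TensorProduct.map σ dB t = 0)
    (hs : TensorProduct.map LinearMap.id f t +
      (TensorProduct.map δ LinearMap.id s + TensorProduct.map σ dI s) = 0) :
    ∃ (u : M ⊗[R] B) (v : M ⊗[R] I),
      -(TensorProduct.map δ LinearMap.id u + TensorProduct.map σ dB u) = t ∧
      TensorProduct.map LinearMap.id f u +
        (TensorProduct.map δ LinearMap.id v + TensorProduct.map σ dI v) = s := by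
  have hl : e ∘ₗ LinearMap.inl R B I = -(LinearMap.inl R B I ∘ₗ dB) + LinearMap.inr R B I ∘ₗ f := by
    refine LinearMap.ext fun x => Prod.ext ?_ ?_
    · simpa using LinearMap.congr_fun he₁ (x, 0)
    · simpa using LinearMap.congr_fun he₂ (x, 0)
  have hr : e ∘ₗ LinearMap.inr R B I = LinearMap.inr R B I ∘ₗ dI := by
    refine LinearMap.ext fun x => Prod.ext ?_ ?_
    · simpa using LinearMap.congr_fun he₁ (0, x)
    · simpa using LinearMap.congr_fun he₂ (0, x)
  -- The identification of the cone of `1 ⊗ f` with `M` tensored with the cone of `f` carries `σ` on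
  -- the shifted summand, since the shift has to pass `M`.
  obtain ⟨w, hw⟩ := h (TensorProduct.map σ (LinearMap.inl R B I) t +
    TensorProduct.map LinearMap.id (LinearMap.inr R B I) s) (by
      have h1 := congrArg (TensorProduct.map σ (LinearMap.inl R B I)) ht
      have h2 := congrArg (TensorProduct.map (LinearMap.id : M →ₗ[R] M) (LinearMap.inr R B I)) hs
      simp only [map_add, TensorProduct.map_map, map_zero, LinearMap.id_comp, LinearMap.comp_id, hσ]
        at h1 h2
      simp only [map_add, TensorProduct.map_map, LinearMap.id_comp, LinearMap.comp_id, hσ, hl, hr,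
        hδσ, map_neg_left, TensorProduct.map_add_right, LinearMap.add_apply]
      rw [← neg_one_smul R (LinearMap.inl R B I ∘ₗ dB), TensorProduct.map_smul_right,
        LinearMap.smul_apply, neg_one_smul, eq_neg_of_add_eq_zero_left h1, ← h2]
      abel)
  have h1 := congrArg (TensorProduct.map σ (LinearMap.fst R B I)) hw
  have h2 := congrArg (TensorProduct.map (LinearMap.id : M →ₗ[R] M) (LinearMap.snd R B I)) hw
  simp only [map_add, TensorProduct.map_map, LinearMap.id_comp, LinearMap.comp_id, hσ, he₁, he₂,
    LinearMap.fst_comp_inl, LinearMap.fst_comp_inr, LinearMap.snd_comp_inl, LinearMap.snd_comp_inr,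
    TensorProduct.map_zero_right, LinearMap.zero_apply, add_zero, zero_add, TensorProduct.map_id,
    LinearMap.id_apply, TensorProduct.map_add_right, LinearMap.add_apply] at h1 h2
  refine ⟨TensorProduct.map σ (LinearMap.fst R B I) w,
    TensorProduct.map LinearMap.id (LinearMap.snd R B I) w, ?_, ?_⟩
  · rw [← h1, ← neg_one_smul R (dB ∘ₗ LinearMap.fst R B I), TensorProduct.map_smul_right,
      LinearMap.smul_apply, neg_one_smul]
    simp only [TensorProduct.map_map, LinearMap.id_comp, hσ, hδσ, map_neg_left]
    abel
  · rw [← h2]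
    simp only [TensorProduct.map_map, LinearMap.id_comp, LinearMap.comp_id]
    abel

end Acyclic

/-! ### Tensor products of flat complexes preserve quasi-isomorphisms. -/

namespace QPComplex

variable {p : ℕ}

lemma sgn_comp_sgn (X : QPComplex p) : X.sgn ∘ₗ X.sgn = LinearMap.id := by
  refine LinearMap.ext fun x => ?_
  rw [LinearMap.comp_apply, LinearMap.id_apply]
  induction x using gr_induction X.isInternal with
  | zero => simp
  | add x y hx hy => simp only [map_add, hx, hy]
  | mem i x hx =>
    rw [X.sgn_of_mem hx, map_zsmul, X.sgn_of_mem hx]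
    split_ifs <;> simp

lemma d_comp_sgn (X : QPComplex p) : X.d ∘ₗ X.sgn = -(X.sgn ∘ₗ X.d) := by
  refine LinearMap.ext fun x => ?_
  rw [LinearMap.comp_apply, LinearMap.neg_apply, LinearMap.comp_apply]
  induction x using gr_induction X.isInternal with
  | zero => simp
  | add x y hx hy => simp only [map_add, hx, hy, neg_add]
  | mem i x hx =>
    rw [X.sgn_of_mem hx, X.sgn_of_mem (X.d_mem i x hx), map_zsmul]
    have h : Even (i + (1, 0) : ℤ × ℤ).1 ↔ ¬ Even i.1 := Int.even_add_one
    by_cases h' : Even i.1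
    · rw [if_pos h', if_neg fun h'' => h.mp h'' h']
      simp
    · rw [if_neg h', if_pos (h.mpr h')]
      simp

lemma d_comp_d (X : QPComplex p) : X.d ∘ₗ X.d = 0 := LinearMap.ext X.d_d

/-- The differential as a morphism to the shift. -/
def dHom (X : QPComplex p) : X ⟶ shift X where
  toLin := X.d
  map_mem := X.d_mem
  map_d :=
    have h : ∀ x, X.d (X.d x) = -X.d (X.d x) := fun x => by rw [X.d_d, neg_zero]
    h
  map_coaction := X.coaction_d

variable [Fact p.Prime]

lemma flat_PE (X : QPComplex p) (hX : isFlat p X) : Module.Flat (PE p) X.carrier :=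
  X.isGradedModule.flat_PE ((isFlat_iff_torsionFree X).mp hX)

/-- The cycles of `Y` are the kernel of `d`, viewed as a morphism to the shift. As such they form a
flat complex and are flat over `E(1)_*[τ, τ⁻¹]`, so `exists_tensor_boundary` applies; acyclicity
makes `d` surjective onto them. -/
lemma tensorObj_acyclic (X Y : QPComplex p) (hX : isFlat p X) (hY : isFlat p Y)
    (h : ∀ y, Y.d y = 0 → ∃ z, Y.d z = y) (w : X.carrier ⊗[PE p] Y.carrier)
    (hw : tensorD X Y w = 0) : ∃ u, tensorD X Y u = w := by
  have := X.flat_PE hX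
  have : Module.Flat (PE p) (LinearMap.ker Y.d) := (kernel Y.dHom).flat_PE (isFlat_kernel _ hY)
  exact exists_tensor_boundary (j := (LinearMap.ker Y.d).subtype)
    (q := Y.d.codRestrict (LinearMap.ker Y.d) Y.d_d) X.d_comp_d X.sgn_comp_sgn X.d_comp_sgn
    Y.d_comp_d (LinearMap.ext fun _ => rfl) (Submodule.subtype_injective _)
    (fun x => (h x.1 x.2).imp fun y hy => Subtype.ext hy)
    (fun x => ⟨fun hx => ⟨⟨x, congrArg Subtype.val hx⟩, rfl⟩,
      by rintro ⟨y, rfl⟩; exact Subtype.ext y.2⟩) w hw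

/-- The cone of `f` is flat and acyclic, and tensoring it with `Z` gives the cone of `1 ⊗ f` up to
signs. -/
lemma quasiIso_tensorMap_id (Z : QPComplex p) {X Y : QPComplex p} (f : X ⟶ Y) (hZ : isFlat p Z)
    (hX : isFlat p X) (hY : isFlat p Y) (hf : quasiIso p f) : quasiIso p (tensorMap (𝟙 Z) f) := by
  rw [quasiIso_iff_cone, cone_acyclic_iff]
  exact exists_tensor_cone_boundary (e := (cone f).d) (LinearMap.ext fun _ => rfl)
    (LinearMap.ext fun _ => rfl) Z.sgn_comp_sgn Z.d_comp_sgn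
    (tensorObj_acyclic Z (cone f) hZ (isFlat_cone f hX hY) ((quasiIso_iff_cone f).mp hf))

omit [Fact p.Prime] in
lemma quasiIso_of_isIso {X Y : QPComplex p} (f : X ⟶ Y) [IsIso f] : quasiIso p f := by
  have h1 : ∀ x, (inv f).toLin (f.toLin x) = x := fun x =>
    congrArg (fun g : X ⟶ X => Hom.toLin g x) (IsIso.hom_inv_id f)
  have h2 : ∀ y, f.toLin ((inv f).toLin y) = y := fun y =>
    congrArg (fun g : Y ⟶ Y => Hom.toLin g y) (IsIso.inv_hom_id f)
  rw [quasiIso_iff]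
  refine ⟨fun x _ y hy => ⟨(inv f).toLin y, ?_⟩, fun y hy => ⟨(inv f).toLin y, 0, ?_, ?_⟩⟩
  · rw [← (inv f).map_d, hy, h1]
  · rw [← (inv f).map_d, hy, map_zero]
  · rw [h2, map_zero, add_zero]

/-- Multiplication by `p` on the tensor product is `p ⊗ 1`, which stays injective because `Y` is
flat over `E(1)_*[τ, τ⁻¹]`. -/
lemma isFlat_tensorObj {X Y : QPComplex p} (hX : isFlat p X) (hY : isFlat p Y) :
    isFlat p (tensorObj X Y) := by
  have := Y.flat_PE hY
  rw [isFlat_iff_torsionFree] at hX ⊢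
  let m : X.carrier →ₗ[PE p] X.carrier := LinearMap.lsmul (PE p) X.carrier (p : PE p)
  have hm : ∀ x, m x = p • x := fun x => Nat.cast_smul_eq_nsmul (PE p) p x
  have hinj : Function.Injective m := by
    rw [injective_iff_map_eq_zero]
    intro x hx
    exact hX x (by rw [← hm, hx])
  have key : ∀ t : X.carrier ⊗[PE p] Y.carrier, m.rTensor Y.carrier t = p • t := fun t => by
    induction t using TensorProduct.induction_on with
    | zero => simp
    | add x y hx hy => rw [map_add, hx, hy, smul_add]
    | tmul x y => rw [LinearMap.rTensor_tmul, hm, TensorProduct.smul_tmul']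
  have h : ∀ t : X.carrier ⊗[PE p] Y.carrier, p • t = 0 → t = 0 := fun t ht => by
    rw [← key] at ht
    exact Module.Flat.rTensor_preserves_injective_linearMap m hinj (ht.trans (map_zero _).symm)
  exact h

lemma isFlat_unit : isFlat p (unit p) := by
  rw [isFlat_iff_torsionFree]
  have h : ∀ x : PE p, p • x = 0 → x = 0 := fun x hx => by
    ext e : 1
    exact LaurentZ_torsionFree (p := p) _ ((coeff_nsmul p x e).symm.trans
      (congrArg (fun y : PE p => y.coeff e) hx))
  exact h

instance : (isFlat p).IsMonoidal where
  prop_unit := isFlat_unit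
  prop_tensor _ _ hX hY := isFlat_tensorObj hX hY

instance : ((quasiIso p).inverseImage (isFlat p).ι).IsMonoidal where
  whiskerLeft Z X Y f hf := quasiIso_tensorMap_id Z.obj f.hom Z.property X.property Y.property hf
  whiskerRight {X Y} f hf Z := by
    -- The symmetry reduces right whiskering to left whiskering.
    have h : (quasiIso p) ((f.hom ▷ Z.obj) ≫ (β_ Y.obj Z.obj).hom) := by
      rw [BraidedCategory.braiding_naturality_left]
      exact (quasiIso p).comp_mem _ _ (quasiIso_of_isIso _)
        (quasiIso_tensorMap_id Z.obj f.hom Z.property X.property Y.property hf)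
    exact (quasiIso p).of_postcomp _ _ (quasiIso_of_isIso _) h

end QPComplex

/-! ### Cylinders and homotopies. -/

namespace QPComplex

variable {p : ℕ}

section DirectSum

variable (X : QPComplex p) {Y : QPComplex p}

/-- The zero twist. -/
def zeroTwist : Twist X X where
  map := 0
  map_mem _ _ _ := zero_mem _
  map_d _ := by simp
  map_coaction _ := by
    rw [LinearMap.zero_apply, map_zero, LinearMap.restrictScalars_zero, LinearMap.lTensor_zero,
      LinearMap.zero_apply]

/-- The direct sum of two copies of a complex. -/
def double : QPComplex p := twisted (zeroTwist X)

variable {X}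

/-- The morphism from the direct sum of two copies of a complex with the given components. -/
def doubleDesc (f g : X ⟶ Y) : double X ⟶ Y where
  toLin := f.toLin.coprod g.toLin
  map_mem i _ hx := add_mem (f.map_mem i _ hx.1) (g.map_mem i _ hx.2)
  map_d :=
    have key : ∀ x : X.carrier × X.carrier,
        f.toLin (X.d x.1) + g.toLin (0 + X.d x.2) = Y.d (f.toLin x.1 + g.toLin x.2) := fun x => by
      rw [zero_add, map_add, f.map_d, g.map_d]
    key
  map_coaction x := CoactionCompat.coprod f.map_coaction g.map_coaction x

variable (X)

/-- The linear map `x ↦ a x`, for an integer `a`. -/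
def zsmulLin (a : ℤ) : X.carrier →ₗ[PE p] X.carrier where
  toFun x := a • x
  map_add' := smul_add a
  map_smul' b x := smul_comm a b x

lemma coactionCompat_zsmulLin (a : ℤ) :
    CoactionCompat X.coaction X.coaction (X.zsmulLin a) := fun x => by
  have key : ∀ t : EE p ⊗[E1 p] X.carrier,
      ((X.zsmulLin a).restrictScalars (E1 p)).lTensor (EE p) t = a • t := fun t => by
    induction t using TensorProduct.induction_on with
    | zero => simp
    | add x y hx hy => rw [map_add, hx, hy, smul_add]
    | tmul g m => exact (map_zsmul (TensorProduct.mk (E1 p) (EE p) X.carrier g) a m)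
  exact (map_zsmul X.coaction.toHom a x).trans (key _).symm

/-- The morphism `x ↦ (a x, b x)` for integers `a` and `b`. -/
def toDouble (a b : ℤ) : X ⟶ double X where
  toLin := (X.zsmulLin a).prod (X.zsmulLin b)
  map_mem i _ hx := ⟨zsmul_mem hx a, zsmul_mem hx b⟩
  map_d :=
    have key : ∀ x : X.carrier, (a • X.d x, b • X.d x) = (X.d (a • x), 0 + X.d (b • x)) := fun x => by
      rw [map_zsmul, map_zsmul, zero_add]
    key
  map_coaction x := CoactionCompat.prod (X.coactionCompat_zsmulLin a) (X.coactionCompat_zsmulLin b) x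

end DirectSum

section Cylinder

variable (X : QPComplex p) {Y : QPComplex p}

/-- The inclusion of the target in the cone. -/
def coneInr {X Y : QPComplex p} (f : X ⟶ Y) : Y ⟶ cone f where
  toLin := LinearMap.inr (PE p) X.carrier Y.carrier
  map_mem _ _ hx := ⟨zero_mem _, hx⟩
  map_d :=
    have key : ∀ y : Y.carrier, ((0, Y.d y) : X.carrier × Y.carrier) =
        (-X.d 0, f.toLin 0 + Y.d y) := fun y => by
      rw [map_zero, map_zero, neg_zero, zero_add]
    key
  map_coaction y := by
    have := prodCoaction_apply X.coaction Y.coaction (0, y)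
    rw [map_zero, map_zero, zero_add] at this
    exact this

/-- The cylinder of a complex. -/
def cylinder : QPComplex p := cone (toDouble X 1 (-1))

variable {X}

/-- The morphism from the cylinder that is given by a homotopy. -/
def cylinderDesc (f g : X ⟶ Y) (h : X.carrier →ₗ[PE p] Y.carrier)
    (h_mem : ∀ i x, x ∈ X.grading i → h x ∈ Y.grading (i - (1, 0)))
    (h_coaction : CoactionCompat X.coaction Y.coaction h)
    (hd : ∀ x, f.toLin x - g.toLin x = Y.d (h x) + h (X.d x)) : cylinder X ⟶ Y :=
  have key : ∀ x : X.carrier, f.toLin ((1 : ℤ) • x) + g.toLin ((-1 : ℤ) • x) =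
      Y.d (h x) + h (X.d x) := fun x => by
    rw [one_smul, neg_one_smul, map_neg, ← sub_eq_add_neg, hd]
  coneDesc _ h (doubleDesc f g)
    (fun i x hx => by have := h_mem _ x hx; rwa [add_sub_cancel_right] at this) h_coaction key

/-- The projection of the cylinder. -/
def cylinderπ (X : QPComplex p) : cylinder X ⟶ X :=
  cylinderDesc (𝟙 X) (𝟙 X) 0 (fun _ _ _ => zero_mem _)
    (fun _ => by
      rw [LinearMap.zero_apply, map_zero, LinearMap.restrictScalars_zero, LinearMap.lTensor_zero,
        LinearMap.zero_apply])
    fun _ => by simp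

/-- The two ends of the cylinder, indexed by the two pairs `(1, 0)` and `(0, 1)`. -/
def cylinderEnd (X : QPComplex p) (a b : ℤ) : X ⟶ cylinder X := toDouble X a b ≫ coneInr _

lemma cylinderEnd_desc (f g : X ⟶ Y) (h : X.carrier →ₗ[PE p] Y.carrier)
    (h_mem : ∀ i x, x ∈ X.grading i → h x ∈ Y.grading (i - (1, 0)))
    (h_coaction : CoactionCompat X.coaction Y.coaction h)
    (hd : ∀ x, f.toLin x - g.toLin x = Y.d (h x) + h (X.d x)) (a b : ℤ) (x : X.carrier) :
    (cylinderEnd X a b ≫ cylinderDesc f g h h_mem h_coaction hd).toLin x =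
      a • f.toLin x + b • g.toLin x := by
  change h 0 + (f.toLin (a • x) + g.toLin (b • x)) = _
  rw [map_zero, zero_add, map_zsmul, map_zsmul]

lemma cylinderEnd_π (X : QPComplex p) :
    cylinderEnd X 1 0 ≫ cylinderπ X = cylinderEnd X 0 1 ≫ cylinderπ X := by
  have h : ∀ x : X.carrier, (0 : X.carrier) + ((1 : ℤ) • x + (0 : ℤ) • x) =
    0 + ((0 : ℤ) • x + (1 : ℤ) • x) := fun x => by simp
  exact Hom.ext (LinearMap.ext h)

/-- The cylinder is the cone of the injective map `x ↦ (x, -x)`, whose cokernel is `X` by way of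
`(a, b) ↦ a + b`. For a cycle `(x, (a, b))` with `a + b = d y` the element `(a, (0, y))` is an
explicit bounding element. -/
lemma quasiIso_cylinderπ (X : QPComplex p) : quasiIso p (cylinderπ X) := by
  rw [quasiIso_iff]
  have h1 : ∀ x a b y : X.carrier, (1 : ℤ) • x + X.d a = 0 → (-1 : ℤ) • x + (0 + X.d b) = 0 →
      X.d y = 0 + (a + b) → -X.d a = x ∧ (1 : ℤ) • a + X.d 0 = a ∧
        (-1 : ℤ) • a + (0 + X.d y) = b := fun x a b y ha _ hy => by
    refine ⟨?_, ?_, ?_⟩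
    · rw [neg_eq_iff_add_eq_zero, add_comm, ← ha, one_smul]
    · rw [map_zero, add_zero, one_smul]
    · rw [hy, neg_one_smul]
      abel
  have h2 : ∀ y : X.carrier, X.d y = 0 → (cylinder X).d (0, (y, 0)) = 0 := fun y hy => by
    refine Prod.ext ?_ (Prod.ext ?_ ?_)
    · exact (congrArg Neg.neg (map_zero X.d)).trans neg_zero
    · have : (1 : ℤ) • (0 : X.carrier) + X.d y = 0 := by rw [hy, smul_zero, add_zero]
      exact this
    · have : (-1 : ℤ) • (0 : X.carrier) + (0 + X.d 0) = 0 := by simp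
      exact this
  refine ⟨fun z hz y hy => ?_, fun y hy => ⟨(0, (y, 0)), 0, h2 y hy, ?_⟩⟩
  · obtain ⟨e1, e2, e3⟩ := h1 z.1 z.2.1 z.2.2 y (congrArg (fun w => w.2.1) hz)
      (congrArg (fun w => w.2.2) hz) hy
    exact ⟨(z.2.1, (0, y)), Prod.ext e1 (Prod.ext e2 e3)⟩
  · have : (0 : X.carrier) + (y + 0) = y + X.d 0 := by simp
    exact this

lemma isFlat_cylinder [Fact p.Prime] (hX : isFlat p X) : isFlat p (cylinder X) :=
  isFlat_cone _ hX (isFlat_twisted _ hX hX)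

end Cylinder

lemma cohomologyMap_eq_of_homotopic {X Y : QPComplex p} {f g : X ⟶ Y} (h : Homotopic f g) :
    cohomologyMap f = cohomologyMap g := by
  obtain ⟨h, -, -, hd⟩ := h
  refine LinearMap.ext fun x => ?_
  obtain ⟨⟨x, hx⟩, rfl⟩ := Submodule.Quotient.mk_surjective _ x
  refine (Submodule.Quotient.eq _).mpr ⟨h x, ?_⟩
  change Y.d (h x) = f.toLin x - g.toLin x
  rw [hd, LinearMap.mem_ker.mp hx, map_zero, add_zero]

lemma cohomologyMap_id (X : QPComplex p) : cohomologyMap (𝟙 X) = LinearMap.id := by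
  refine LinearMap.ext fun x => ?_
  obtain ⟨x, rfl⟩ := Submodule.Quotient.mk_surjective _ x
  rfl

end QPComplex

open QPComplex

/-! ### The homotopy category of flat complexes and its localization. -/

section HomotopyCategory

variable {p : ℕ}

/-- Cohomology as a functor on flat complexes. -/
def cohomologyFunctor (p : ℕ) : CFlat p ⥤ ModuleCat (PE p) where
  obj X := ModuleCat.of (PE p) X.obj.Cohomology
  map f := ModuleCat.ofHom (cohomologyMap f.hom)
  map_id X := congrArg ModuleCat.ofHom (cohomologyMap_id X.obj)
  map_comp f g := congrArg ModuleCat.ofHom (cohomologyMap_comp f.hom g.hom)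

/-- Equality in the quotient means equivalence under the congruence generated by homotopy.
Descending cohomology to a functor on the quotient avoids a description of this congruence: maps
with the same class have the same effect on cohomology. -/
lemma inverseImage_quasiIsoKFlat :
    (quasiIso p).inverseImage (isFlat p).ι = (quasiIsoKFlat p).inverseImage (toKFlat p) := by
  ext X Y f
  refine ⟨fun hf => ⟨f, rfl, hf⟩, ?_⟩
  rintro ⟨g, hg, hq⟩
  let H := CategoryTheory.Quotient.lift (homotopyRel p) (cohomologyFunctor p)
    fun _ _ _ _ h => congrArg ModuleCat.ofHom (cohomologyMap_eq_of_homotopic h)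
  have h : cohomologyMap g.hom = cohomologyMap f.hom :=
    congrArg ModuleCat.Hom.hom (congrArg H.map hg)
  change Function.Bijective (cohomologyMap f.hom)
  rw [← h]
  exact hq

variable [Fact p.Prime]

/-- A homotopy is a map out of the cylinder restricting to `f` and `g` on its two ends. Both ends
are sections of the same quasi-isomorphism, so they become equal after localization, and with them
`f` and `g`. -/
lemma homotopyRel_factorsThroughLocalization :
    (homotopyRel p).FactorsThroughLocalization ((quasiIso p).inverseImage (isFlat p).ι) := by
  rintro X Y f g ⟨h, h_mem, h_coaction, hd⟩
  let W := (quasiIso p).inverseImage (isFlat p).ι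
  let Z : CFlat p := ⟨cylinder X.obj, isFlat_cylinder X.property⟩
  let π : Z ⟶ X := ObjectProperty.homMk (cylinderπ X.obj)
  let s : X ⟶ Z := ObjectProperty.homMk (cylinderEnd X.obj 1 0)
  let t : X ⟶ Z := ObjectProperty.homMk (cylinderEnd X.obj 0 1)
  let F : Z ⟶ Y := ObjectProperty.homMk (cylinderDesc f.hom g.hom h h_mem h_coaction hd)
  have hs : s ≫ F = f := ObjectProperty.hom_ext _ (Hom.ext (LinearMap.ext fun x =>
    (cylinderEnd_desc _ _ h h_mem h_coaction hd 1 0 x).trans (by simp)))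
  have ht : t ≫ F = g := ObjectProperty.hom_ext _ (Hom.ext (LinearMap.ext fun x =>
    (cylinderEnd_desc _ _ h h_mem h_coaction hd 0 1 x).trans (by simp)))
  have hst : s ≫ π = t ≫ π := ObjectProperty.hom_ext _ (cylinderEnd_π X.obj)
  change W.Q.map f = W.Q.map g
  have : IsIso (W.Q.map π) := Localization.inverts W.Q W π (quasiIso_cylinderπ X.obj)
  rw [← hs, ← ht, Functor.map_comp, Functor.map_comp]
  congr 1
  rw [← cancel_mono (W.Q.map π), ← Functor.map_comp, ← Functor.map_comp, hst]

/-- The homotopy category of flat complexes, localized at the quasi-isomorphisms, is the derived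
category. -/
theorem exists_equivalence_of_homotopyCategory :
    ∃ Φ : (quasiIsoKFlat p).Localization ⥤ DerivedCat p,
      toKFlat p ⋙ (quasiIsoKFlat p).Q ⋙ Φ = gammaFlat p ∧ Φ.IsEquivalence := by
  let W := (quasiIso p).inverseImage (isFlat p).ι
  have hW : W = (quasiIsoKFlat p).inverseImage (toKFlat p) := inverseImage_quasiIsoKFlat
  have hγ : (gammaFlat p).IsLocalization W := isLocalization_of_resolution (quasiIso p) (toDerived p)
    (isFlat p) (replacement p) (replacementπ p) isFlat_replacement quasiIso_replacementπ
  -- Inverting `W` already identifies homotopic maps, so going through `K_flat` first has the same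
  -- strict universal property. Strictness makes the factorization of `gammaFlat` an equality of
  -- functors.
  have univ := fun (E : Type 1) [Category.{1} E] =>
    homotopyRel_factorsThroughLocalization.strictUniversalPropertyFixedTarget' hW E
  have hQ : (toKFlat p ⋙ (quasiIsoKFlat p).Q).IsLocalization W :=
    Functor.IsLocalization.mk' _ _ (univ _) (univ _)
  let Φ := (univ (DerivedCat p)).lift (gammaFlat p) (Localization.inverts (gammaFlat p) W)
  have hΦ : (toKFlat p ⋙ (quasiIsoKFlat p).Q) ⋙ Φ = gammaFlat p :=
    (univ (DerivedCat p)).fac (gammaFlat p) (Localization.inverts (gammaFlat p) W)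
  refine ⟨Φ, hΦ, ?_⟩
  -- `Φ` compares two localizations of flat complexes at the same class `W`.
  exact Functor.isEquivalence_of_iso
    (Localization.isoUniqFunctor (toKFlat p ⋙ (quasiIsoKFlat p).Q) (gammaFlat p) W Φ
      (eqToIso hΦ)).symm

end HomotopyCategory

end FrankeE1

end

theorem mainTheorem6 (p : ℕ) [Fact p.Prime] (hp : p ≠ 2) :
    (∃ (P : QPComplex p ⥤ QPComplex p) (i : P ⟶ 𝟭 (QPComplex p)),
      ∀ X, isFlat p (P.obj X) ∧ quasiIso p (i.app X)) ∧
    (∃ Φ : (quasiIsoKFlat p).Localization ⥤ DerivedCat p,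
      toKFlat p ⋙ (quasiIsoKFlat p).Q ⋙ Φ = gammaFlat p ∧ Φ.IsEquivalence) ∧
    (∃ (_ : MonoidalCategory (DerivedCat p)) (_ : SymmetricCategory (DerivedCat p))
      (_ : (toDerived p).LaxBraided),
      IsIso (Functor.LaxMonoidal.ε (toDerived p)) ∧
      (tensor (DerivedCat p)).IsLeftDerivedFunctor (laxTensorator (toDerived p))
        ((quasiIso p).prod (quasiIso p)) ∧
      ∀ X Y, isFlat p X → isFlat p Y → IsIso (Functor.LaxMonoidal.μ (toDerived p) X Y)) := by
  exact ⟨⟨QPComplex.replacement p, QPComplex.replacementπ p,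
      fun X => ⟨QPComplex.isFlat_replacement X, QPComplex.quasiIso_replacementπ X⟩⟩,
    exists_equivalence_of_homotopyCategory,
    exists_derived_symmetricCategory (quasiIso p) (toDerived p) (isFlat p) (QPComplex.replacement p)
      (QPComplex.replacementπ p) QPComplex.isFlat_replacement QPComplex.quasiIso_replacementπ⟩
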